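/- Let $\mathfrak S_n$ be the set of permutations $\pi=\pi_1\cdots\pi_n$ of $[n]=\{1,\dots,n\}$ and $\mathrm{SYT}(n)$ the set of standard Young tableaux with $n$ cells (English notation). For $S\in\mathrm{SYT}(n)$ let $K(S)=\{\pi\in\mathfrak S_n : P(\pi)=S\}$ be its Knuth class, where $P(\pi)$ is the Robinson--Schensted insertion tableau of $\pi$. A set $\Pi\subseteq\mathfrak S_n$ is *pattern-Knuth closed* if for every $m\ge 0$ the set $\mathfrak S_m(\Pi)$ of permutations in $\mathfrak S_m$ that avoid every pattern in $\Pi$ is a union of Knuth classes. It is *swap closed* if it is closed under interchanging adjacent elements $\pi_i,\pi_{i+1}$ with $|\pi_i-\pi_{i+1}|>1$. For $J\subseteq[n-1]$ let $D_J^{-1}$ be the set of $\pi\in\mathfrak S_n$ such that $\pi^{-1}$ has descent set $J$. A *superstandard hook* is a tableau of hook shape whose entries are $1,2,\dots,n$ when read row by row (top to bottom, each row left to right), or when read column by column (left to right, each column top to bottom). **Theorem.** Let $S\ne T$ be in $\mathrm{SYT}(n)$ and $\Pi=K(S)\cup K(T)$. The following are equivalent. (i) $\Pi$ is pattern-Knuth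 closed. (ii) $\Pi$ is swap closed. (iii) $\Pi=D_J^{-1}\cup D_L^{-1}$ for some $J,L\subseteq[n-1]$ such that either - $J\neq L$ and each of $J,L$ is $[1,k]$ with $0\le k\le n-1$ or $[k,n-1]$ with $1\le k\le n$ (so $\emptyset$ is allowed); or - $J=L$, and $J$ or its complement $[n-1]\setminus J$ is $[k,n-2]$ with $2\le k\le n-2$ or $[2,k-2]$ with $4\le k\le n$. (iv) Either $S$ and $T$ are both superstandard hooks, or, up to exchanging $S$ and $T$, the pair $(S,T)$ or the pair of transposes $(S^t,T^t)$ is one of the following pairs (tableaux listed by rows, separated by $/$): - for some $2\le k\le n-2$: $S = 1\,2\cdots k\,n\,/\,k{+}1\,/\,k{+}2\,/\cdots/\,n{-}1$ and $T = 1\,2\cdots k\,/\,k{+}1\;\,n\,/\,k{+}2\,/\cdots/\,n{-}1$; - for some $4\le k\le n$: $S = 1\,2\,k\,k{+}1\cdots n\,/\,3\,/\,4\,/\cdots/\,k{-}1$ and $T = 1\,2\,k{+}1\cdots n\,/\,3\,k\,/\,4\,/\cdots/\,k{-}1$. -/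

import Mathlib

open scoped Pointwise

namespace PatternKnuth

/-! ### Standard Young tableaux -/

/-- A standard Young tableau with `n` cells: a Young diagram (English notation, matrix coordinates
starting at `0`) filled bijectively with `1, …, n`, increasing along rows and columns. The
underlying filling is a semistandard tableau; injectivity makes its rows strictly increasing. -/
structure SYT (n : ℕ) where
  /-- the shape -/
  shape : YoungDiagram
  /-- the filling -/
  tab : SemistandardYoungTableau shape
  /-- each of `1, …, n` occurs exactly once, and no other number occurs -/
  bijOn : Set.BijOn (fun c : ℕ × ℕ => tab c.1 c.2) (shape.cells : Set (ℕ × ℕ)) (Set.Icc 1 n)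

namespace SYT

variable {n : ℕ}

/-- The list of rows of a tableau, from top to bottom, each row read from left to right. -/
def rows (S : SYT n) : List (List ℕ) :=
  (List.range (S.shape.colLen 0)).map fun i =>
    (List.range (S.shape.rowLen i)).map fun j => S.tab i j

/-- The transposed tableau. -/
def transpose (S : SYT n) : SYT n where
  shape := S.shape.transpose
  tab :=
    { entry := fun i j => S.tab j i
      row_weak' := fun hj h =>
        (S.tab.col_strict hj (by simpa [YoungDiagram.mem_transpose] using h)).le
      col_strict' := by
        intro i1 i2 j hi h
        have h2 : (j, i2) ∈ S.shape := by simpa [YoungDiagram.mem_transpose] using h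
        have h1 : (j, i1) ∈ S.shape := S.shape.up_left_mem le_rfl hi.le h2
        refine lt_of_le_of_ne (S.tab.row_weak hi h2) fun he => ?_
        have h12 := S.bijOn.injOn (x₁ := (j, i1)) (x₂ := (j, i2))
          (by simpa using h1) (by simpa using h2) he
        simp only [Prod.mk.injEq, true_and] at h12
        exact hi.ne h12
      zeros' := fun h => S.tab.zeros fun h' => h (by simpa [YoungDiagram.mem_transpose] using h') }
  bijOn := by
    refine S.bijOn.comp (g := fun c : ℕ × ℕ => S.tab c.1 c.2) (f := Prod.swap) ?_
    refine ⟨fun c hc => ?_, Prod.swap_injective.injOn, fun c hc => ⟨c.swap, ?_, c.swap_swap⟩⟩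
    · simpa [YoungDiagram.mem_transpose] using hc
    · simpa [YoungDiagram.mem_transpose] using hc

/-- The shape is a hook: every cell lies in the first row or in the first column. -/
def IsHook (S : SYT n) : Prop :=
  ∀ i j, (i, j) ∈ S.shape → i = 0 ∨ j = 0

/-- The first row is filled with `1, …, lam₁`, the second with `lam₁ + 1, …, lam₁ + lam₂`, etc. -/
def IsRowSuperstandard (S : SYT n) : Prop :=
  ∀ i j, (i, j) ∈ S.shape → S.tab i j = ∑ r ∈ Finset.range i, S.shape.rowLen r + j + 1

/-- The same with columns in place of rows. -/
def IsColSuperstandard (S : SYT n) : Prop :=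
  ∀ i j, (i, j) ∈ S.shape → S.tab i j = ∑ c ∈ Finset.range j, S.shape.colLen c + i + 1

/-- A superstandard hook: a row or column superstandard tableau of hook shape. -/
def IsSuperstandardHook (S : SYT n) : Prop :=
  S.IsHook ∧ (S.IsRowSuperstandard ∨ S.IsColSuperstandard)

end SYT

/-! ### Robinson–Schensted insertion and Knuth classes -/

/-- Insert `x` into a row: `x` replaces the leftmost entry larger than `x`, which is bumped out
and returned; if there is no such entry, `x` is put at the end and nothing is bumped.
(`List.range' a m` below is the list `a, a + 1, …, a + m - 1`.) -/
def rowInsert (x : ℕ) : List ℕ → List ℕ × Option ℕ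
  | [] => ([x], none)
  | y :: r =>
    if x < y then (x :: r, some y)
    else (y :: (rowInsert x r).1, (rowInsert x r).2)

/-- Insert `x` into a tableau given by its list of rows: insert `x` into the first row, then the
bumped entry (if any) into the second row, and so on. -/
def tabInsert : ℕ → List (List ℕ) → List (List ℕ)
  | x, [] => [[x]]
  | x, r :: t =>
    match rowInsert x r with
    | (r', none) => r' :: t
    | (r', some y) => r' :: tabInsert y t

/-- The one-line notation `π₁ π₂ … πₙ` of a permutation. -/
def word {n : ℕ} (π : Equiv.Perm (Fin n)) : List ℕ :=
  List.ofFn fun i => (π i : ℕ) + 1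

/-- The (rows of the) insertion tableau `P(π)`: insert `π₁`, `π₂`, …, `πₙ` in this order into the
empty tableau. -/
def insertionTableau {n : ℕ} (π : Equiv.Perm (Fin n)) : List (List ℕ) :=
  (word π).foldl (fun t x => tabInsert x t) []

/-- The Knuth class `K(S) = {π | P(π) = S}`. -/
def K {n : ℕ} (S : SYT n) : Set (Equiv.Perm (Fin n)) :=
  {π | insertionTableau π = S.rows}

/-- A set of permutations of `[n]` that is a union of Knuth classes. -/
def IsUnionOfKnuthClasses {n : ℕ} (A : Set (Equiv.Perm (Fin n))) : Prop :=
  ∃ F : Set (SYT n), A = ⋃ S ∈ F, K S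

/-! ### Pattern containment -/

/-- `σ` contains `π` as a pattern: some subsequence of `σ` is in the same relative order as `π`. -/
def Contains {m k : ℕ} (σ : Equiv.Perm (Fin m)) (π : Equiv.Perm (Fin k)) : Prop :=
  ∃ f : Fin k ↪o Fin m, ∀ i j, σ (f i) < σ (f j) ↔ π i < π j

/-- `𝔖ₘ(Π)`, the permutations of `[m]` avoiding every element of `Π`. -/
def avoiders {k : ℕ} (m : ℕ) (Pi : Set (Equiv.Perm (Fin k))) : Set (Equiv.Perm (Fin m)) :=
  {σ | ∀ π ∈ Pi, ¬ Contains σ π}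

/-- `Π` is pattern-Knuth closed: `𝔖ₘ(Π)` is a union of Knuth classes for all `m`. -/
def PatternKnuthClosed {k : ℕ} (Pi : Set (Equiv.Perm (Fin k))) : Prop :=
  ∀ m : ℕ, IsUnionOfKnuthClasses (avoiders m Pi)

/-! ### Swaps -/

/-- `σ` arises from `π` by interchanging adjacent elements `πᵢ`, `πᵢ₊₁` that differ by more
than `1`. -/
def IsSwap {n : ℕ} (π σ : Equiv.Perm (Fin n)) : Prop :=
  ∃ i j : Fin n, (i : ℕ) + 1 = j ∧ 1 < |((π i : ℕ) : ℤ) - ((π j : ℕ) : ℤ)| ∧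
    σ = π * Equiv.swap i j

/-- `σ` can be obtained from `π` by a (possibly empty) sequence of swaps. -/
def SwapEquiv {n : ℕ} : Equiv.Perm (Fin n) → Equiv.Perm (Fin n) → Prop :=
  Relation.ReflTransGen IsSwap

/-- A set of permutations closed under swap equivalence. -/
def SwapClosed {n : ℕ} (Pi : Set (Equiv.Perm (Fin n))) : Prop :=
  ∀ π ∈ Pi, ∀ σ, SwapEquiv π σ → σ ∈ Pi

/-! ### Descents -/

/-- The descent set `{i ∈ [n-1] | πᵢ > πᵢ₊₁}`, with positions numbered from `1`. -/
def Des {n : ℕ} (π : Equiv.Perm (Fin n)) : Set ℕ :=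
  {i | ∃ a b : Fin n, (a : ℕ) + 1 = i ∧ (b : ℕ) = i ∧ π b < π a}

/-- `D_J`, the permutations of `[n]` with descent set `J`. The set of inverses of its elements
is then the pointwise inverse `(D n J)⁻¹`. -/
def D (n : ℕ) (J : Set ℕ) : Set (Equiv.Perm (Fin n)) :=
  {π | Des π = J}

/-- `J = [1,k]` with `0 ≤ k ≤ n-1`, or `J = [k,n-1]` with `1 ≤ k ≤ n`; in particular `∅` is
allowed. -/
def IsHookDescentSet (n : ℕ) (J : Set ℕ) : Prop :=
  (∃ k, k < n ∧ J = Set.Icc 1 k) ∨ (∃ k, 1 ≤ k ∧ k ≤ n ∧ J = Set.Icc k (n - 1))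

/-- `J = [k,n-2]` with `2 ≤ k ≤ n-2`, or `J = [2,k-2]` with `4 ≤ k ≤ n`. -/
def IsBasicPairDescentSet (n : ℕ) (J : Set ℕ) : Prop :=
  (∃ k, 2 ≤ k ∧ k + 2 ≤ n ∧ J = Set.Icc k (n - 2)) ∨
    (∃ k, 4 ≤ k ∧ k ≤ n ∧ J = Set.Icc 2 (k - 2))

/-- The descent sets of the displayed pairs and of their transposes; transposing a tableau
replaces its descent set by the complement in `[n-1]`. -/
def IsPairDescentSet (n : ℕ) (J : Set ℕ) : Prop :=
  IsBasicPairDescentSet n J ∨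
    ∃ I, IsBasicPairDescentSet n I ∧ J = Set.Icc 1 (n - 1) \ I

/-! ### The two families of tableau pairs -/

/-- For some `2 ≤ k ≤ n-2`, the tableau `S` is the hook with first row `1, 2, …, k, n` and
remaining entries `k+1, …, n-1` down the first column, and `T` has first row `1, 2, …, k`, second
row `k+1, n`, and remaining entries `k+2, …, n-1` down the first column. -/
def IsFirstPair {n : ℕ} (S T : SYT n) : Prop :=
  ∃ k, 2 ≤ k ∧ k + 2 ≤ n ∧
    S.rows = (List.range' 1 k ++ [n]) :: (List.range' (k + 1) (n - 1 - k)).map (fun x => [x]) ∧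
    T.rows = List.range' 1 k :: [k + 1, n] ::
      (List.range' (k + 2) (n - 2 - k)).map (fun x => [x])

/-- For some `4 ≤ k ≤ n`, the tableau `S` is the hook with first row `1, 2, k, k+1, …, n` and
remaining entries `3, …, k-1` down the first column, and `T` has first row `1, 2, k+1, …, n`,
second row `3, k`, and remaining entries `4, …, k-1` down the first column. -/
def IsSecondPair {n : ℕ} (S T : SYT n) : Prop :=
  ∃ k, 4 ≤ k ∧ k ≤ n ∧
    S.rows = (1 :: 2 :: List.range' k (n + 1 - k)) ::
      (List.range' 3 (k - 3)).map (fun x => [x]) ∧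
    T.rows = (1 :: 2 :: List.range' (k + 1) (n - k)) :: [3, k] ::
      (List.range' 4 (k - 4)).map (fun x => [x])

/-- The ordered pair `(S, T)`, or the pair of its transposes, is one of the displayed pairs. -/
def IsDisplayedPair {n : ℕ} (S T : SYT n) : Prop :=
  IsFirstPair S T ∨ IsSecondPair S T ∨
    IsFirstPair S.transpose T.transpose ∨ IsSecondPair S.transpose T.transpose

end PatternKnuth

/-! All arguments are about words up to Knuth equivalence `KE`. By `KE_iff_insWord_eq` the sets K(S)
are the Knuth classes of words in 1, …, n. The inverse descent set `desWord` is constant on a class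
and equals the descent set of the tableau.

(iii) ⇒ (ii): exchanging adjacent letters that differ by more than 1 never changes the relative
order of i and i+1, so every inverse descent class is swap closed.

(ii) ⇒ (i), `HasPattern.swap`: a Knuth move exchanges neighbours p and q beside a letter y whose
value lies between them. If an occurrence of a pattern uses p, q and some letter of intermediate
value, the move swaps two pattern letters that differ by more than 1. If it uses p and q but no such
letter, then y can stand in for p or for q.

(i) ⇒ (iii) is the long part. Only permutations of length n+1 are needed; for these, containment
means deletion of one letter (`DelClosed`). In tableau terms `Ext w k` says that k lies in the first
row or the first column, so a class has hook shape exactly if `Ext` holds for all letters. Suppose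
that it fails for n, and that n-1 precedes n (otherwise reverse). Choose a word α n u γ of the class
with n as far right as possible. Inserting suitable letters into it and applying Knuth moves forces
the partner to be the class of α u n γ (`ke_swap_of_delClosed`). The partner therefore agrees with
the given class below n but lets n move further right. This cannot hold in both directions, so one
of the two classes is a hook (`hook_or_hook_of_delClosed`).

A hook class is determined by its descent set J (`ke_vWord`). If membership in J changes at most
once along 1, …, n-1 (`NoPattern`), the class is a superstandard hook. Otherwise cut at the first
second change. Up to reversal the truncated hook is the class of `hookW p q`, and its partner must
be that of `bumpW p q` (`ke_bumpW_of_delClosed`). Above the cut the partner satisfies `Ext`.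
Comparing this with the same statement for the reverse complements shows that J is a single
interval, and `not_delClosed_bumpW` forces the interval to begin at 2 or to end at n-2.

(iii) ⇔ (iv): a hook descent set belongs to one tableau only, a superstandard hook. The descent set
[k,n-2] belongs to at most two tableaux, because every row is forced except that of n, which is the
first or second. Evacuation and transposition carry this to the other pair types. -/

namespace PatternKnuth

/-! ### Knuth equivalence of words -/

/-- An elementary Knuth transformation of a word. -/
inductive KStep : List ℕ → List ℕ → Prop
  | left (a b : List ℕ) {x y z : ℕ} (hxy : x < y) (hyz : y < z) :
      KStep (a ++ y :: x :: z :: b) (a ++ y :: z :: x :: b)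
  | right (a b : List ℕ) {x y z : ℕ} (hxy : x < y) (hyz : y < z) :
      KStep (a ++ x :: z :: y :: b) (a ++ z :: x :: y :: b)

/-- Knuth equivalence of words. -/
def KE : List ℕ → List ℕ → Prop := Relation.EqvGen KStep

namespace KE

@[refl] theorem refl (w : List ℕ) : KE w w := Relation.EqvGen.refl w

theorem symm {w v : List ℕ} (h : KE w v) : KE v w := Relation.EqvGen.symm _ _ h

theorem trans {w v u : List ℕ} (h : KE w v) (h' : KE v u) : KE w u :=
  Relation.EqvGen.trans _ _ _ h h'

theorem of_step {w v : List ℕ} (h : KStep w v) : KE w v := Relation.EqvGen.rel _ _ h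

theorem of_eq {w v : List ℕ} (h : w = v) : KE w v := h ▸ refl w

theorem left (a b : List ℕ) {x y z : ℕ} (hxy : x < y) (hyz : y < z) :
    KE (a ++ y :: x :: z :: b) (a ++ y :: z :: x :: b) := of_step (.left a b hxy hyz)

theorem right (a b : List ℕ) {x y z : ℕ} (hxy : x < y) (hyz : y < z) :
    KE (a ++ x :: z :: y :: b) (a ++ z :: x :: y :: b) := of_step (.right a b hxy hyz)

theorem lift (f : List ℕ → List ℕ) (hf : ∀ w v, KStep w v → KE (f w) (f v)) {w v : List ℕ}
    (h : KE w v) : KE (f w) (f v) := by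
  induction h with
  | rel _ _ h => exact hf _ _ h
  | refl _ => exact refl _
  | symm _ _ _ ih => exact ih.symm
  | trans _ _ _ _ _ ih ih' => exact ih.trans ih'

theorem append_left (a : List ℕ) {w v : List ℕ} (h : KE w v) : KE (a ++ w) (a ++ v) := by
  refine lift (a ++ ·) ?_ h
  rintro _ _ (⟨c, d, h1, h2⟩ | ⟨c, d, h1, h2⟩)
  · simpa using left (a ++ c) d h1 h2
  · simpa using right (a ++ c) d h1 h2

theorem append_right (b : List ℕ) {w v : List ℕ} (h : KE w v) : KE (w ++ b) (v ++ b) := by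
  refine lift (· ++ b) ?_ h
  rintro _ _ (⟨c, d, h1, h2⟩ | ⟨c, d, h1, h2⟩)
  · simpa using left c (d ++ b) h1 h2
  · simpa using right c (d ++ b) h1 h2

theorem cons (a : ℕ) {w v : List ℕ} (h : KE w v) : KE (a :: w) (a :: v) := h.append_left [a]

theorem reverse {w v : List ℕ} (h : KE w v) : KE w.reverse v.reverse := by
  refine lift List.reverse ?_ h
  rintro _ _ (⟨c, d, h1, h2⟩ | ⟨c, d, h1, h2⟩)
  · simpa using (right d.reverse c.reverse h1 h2).symm
  · simpa using (left d.reverse c.reverse h1 h2).symm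

/-- Reversing the order of values keeps the middle letter of x < y < z, so each move becomes a move
of the same kind read backwards. Membership of the letters in s is carried along since the
equivalence runs through intermediate words in both directions. -/
theorem map_of_strictAntiOn {f : ℕ → ℕ} {s : Set ℕ} (hf : StrictAntiOn f s) {w v : List ℕ}
    (h : KE w v) : (∀ x ∈ w, x ∈ s) → KE (w.map f) (v.map f) := by
  have key : ∀ w v, KE w v → ((∀ x ∈ w, x ∈ s) ↔ ∀ x ∈ v, x ∈ s) ∧
      ((∀ x ∈ w, x ∈ s) → KE (w.map f) (v.map f)) := by
    intro w v h
    induction h with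
    | rel _ _ h =>
      rcases h with ⟨c, d, h1, h2⟩ | ⟨c, d, h1, h2⟩
      · refine ⟨by simp only [List.mem_append, List.mem_cons]; grind, fun hs => ?_⟩
        simp only [List.mem_append, List.mem_cons] at hs
        have hx := hs _ (.inr (.inr (.inl rfl)))
        have hy := hs _ (.inr (.inl rfl))
        have hz := hs _ (.inr (.inr (.inr (.inl rfl))))
        simpa using (left (c.map f) (d.map f) (hf hy hz h2) (hf hx hy h1)).symm
      · refine ⟨by simp only [List.mem_append, List.mem_cons]; grind, fun hs => ?_⟩
        simp only [List.mem_append, List.mem_cons] at hs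
        have hx := hs _ (.inr (.inl rfl))
        have hz := hs _ (.inr (.inr (.inl rfl)))
        have hy := hs _ (.inr (.inr (.inr (.inl rfl))))
        simpa using (right (c.map f) (d.map f) (hf hy hz h2) (hf hx hy h1)).symm
    | refl _ => exact ⟨Iff.rfl, fun _ => refl _⟩
    | symm _ _ _ ih => exact ⟨ih.1.symm, fun hs => (ih.2 (ih.1.2 hs)).symm⟩
    | trans _ _ _ _ _ ih ih' =>
      exact ⟨ih.1.trans ih'.1, fun hs => (ih.2 hs).trans (ih'.2 (ih.1.1 hs))⟩
  exact (key w v h).2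

/-- By convexity, if the witness y of a move is dropped then x or z is dropped too, and the move
becomes trivial. -/
theorem filter {p : ℕ → Bool} (hp : ∀ x y z, x < y → y < z → p x → p z → p y) {w v : List ℕ}
    (h : KE w v) : KE (w.filter p) (v.filter p) := by
  refine lift (List.filter p) ?_ h
  rintro _ _ (⟨c, d, h1, h2⟩ | ⟨c, d, h1, h2⟩)
  · rename_i x y z
    have := hp x y z h1 h2
    simp only [List.filter_append, List.filter_cons]
    by_cases hx : p x <;> by_cases hy : p y <;> by_cases hz : p z <;> simp_all
    · exact left _ _ h1 h2
    all_goals rfl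
  · rename_i x y z
    have := hp x y z h1 h2
    simp only [List.filter_append, List.filter_cons]
    by_cases hx : p x <;> by_cases hy : p y <;> by_cases hz : p z <;> simp_all
    · exact right _ _ h1 h2
    all_goals rfl

theorem perm {w v : List ℕ} (h : KE w v) : w.Perm v := by
  induction h with
  | rel _ _ h =>
    rcases h with ⟨c, d, h1, h2⟩ | ⟨c, d, h1, h2⟩
    · exact List.Perm.append_left _ ((List.Perm.swap _ _ _).cons _)
    · exact List.Perm.append_left _ (List.Perm.swap _ _ _)
  | refl _ => exact List.Perm.refl _
  | symm _ _ _ ih => exact ih.symm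
  | trans _ _ _ _ _ ih ih' => exact ih.trans ih'

theorem eq_of_length_le_two {w v : List ℕ} (h : KE w v) (hw : w.length ≤ 2) : w = v := by
  have key : ∀ w v, KE w v → w.length = v.length ∧ (w.length ≤ 2 → w = v) := by
    intro w v h
    induction h with
    | rel _ _ h =>
      rcases h with ⟨c, d, h1, h2⟩ | ⟨c, d, h1, h2⟩
      · refine ⟨by simp, fun h => ?_⟩
        simp at h; omega
      · refine ⟨by simp, fun h => ?_⟩
        simp at h; omega
    | refl _ => exact ⟨rfl, fun _ => rfl⟩
    | symm _ _ _ ih => exact ⟨ih.1.symm, fun h => (ih.2 (ih.1 ▸ h)).symm⟩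
    | trans _ _ _ _ _ ih ih' =>
      exact ⟨ih.1.trans ih'.1, fun h => (ih.2 h).trans (ih'.2 (ih.1 ▸ h))⟩
  exact (key w v h).2 hw

end KE

/-! ### Insertion and Knuth equivalence -/

theorem mem_rowInsert {x v : ℕ} {r : List ℕ} (h : v ∈ (rowInsert x r).1) : v = x ∨ v ∈ r := by
  induction r with
  | nil => simpa [rowInsert] using h
  | cons a r ih =>
    simp only [rowInsert] at h
    split at h <;> simp at h ⊢ <;> tauto

theorem rowInsert_perm (x : ℕ) (r : List ℕ) :
    ((rowInsert x r).1 ++ (rowInsert x r).2.toList).Perm (x :: r) := by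
  induction r with
  | nil => simp [rowInsert]
  | cons a r ih =>
    simp only [rowInsert]
    split
    · simp
    · simpa using (ih.cons a).trans (List.Perm.swap _ _ _)

theorem rowInsert_bumped {x y : ℕ} {r : List ℕ} (h : (rowInsert x r).2 = some y) :
    x < y ∧ y ∈ r := by
  induction r with
  | nil => simp [rowInsert] at h
  | cons a r ih =>
    simp only [rowInsert] at h
    split at h
    · simp at h; subst h; simp; assumption
    · have := ih h; simp; tauto

theorem rowInsert_pairwise {x : ℕ} {r : List ℕ} (hr : r.Pairwise (· < ·)) (hx : x ∉ r) :
    (rowInsert x r).1.Pairwise (· < ·) := by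
  induction r with
  | nil => simp [rowInsert]
  | cons a r ih =>
    simp only [List.pairwise_cons, List.mem_cons, not_or] at hr hx
    simp only [rowInsert]
    split
    · rename_i h
      exact List.pairwise_cons.2 ⟨fun v hv => h.trans (hr.1 v hv), hr.2⟩
    · rename_i h
      refine List.pairwise_cons.2 ⟨fun v hv => ?_, ih hr.2 hx.2⟩
      rcases mem_rowInsert hv with rfl | hv
      · omega
      · exact hr.1 v hv

theorem rowInsert_eq_none {x : ℕ} {r : List ℕ} (h : (rowInsert x r).2 = none) :
    (rowInsert x r).1 = r ++ [x] := by
  induction r with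
  | nil => simp [rowInsert]
  | cons a r ih =>
    simp only [rowInsert] at h ⊢
    split at h
    · simp at h
    · rename_i h'
      simp [h', ih h]

/-- The letter x moves left past one larger letter at a time; the row entry in front of the
exchanged pair is the witness. -/
theorem KE.cons_append_of_pairwise {x y : ℕ} {b : List ℕ} (hxy : x < y)
    (hb : (y :: b).Pairwise (· < ·)) : KE (y :: b ++ [x]) (y :: x :: b) := by
  induction b generalizing y with
  | nil => exact KE.refl _
  | cons c b ih =>
    simp only [List.pairwise_cons, List.mem_cons, forall_eq_or_imp] at hb
    have h1 := (ih (hxy.trans hb.1.1) (List.pairwise_cons.2 hb.2)).cons y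
    exact h1.trans (KE.left [] b hxy hb.1.1).symm

/-- The appended letter x moves left up to the place of the bumped letter y; then y moves left to
the front, each time with the next letter of the new row as witness. -/
theorem KE.rowInsert_some {x y : ℕ} {r : List ℕ} (hr : r.Pairwise (· < ·)) (hx : x ∉ r)
    (h : (rowInsert x r).2 = some y) : KE (r ++ [x]) (y :: (rowInsert x r).1) := by
  induction r with
  | nil => simp [rowInsert] at h
  | cons a r ih =>
    simp only [rowInsert] at h ⊢
    split at h
    · rename_i hxa
      simp only [Option.some.injEq] at h
      subst h
      simp only [hxa, if_true]
      exact KE.cons_append_of_pairwise hxa hr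
    · rename_i hxa
      simp only [hxa, if_false]
      simp only [List.pairwise_cons, List.mem_cons, not_or] at hr hx
      have h1 := (ih hr.2 hx.2 h).cons a
      refine h1.trans ?_
      have hb := rowInsert_bumped h
      cases r with
      | nil => simp at hb
      | cons c r =>
        simp only [rowInsert]
        split
        · exact KE.right [] _ (by omega) hb.1
        · refine KE.right [] _ (hr.1 c (by simp)) ?_
          rename_i hxc
          have := hb.1
          simp only [List.mem_cons] at hx
          omega

/-- The row reading word: rows from bottom to top. -/
def rowWord (t : List (List ℕ)) : List ℕ := t.reverse.flatten

theorem rowWord_cons (r : List ℕ) (t : List (List ℕ)) : rowWord (r :: t) = rowWord t ++ r := by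
  simp [rowWord]

theorem tabInsert_perm (x : ℕ) (t : List (List ℕ)) :
    (rowWord (tabInsert x t)).Perm (x :: rowWord t) := by
  induction t generalizing x with
  | nil => simp [tabInsert, rowWord]
  | cons r t ih =>
    have h := rowInsert_perm x r
    rcases hri : rowInsert x r with ⟨r', _ | y⟩
    · simp only [tabInsert, hri, rowWord_cons]
      simp only [hri, Option.toList_none, List.append_nil] at h
      exact (h.append_left _).trans List.perm_middle
    · simp only [tabInsert, hri, rowWord_cons]
      simp only [hri, Option.toList_some] at h
      refine ((ih y).append_right r').trans ?_
      have h2 := (((List.perm_append_singleton y r').symm.trans h).append_left (rowWord t)).trans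
        (List.perm_middle)
      exact (List.perm_middle.symm.trans h2)

theorem tabInsert_sorted {x : ℕ} {t : List (List ℕ)} (ht : ∀ r ∈ t, r.Pairwise (· < ·))
    (hx : (x :: rowWord t).Nodup) : ∀ r ∈ tabInsert x t, r.Pairwise (· < ·) := by
  induction t generalizing x with
  | nil => simp [tabInsert]
  | cons r t ih =>
    rw [rowWord_cons] at hx
    simp only [List.mem_cons, forall_eq_or_imp] at ht
    simp only [List.nodup_cons, List.mem_append, not_or, List.nodup_append'] at hx
    have hs := rowInsert_pairwise ht.1 hx.1.2
    rcases hri : rowInsert x r with ⟨r', _ | y⟩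
    · simp only [hri] at hs
      simp only [tabInsert, hri, List.mem_cons, forall_eq_or_imp]
      exact ⟨hs, ht.2⟩
    · simp only [hri] at hs
      simp only [tabInsert, hri, List.mem_cons, forall_eq_or_imp]
      refine ⟨hs, ih ht.2 (List.nodup_cons.2 ⟨fun hy => ?_, hx.2.1⟩)⟩
      exact hx.2.2.2 hy (rowInsert_bumped (by rw [hri])).2

theorem KE.tabInsert {x : ℕ} {t : List (List ℕ)} (ht : ∀ r ∈ t, r.Pairwise (· < ·))
    (hx : (x :: rowWord t).Nodup) : KE (rowWord t ++ [x]) (rowWord (tabInsert x t)) := by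
  induction t generalizing x with
  | nil => exact KE.refl _
  | cons r t ih =>
    rw [rowWord_cons] at hx
    simp only [List.mem_cons, forall_eq_or_imp] at ht
    simp only [List.nodup_cons, List.mem_append, not_or, List.nodup_append'] at hx
    have hn := @rowInsert_eq_none x r
    have hk := @KE.rowInsert_some x
    rcases hri : rowInsert x r with ⟨r', _ | y⟩
    · simp only [hri, forall_const] at hn
      simp [PatternKnuth.tabInsert, hri, rowWord_cons, hn, KE.refl]
    · simp only [PatternKnuth.tabInsert, hri, rowWord_cons]
      have h1 := (hk (y := y) ht.1 hx.1.2 (by rw [hri])).append_left (rowWord t)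
      rw [hri] at h1
      have h2 := (ih (x := y) ht.2 (List.nodup_cons.2 ⟨fun hy =>
        hx.2.2.2 hy (rowInsert_bumped (by rw [hri])).2, hx.2.1⟩)).append_right r'
      refine KE.trans ?_ (KE.trans h1 ?_)
      · simp [KE.refl]
      · simpa using h2

/-- Insertion of a word into a tableau. -/
def insWord (t : List (List ℕ)) (w : List ℕ) : List (List ℕ) :=
  w.foldl (fun t x => tabInsert x t) t

theorem insWord_spec {t : List (List ℕ)} {w : List ℕ} (ht : ∀ r ∈ t, r.Pairwise (· < ·))
    (hw : (rowWord t ++ w).Nodup) :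
    (∀ r ∈ insWord t w, r.Pairwise (· < ·)) ∧ KE (rowWord t ++ w) (rowWord (insWord t w)) := by
  induction w generalizing t with
  | nil => simpa [insWord, KE.refl] using ht
  | cons x w ih =>
    have hw' : (x :: rowWord t ++ w).Nodup := (List.perm_middle.nodup_iff).1 hw
    have hx : (x :: rowWord t).Nodup := hw'.of_append_left
    have h1 := tabInsert_sorted ht hx
    have h2 : (rowWord (tabInsert x t) ++ w).Nodup :=
      (((tabInsert_perm x t).append_right w).nodup_iff).2 hw'
    have h3 := ih h1 h2
    refine ⟨h3.1, ?_⟩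
    have h4 := ((KE.tabInsert ht hx).append_right w).trans h3.2
    simpa [insWord] using h4

/-- A word is Knuth equivalent to the reading word of its insertion tableau. -/
theorem KE.rowWord_insWord {w : List ℕ} (hw : w.Nodup) : KE w (rowWord (insWord [] w)) := by
  simpa [rowWord] using (insWord_spec (t := []) (w := w) (by simp) (by simpa [rowWord] using hw)).2

/-! ### Invariance of the insertion tableau under Knuth moves -/

/-- Insertion of a word into a row, with the word of bumped letters. -/
def rowInsWord : List ℕ → List ℕ → List ℕ × List ℕ
  | r, [] => (r, [])
  | r, x :: w =>
    ((rowInsWord (rowInsert x r).1 w).1,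
      (rowInsert x r).2.toList ++ (rowInsWord (rowInsert x r).1 w).2)

theorem insWord_cons (r : List ℕ) (t : List (List ℕ)) (w : List ℕ) :
    insWord (r :: t) w = (rowInsWord r w).1 :: insWord t (rowInsWord r w).2 := by
  induction w generalizing r t with
  | nil => simp [insWord, rowInsWord]
  | cons x w ih =>
    simp only [insWord, List.foldl_cons] at ih ⊢
    rcases hri : rowInsert x r with ⟨r', _ | y⟩
    · simp [tabInsert, rowInsWord, hri, ih]
    · simp [tabInsert, rowInsWord, hri, ih]

theorem insWord_nil {w : List ℕ} (hw : w ≠ []) : insWord [] w = insWord [[]] w := by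
  cases w with
  | nil => exact absurd rfl hw
  | cons x w => simp [insWord, tabInsert, rowInsert]

/-- A Knuth transformation of a word of three letters. -/
inductive KTriple : List ℕ → List ℕ → Prop
  | left {x y z : ℕ} (hxy : x < y) (hyz : y < z) : KTriple [y, x, z] [y, z, x]
  | right {x y z : ℕ} (hxy : x < y) (hyz : y < z) : KTriple [x, z, y] [z, x, y]

theorem rowInsert_all_lt {x : ℕ} {r : List ℕ} (h : ∀ v ∈ r, v < x) :
    rowInsert x r = (r ++ [x], none) := by
  induction r with
  | nil => rfl
  | cons a r ih =>
    simp only [List.mem_cons, forall_eq_or_imp] at h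
    simp [rowInsert, ih h.2, h.1.le.not_gt]

/-- Row bumping for y followed by a larger z: the second bumping path ends strictly to the right of
the first. -/
theorem rowInsert_two_up {y z : ℕ} (hyz : y < z) {r : List ℕ} (hr : r.Pairwise (· < ·)) :
    (∃ r', rowInsert y r = (r', none) ∧ (rowInsert z r').2 = none) ∨
    (∃ r' b, rowInsert y r = (r', some b) ∧
      ((rowInsert z r').2 = none ∨ ∃ b', b < b' ∧ (rowInsert z r').2 = some b')) := by
  induction r with
  | nil => left; simp [rowInsert, hyz.le.not_gt]
  | cons a r ih =>
    simp only [List.pairwise_cons] at hr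
    by_cases hya : y < a
    · right
      refine ⟨y :: r, a, by simp [rowInsert, hya], ?_⟩
      simp only [rowInsert, hyz.le.not_gt, if_false]
      rcases h : (rowInsert z r).2 with _ | b'
      · exact .inl rfl
      · exact .inr ⟨b', hr.1 _ (rowInsert_bumped h).2, rfl⟩
    · have hza : ¬ z < a := by omega
      rcases ih hr.2 with ⟨r', h1, h2⟩ | ⟨r', b, h1, h2⟩
      · left; exact ⟨a :: r', by simp [rowInsert, hya, h1], by simp [rowInsert, hza, h2]⟩
      · right; exact ⟨a :: r', b, by simp [rowInsert, hya, h1], by simpa [rowInsert, hza] using h2⟩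

/-- Row bumping for z followed by a smaller y: after z is in the row, y always finds a larger entry
to bump. -/
theorem rowInsert_two_down {y z : ℕ} (hyz : y < z) (r : List ℕ) :
    ∃ r' b r'' c, rowInsert z r = (r', b) ∧ rowInsert y r' = (r'', some c) ∧ c ≤ z ∧
      (c = z ∨ c ∈ r) ∧ ∀ b' ∈ b, z < b' := by
  induction r with
  | nil => exact ⟨[z], none, [y], z, by simp [rowInsert, hyz]⟩
  | cons a r ih =>
    by_cases hza : z < a
    · exact ⟨z :: r, some a, y :: r, z, by simp [rowInsert, hza, hyz]⟩
    · obtain ⟨r', b, r'', c, h1, h2, h3, h4, h5⟩ := ih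
      by_cases hya : y < a
      · exact ⟨a :: r', b, y :: r', a, by simp [rowInsert, hza, h1], by simp [rowInsert, hya],
          by omega, by simp, h5⟩
      · exact ⟨a :: r', b, a :: r'', c, by simp [rowInsert, hza, h1], by simp [rowInsert, hya, h2],
          h3, by simp; tauto, h5⟩

/-- Entries below x are passed over. At the first entry a above x, the two bumping lemmas describe
what the three letters push down. Bumped words of three letters form a Knuth triple again, whose
kind and direction may change; shorter ones coincide. This is what lets invariance pass from one row
to the next. -/
theorem rowInsWord_triple {u v r : List ℕ} (h : KTriple u v) (hr : r.Pairwise (· < ·))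
    (hu : ∀ x ∈ u, x ∉ r) :
    (rowInsWord r u).1 = (rowInsWord r v).1 ∧
      ((rowInsWord r u).2 = (rowInsWord r v).2 ∨ KTriple (rowInsWord r u).2 (rowInsWord r v).2 ∨
        KTriple (rowInsWord r v).2 (rowInsWord r u).2) := by
  induction r with
  | nil =>
    rcases h with ⟨h1, h2⟩ | ⟨h1, h2⟩ <;> rename_i x y z
    · simp [rowInsWord, rowInsert, h1, h2.le.not_gt, (h1.trans h2).le.not_gt]
    · simp [rowInsWord, rowInsert, h1.le.not_gt, h2, (h1.trans h2), (h1.trans h2).le.not_gt]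
  | cons a r ih =>
    have hr' := List.pairwise_cons.1 hr
    replace ih := ih hr'.2 (fun x hx hxr => hu x hx (List.mem_cons_of_mem _ hxr))
    have key : (∀ x ∈ u, a < x) → (∀ w : List ℕ, (∀ x ∈ w, a < x) → ∀ r : List ℕ,
        rowInsWord (a :: r) w = (a :: (rowInsWord r w).1, (rowInsWord r w).2)) := by
      intro _ w
      induction w with
      | nil => simp [rowInsWord]
      | cons c w ihw =>
        intro hw r
        simp only [List.mem_cons, forall_eq_or_imp] at hw
        simp [rowInsWord, rowInsert, hw.1.le.not_gt, ihw hw.2]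
    rcases h with ⟨h1, h2⟩ | ⟨h1, h2⟩ <;> rename_i x y z
    · simp only [List.mem_cons, List.not_mem_nil, or_false, forall_eq_or_imp, forall_eq,
        not_or] at hu
      obtain ⟨⟨hya, hyr⟩, ⟨hxa, hxr⟩, hza, hzr⟩ := hu
      by_cases ha : a < x
      · rw [key (by simp; omega) _ (by simp; omega), key (by simp; omega) _ (by simp; omega)]
        simpa using ih
      · have hxa' : x < a := by omega
        by_cases hy : y < a
        · have hxz : ¬ z < x := by omega
          have hyz : ¬ z < y := by omega
          simp only [rowInsWord, rowInsert, hy, h1, hxz, hyz, if_true, if_false]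
          refine ⟨trivial, ?_⟩
          rcases hz : (rowInsert z r).2 with _ | b
          · left; simp
          · right; left
            simpa using KTriple.left hy (hr'.1 b (rowInsert_bumped hz).2)
        · have hza' : ¬ z < a := by omega
          have hxz : ¬ z < x := by omega
          simp only [rowInsWord, rowInsert, hy, hza', hxa', hxz, if_true, if_false]
          refine ⟨trivial, ?_⟩
          rcases rowInsert_two_up h2 hr'.2 with ⟨r', h3, h4⟩ | ⟨r', b, h3, h4⟩
          · left; simp [h3, h4]
          · have hab := hr'.1 b (rowInsert_bumped (by rw [h3])).2
            rcases h4 with h4 | ⟨b', hb, h4⟩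
            · left; simp [h3, h4]
            · right; left; simpa [h3, h4] using KTriple.left hab hb
    · simp only [List.mem_cons, List.not_mem_nil, or_false, forall_eq_or_imp, forall_eq,
        not_or] at hu
      obtain ⟨⟨hxa, hxr⟩, ⟨hza, hzr⟩, hya, hyr⟩ := hu
      by_cases ha : a < x
      · rw [key (by simp; omega) _ (by simp; omega), key (by simp; omega) _ (by simp; omega)]
        simpa using ih
      · have hxa' : x < a := by omega
        have hxz : ¬ z < x := by omega
        have hxy : ¬ y < x := by omega
        by_cases hz : z < a
        · have hxz' : x < z := by omega
          simp only [rowInsWord, rowInsert, hz, hxa', hxz', hxz, hxy, if_true, if_false]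
          cases r with
          | nil => simp [rowInsert, h2]
          | cons t r =>
            have hat := hr'.1 t (by simp)
            have hzt : z < t := by omega
            have hyt : y < t := by omega
            simp only [rowInsert, hzt, h2, hyt, if_true]
            exact ⟨trivial, .inr (.inr (by simpa using KTriple.left hz hat))⟩
        · obtain ⟨r', b, r'', c, h3, h4, h5, h6, h7⟩ := rowInsert_two_down h2 r
          have hac : a < c := by
            rcases h6 with rfl | h6
            · omega
            · exact hr'.1 c h6
          simp only [rowInsWord, rowInsert, hz, hxa', hxz, hxy, h3, h4, if_true, if_false]
          refine ⟨trivial, ?_⟩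
          rcases b with _ | b
          · left; simp
          · right; left
            simpa using KTriple.right hac (h5.trans_lt (h7 b rfl))

theorem insWord_triple {u v : List ℕ} {t : List (List ℕ)} (h : KTriple u v)
    (ht : ∀ r ∈ t, r.Pairwise (· < ·)) (hu : (rowWord t ++ u).Nodup) :
    insWord t u = insWord t v := by
  induction t generalizing u v with
  | nil =>
    have hu0 : u ≠ [] := by rcases h with _ | _ <;> simp
    have hv0 : v ≠ [] := by rcases h with _ | _ <;> simp
    rw [insWord_nil hu0, insWord_nil hv0, insWord_cons, insWord_cons]
    rcases h with ⟨h1, h2⟩ | ⟨h1, h2⟩ <;> rename_i x y z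
    · simp [rowInsWord, rowInsert, h1, h2.le.not_gt, (h1.trans h2).le.not_gt]
    · simp [rowInsWord, rowInsert, h1.le.not_gt, h2, (h1.trans h2), (h1.trans h2).le.not_gt]
  | cons r t ih =>
    simp only [List.mem_cons, forall_eq_or_imp] at ht
    rw [rowWord_cons, List.append_assoc, List.nodup_append'] at hu
    have hru := (List.nodup_append'.1 hu.2.1)
    obtain ⟨h1, h2⟩ := rowInsWord_triple h ht.1 (fun x hx hxr => hru.2.2 hxr hx)
    rw [insWord_cons, insWord_cons, h1]
    have hperm : ∀ (w r : List ℕ), ((rowInsWord r w).2 ++ (rowInsWord r w).1).Perm (r ++ w) := by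
      intro w
      induction w with
      | nil => simp [rowInsWord]
      | cons c w ihw =>
        intro r
        simp only [rowInsWord, List.append_assoc]
        refine ((ihw _).append_left _).trans ?_
        rw [← List.append_assoc]
        refine (((List.perm_append_comm.trans (rowInsert_perm c r))).append_right w).trans ?_
        exact List.perm_middle.symm
    have huv : u.Perm v := by
      rcases h with ⟨_, _⟩ | ⟨_, _⟩
      · exact (List.Perm.swap _ _ _).cons _
      · exact List.Perm.swap _ _ _
    have hnd : ∀ w, u.Perm w → (rowWord t ++ (rowInsWord r w).2).Nodup := fun w hw => by
      have h0 := (hw.append_left r).nodup hu.2.1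
      have h3 := (hperm w r).symm.nodup h0
      refine List.nodup_append'.2 ⟨hu.1, h3.of_append_left, fun a ha ha' => ?_⟩
      exact hu.2.2 ha ((hw.append_left r).mem_iff.2
        ((hperm w r).subset (List.mem_append_left _ ha')))
    rcases h2 with h2 | h2 | h2
    · rw [h2]
    · rw [ih h2 ht.2 (hnd u (List.Perm.refl u))]
    · rw [ih h2 ht.2 (hnd v huv)]

theorem insWord_append (t : List (List ℕ)) (w v : List ℕ) :
    insWord t (w ++ v) = insWord (insWord t w) v := by simp [insWord]

theorem insWord_eq_of_step {w v : List ℕ} (h : KStep w v) (hw : w.Nodup) :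
    insWord [] w = insWord [] v := by
  have key : ∀ a u u' b : List ℕ, KTriple u u' → (a ++ (u ++ b)).Nodup →
      insWord [] (a ++ (u ++ b)) = insWord [] (a ++ (u' ++ b)) := by
    intro a u u' b hu hn
    simp only [insWord_append]
    rw [insWord_triple hu (insWord_spec (t := []) (by simp) (by simpa [rowWord] using hn.of_append_left)).1]
    have h1 := (KE.rowWord_insWord (hn.of_append_left)).perm
    rw [← List.append_assoc] at hn
    exact (h1.append_right u).nodup hn.of_append_left
  rcases h with ⟨a, b, h1, h2⟩ | ⟨a, b, h1, h2⟩
  · exact key a _ _ b (.left h1 h2) hw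
  · exact key a _ _ b (.right h1 h2) hw

/-- Two words are Knuth equivalent if and only if their insertion tableaux agree. -/
theorem KE_iff_insWord_eq {w v : List ℕ} (hw : w.Nodup) (hv : v.Nodup) :
    KE w v ↔ insWord [] w = insWord [] v := by
  constructor
  · intro h
    have key : ∀ w v, KE w v → (w.Nodup → insWord [] w = insWord [] v) := by
      intro w v h
      induction h with
      | rel _ _ h => exact fun hw => insWord_eq_of_step h hw
      | refl _ => exact fun _ => rfl
      | symm _ _ h ih => exact fun hw => (ih (KE.perm (KE.symm h) |>.nodup hw)).symm
      | trans _ _ _ h _ ih ih' =>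
        exact fun hw => (ih hw).trans (ih' ((KE.perm h).nodup hw))
    exact key w v h hw
  · intro h
    exact (KE.rowWord_insWord hw).trans (h ▸ (KE.rowWord_insWord hv).symm)

/-! ### Tableaux as lists of rows -/

/-- The row `s` fits strictly below the row `r`. -/
def Dom : List ℕ → List ℕ → Prop
  | _, [] => True
  | [], _ :: _ => False
  | a :: r, b :: s => a < b ∧ Dom r s

/-- The rows of a tableau with strictly increasing rows and columns. -/
def IsTab : List (List ℕ) → Prop
  | [] => True
  | r :: t => r ≠ [] ∧ r.Pairwise (· < ·) ∧ Dom r (t.headD []) ∧ IsTab t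

@[simp] theorem dom_nil (r : List ℕ) : Dom r [] := by cases r <;> trivial

theorem dom_iff {r s : List ℕ} :
    Dom r s ↔ s.length ≤ r.length ∧ ∀ j < s.length, r.getD j 0 < s.getD j 0 := by
  induction r generalizing s with
  | nil => cases s <;> simp [Dom]
  | cons a r ih =>
    cases s with
    | nil => simp
    | cons b s =>
      simp only [Dom, ih, List.length_cons]
      constructor
      · rintro ⟨h1, h2, h3⟩
        refine ⟨by omega, fun j hj => ?_⟩
        cases j with
        | zero => simpa
        | succ j => simpa using h3 j (by omega)
      · rintro ⟨h1, h2⟩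
        exact ⟨by simpa using h2 0 (by omega), by omega, fun j hj => by
          simpa using h2 (j + 1) (by omega)⟩

theorem Dom.append {r s : List ℕ} (h : Dom r s) (x : List ℕ) : Dom (r ++ x) s := by
  induction r generalizing s with
  | nil => cases s <;> simp_all [Dom]
  | cons a r ih => cases s <;> simp_all [Dom]

theorem Dom.rowInsert_left {x y : ℕ} {r s : List ℕ} (h : Dom r s)
    (hy : (rowInsert x r).2 = some y) : Dom (rowInsert x r).1 s := by
  induction r generalizing s with
  | nil => simp [rowInsert] at hy
  | cons a r ih =>
    cases s with
    | nil => simp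
    | cons b s =>
      simp only [Dom] at h
      simp only [rowInsert] at hy ⊢
      split
      · exact ⟨by omega, h.2⟩
      · rename_i hxa
        simp only [hxa, if_false] at hy
        exact ⟨h.1, ih h.2 hy⟩

theorem Dom.rowInsert {x y : ℕ} {r s : List ℕ} (hr : r.Pairwise (· < ·)) (h : Dom r s)
    (hy : (rowInsert x r).2 = some y) : Dom (rowInsert x r).1 (rowInsert y s).1 := by
  induction r generalizing s with
  | nil => simp [PatternKnuth.rowInsert] at hy
  | cons a r ih =>
    have hr' := List.pairwise_cons.1 hr
    simp only [PatternKnuth.rowInsert] at hy ⊢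
    split
    · rename_i hxa
      simp only [hxa, if_true, Option.some.injEq] at hy
      subst hy
      cases s with
      | nil => simpa [PatternKnuth.rowInsert, Dom]
      | cons b s =>
        simp only [Dom] at h
        simp [PatternKnuth.rowInsert, h.1, Dom, hxa, h.2]
    · rename_i hxa
      simp only [hxa, if_false] at hy
      have hay := hr'.1 y (rowInsert_bumped hy).2
      cases s with
      | nil => simpa [PatternKnuth.rowInsert, Dom]
      | cons b s =>
        simp only [Dom] at h
        simp only [PatternKnuth.rowInsert]
        split
        · exact ⟨hay, h.2.rowInsert_left hy⟩
        · exact ⟨h.1, ih hr'.2 h.2 hy⟩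

theorem tabInsert_headD (x : ℕ) (t : List (List ℕ)) :
    (tabInsert x t).headD [] = (rowInsert x (t.headD [])).1 := by
  cases t with
  | nil => simp [tabInsert, rowInsert]
  | cons r t =>
    rcases h : rowInsert x r with ⟨r', _ | y⟩ <;> simp [tabInsert, h]

theorem rowInsert_ne_nil (x : ℕ) (r : List ℕ) : (rowInsert x r).1 ≠ [] := by
  cases r with
  | nil => simp [rowInsert]
  | cons a r => simp only [rowInsert]; split <;> simp

theorem IsTab.tabInsert {x : ℕ} {t : List (List ℕ)} (ht : IsTab t) (hx : (x :: rowWord t).Nodup) :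
    IsTab (tabInsert x t) := by
  induction t generalizing x with
  | nil => simp [PatternKnuth.tabInsert, IsTab]
  | cons r t ih =>
    rw [rowWord_cons] at hx
    simp only [IsTab] at ht
    simp only [List.nodup_cons, List.mem_append, not_or, List.nodup_append'] at hx
    have hs := rowInsert_pairwise ht.2.1 hx.1.2
    have h1 := @rowInsert_eq_none x r
    have h2 := fun y => @Dom.rowInsert x y r (t.headD []) ht.2.1 ht.2.2.1
    have h3 := fun y => @rowInsert_bumped x y r
    have h4 := rowInsert_ne_nil x r
    rcases hri : PatternKnuth.rowInsert x r with ⟨r', _ | y⟩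
    · simp only [hri, forall_const] at hs h1 h4
      simp only [PatternKnuth.tabInsert, hri, IsTab]
      exact ⟨h4, hs, by rw [h1]; exact ht.2.2.1.append _, ht.2.2.2⟩
    · simp only [hri] at hs h2 h3 h4
      simp only [PatternKnuth.tabInsert, hri, IsTab]
      refine ⟨h4, hs, by rw [tabInsert_headD]; exact h2 y rfl, ih ht.2.2.2 ?_⟩
      exact List.nodup_cons.2 ⟨fun hy => hx.2.2.2 hy (h3 y rfl).2, hx.2.1⟩

theorem IsTab.insWord {t : List (List ℕ)} {w : List ℕ} (ht : IsTab t)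
    (hw : (rowWord t ++ w).Nodup) : IsTab (insWord t w) := by
  induction w generalizing t with
  | nil => simpa [PatternKnuth.insWord]
  | cons x w ih =>
    have hw' : (x :: rowWord t ++ w).Nodup := (List.perm_middle.nodup_iff).1 hw
    have hx : (x :: rowWord t).Nodup := hw'.of_append_left
    exact ih (ht.tabInsert hx) ((((tabInsert_perm x t).append_right w).nodup_iff).2 hw')

/-! ### Inserting the reading word of a tableau gives the tableau back -/

theorem rowInsert_append {a r : List ℕ} {x : ℕ} (ha : ∀ v ∈ a, v < x) :
    rowInsert x (a ++ r) = (a ++ (rowInsert x r).1, (rowInsert x r).2) := by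
  induction a with
  | nil => simp
  | cons b a ih =>
    simp only [List.mem_cons, forall_eq_or_imp] at ha
    simp [rowInsert, ha.1.le.not_gt, ih ha.2]

/-- Each letter of the upper row r bumps exactly the entry of s in its own column, or is appended if
there is none. The list `a` is the part already replaced. -/
theorem rowInsWord_dom {a r s : List ℕ} (hd : Dom r s) (hr : r.Pairwise (· < ·))
    (ha : ∀ v ∈ a, ∀ u ∈ r, v < u) : rowInsWord (a ++ s) r = (a ++ r, s) := by
  induction r generalizing s a with
  | nil =>
    cases s with
    | nil => simp [rowInsWord]
    | cons b s => simp [Dom] at hd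
  | cons c r ih =>
    have hr' := List.pairwise_cons.1 hr
    have hac : ∀ v ∈ a, v < c := fun v hv => ha v hv c (by simp)
    have ha' : ∀ v ∈ a ++ [c], ∀ u ∈ r, v < u := by
      intro v hv u hu
      simp only [List.mem_append, List.mem_singleton] at hv
      rcases hv with hv | rfl
      · exact ha v hv u (by simp [hu])
      · exact hr'.1 u hu
    cases s with
    | nil =>
      have := ih (s := []) (by simp) hr'.2 ha'
      simp only [List.append_nil, List.append_assoc] at this ⊢
      rw [rowInsWord, rowInsert_all_lt hac, this]
      simp
    | cons d s =>
      simp only [Dom] at hd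
      have := ih hd.2 hr'.2 ha'
      rw [rowInsWord, rowInsert_append hac]
      simp only [rowInsert, hd.1, if_true]
      rw [show a ++ c :: s = (a ++ [c]) ++ s by simp, this]
      simp

theorem IsTab.insWord_cons {t : List (List ℕ)} {r : List ℕ} (h : IsTab (r :: t)) :
    PatternKnuth.insWord t r = r :: t := by
  induction t generalizing r with
  | nil =>
    simp only [IsTab] at h
    rw [insWord_nil h.1, PatternKnuth.insWord_cons]
    have := rowInsWord_dom (a := []) (s := []) (by simp) h.2.1 (by simp)
    simp only [List.append_nil, List.nil_append] at this
    simp [this, PatternKnuth.insWord]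
  | cons s t ih =>
    simp only [IsTab] at h ih
    rw [PatternKnuth.insWord_cons]
    have := rowInsWord_dom (a := []) (s := s) h.2.2.1 h.2.1 (by simp)
    simp only [List.nil_append] at this
    rw [this]
    simp only
    rw [ih h.2.2.2]

theorem IsTab.insWord_rowWord {t : List (List ℕ)} (h : IsTab t) :
    PatternKnuth.insWord [] (rowWord t) = t := by
  induction t with
  | nil => simp [rowWord, PatternKnuth.insWord]
  | cons r t ih =>
    rw [rowWord_cons, insWord_append, ih h.2.2.2, h.insWord_cons]

theorem isTab_iff {t : List (List ℕ)} : IsTab t ↔ (∀ r ∈ t, r ≠ []) ∧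
    (∀ r ∈ t, r.Pairwise (· < ·)) ∧ ∀ i, Dom (t.getD i []) (t.getD (i + 1) []) := by
  induction t with
  | nil => simp [IsTab]
  | cons r t ih =>
    simp only [IsTab, ih, List.mem_cons, forall_eq_or_imp]
    have h0 : t.headD [] = t.getD 0 [] := by cases t <;> simp
    constructor
    · rintro ⟨h1, h2, h3, h4, h5, h6⟩
      refine ⟨⟨h1, h4⟩, ⟨h2, h5⟩, fun i => ?_⟩
      cases i with
      | zero => exact h0 ▸ h3
      | succ i => simpa using h6 i
    · rintro ⟨⟨h1, h4⟩, ⟨h2, h5⟩, h6⟩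
      refine ⟨h1, h2, h0 ▸ h6 0, h4, h5, fun i => by simpa using h6 (i + 1)⟩

/-- A word in the letters `1, …, n`, each used once. -/
def IsWord (n : ℕ) (w : List ℕ) : Prop := w.Perm (List.range' 1 n)

namespace IsWord

variable {n : ℕ} {w : List ℕ}

theorem nodup (h : IsWord n w) : w.Nodup := h.nodup_iff.2 List.nodup_range'

theorem mem_iff (h : IsWord n w) {x : ℕ} : x ∈ w ↔ 1 ≤ x ∧ x ≤ n := by
  rw [List.Perm.mem_iff h, List.mem_range'_1]; omega

theorem length_eq (h : IsWord n w) : w.length = n := by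
  simpa using List.Perm.length_eq h

theorem of_nodup (h : w.Nodup) (h' : ∀ x, x ∈ w ↔ 1 ≤ x ∧ x ≤ n) : IsWord n w := by
  refine (List.perm_ext_iff_of_nodup h List.nodup_range').2 fun x => ?_
  rw [h', List.mem_range'_1]; omega

theorem ke (h : IsWord n w) {v : List ℕ} (hv : KE w v) : IsWord n v := hv.perm.symm.trans h

end IsWord

/-! ### Standard Young tableaux and their rows -/

namespace SYT

variable {n : ℕ}

theorem getD_rows (S : SYT n) (i : ℕ) :
    S.rows.getD i [] = (List.range (S.shape.rowLen i)).map fun j => S.tab i j := by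
  unfold rows
  by_cases hi : i < S.shape.colLen 0
  · rw [List.getD_eq_getElem _ _ (by simpa)]
    simp
  · rw [List.getD_eq_default _ _ (by simpa using hi)]
    have : S.shape.rowLen i = 0 := by
      by_contra h
      exact hi (YoungDiagram.mem_iff_lt_colLen.1
        (YoungDiagram.mem_iff_lt_rowLen.2 (Nat.pos_of_ne_zero h)))
    simp [this]

theorem row_strict (S : SYT n) {i j k : ℕ} (hjk : j < k) (h : (i, k) ∈ S.shape) :
    S.tab i j < S.tab i k := by
  refine lt_of_le_of_ne (S.tab.row_weak hjk h) fun he => ?_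
  have h1 : (i, j) ∈ S.shape := S.shape.up_left_mem le_rfl hjk.le h
  have := S.bijOn.injOn (x₁ := (i, j)) (x₂ := (i, k)) (by simpa using h1) (by simpa using h) he
  simp only [Prod.mk.injEq, true_and] at this
  omega

theorem mem_of_mem_rows (S : SYT n) {r : List ℕ} (hr : r ∈ S.rows) :
    ∃ i, i < S.shape.colLen 0 ∧ r = (List.range (S.shape.rowLen i)).map fun j => S.tab i j := by
  simp only [rows, List.mem_map, List.mem_range] at hr
  obtain ⟨i, hi, rfl⟩ := hr
  exact ⟨i, hi, rfl⟩

theorem isTab_rows (S : SYT n) : IsTab S.rows := by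
  refine isTab_iff.2 ⟨fun r hr => ?_, fun r hr => ?_, fun i => ?_⟩
  · obtain ⟨i, hi, rfl⟩ := S.mem_of_mem_rows hr
    have := YoungDiagram.mem_iff_lt_rowLen.1 (YoungDiagram.mem_iff_lt_colLen.2 hi)
    simp; omega
  · obtain ⟨i, hi, rfl⟩ := S.mem_of_mem_rows hr
    rw [List.pairwise_map, List.pairwise_iff_getElem]
    intro j k hj hk hjk
    simp only [List.getElem_range, List.length_range] at hk ⊢
    exact S.row_strict hjk (YoungDiagram.mem_iff_lt_rowLen.2 hk)
  · rw [getD_rows, getD_rows, dom_iff]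
    have h1 := S.shape.rowLen_anti i (i + 1) (by omega)
    refine ⟨by simpa using h1, fun j hj => ?_⟩
    simp only [List.length_map, List.length_range] at hj
    rw [List.getD_eq_getElem _ _ (by simp; omega), List.getD_eq_getElem _ _ (by simpa)]
    simp only [List.getElem_map, List.getElem_range]
    exact S.tab.col_strict (by omega) (YoungDiagram.mem_iff_lt_rowLen.2 hj)

theorem mem_rowWord_rows (S : SYT n) {x : ℕ} :
    x ∈ rowWord S.rows ↔ ∃ i j, (i, j) ∈ S.shape ∧ S.tab i j = x := by
  simp only [rowWord, List.mem_flatten, List.mem_reverse]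
  constructor
  · rintro ⟨r, hr, hx⟩
    obtain ⟨i, hi, rfl⟩ := S.mem_of_mem_rows hr
    simp only [List.mem_map, List.mem_range] at hx
    obtain ⟨j, hj, rfl⟩ := hx
    exact ⟨i, j, YoungDiagram.mem_iff_lt_rowLen.2 hj, rfl⟩
  · rintro ⟨i, j, h, rfl⟩
    refine ⟨_, List.mem_map.2 ⟨i, List.mem_range.2 ?_, rfl⟩, List.mem_map.2 ⟨j, List.mem_range.2 ?_,
      rfl⟩⟩
    · exact YoungDiagram.mem_iff_lt_colLen.1 (S.shape.up_left_mem le_rfl (Nat.zero_le _) h)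
    · exact YoungDiagram.mem_iff_lt_rowLen.1 h

theorem exists_cell (S : SYT n) {x : ℕ} (h1 : 1 ≤ x) (h2 : x ≤ n) :
    ∃ i j, (i, j) ∈ S.shape ∧ S.tab i j = x := by
  obtain ⟨⟨i, j⟩, hc, hx⟩ := S.bijOn.surjOn (show x ∈ Set.Icc 1 n from ⟨h1, h2⟩)
  exact ⟨i, j, by simpa using hc, hx⟩

theorem tab_mem (S : SYT n) {i j : ℕ} (h : (i, j) ∈ S.shape) : 1 ≤ S.tab i j ∧ S.tab i j ≤ n :=
  S.bijOn.mapsTo (show (i, j) ∈ (S.shape.cells : Set (ℕ × ℕ)) by simpa using h)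

theorem tab_inj (S : SYT n) {i j k l : ℕ} (h : (i, j) ∈ S.shape) (h' : (k, l) ∈ S.shape)
    (he : S.tab i j = S.tab k l) : i = k ∧ j = l := by
  have := S.bijOn.injOn (x₁ := (i, j)) (x₂ := (k, l)) (by simpa using h) (by simpa using h') he
  simpa using this

theorem isWord_rowWord (S : SYT n) : IsWord n (rowWord S.rows) := by
  refine IsWord.of_nodup ?_ fun x => ?_
  · rw [rowWord, List.nodup_flatten]
    refine ⟨fun r hr => ?_, ?_⟩
    · exact ((isTab_iff.1 S.isTab_rows).2.1 r (by simpa using hr)).imp (fun h => h.ne)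
    · rw [List.pairwise_reverse, rows, List.pairwise_map]
      refine List.pairwise_lt_range.imp fun {a b} hab => ?_
      intro x hx hx'
      simp only [List.mem_map, List.mem_range] at hx hx'
      obtain ⟨j, hj, rfl⟩ := hx
      obtain ⟨k, hk, he⟩ := hx'
      have := S.tab_inj (YoungDiagram.mem_iff_lt_rowLen.2 hj)
        (YoungDiagram.mem_iff_lt_rowLen.2 hk) he.symm
      omega
  · rw [mem_rowWord_rows]
    constructor
    · rintro ⟨i, j, h, rfl⟩
      exact S.tab_mem h
    · rintro ⟨h1, h2⟩
      exact S.exists_cell h1 h2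

theorem ext_tab {S T : SYT n} (h : ∀ i j, (i, j) ∈ S.shape ↔ (i, j) ∈ T.shape)
    (h' : ∀ i j, (i, j) ∈ S.shape → S.tab i j = T.tab i j) : S = T := by
  obtain ⟨sh, tab, b⟩ := S
  obtain ⟨sh', tab', b'⟩ := T
  have : sh = sh' := by
    ext ⟨i, j⟩
    simpa using h i j
  subst this
  have : tab = tab' := by
    ext i j
    by_cases hc : (i, j) ∈ sh
    · exact h' i j hc
    · rw [tab.zeros hc, tab'.zeros hc]
  subst this
  rfl

theorem rows_injective {S T : SYT n} (h : S.rows = T.rows) : S = T := by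
  have hl : ∀ i, S.shape.rowLen i = T.shape.rowLen i := fun i => by
    have := congrArg List.length ((S.getD_rows i).symm.trans ((congrArg (·.getD i []) h).trans
      (T.getD_rows i)))
    simpa using this
  refine ext_tab (fun i j => ?_) fun i j hij => ?_
  · rw [YoungDiagram.mem_iff_lt_rowLen, YoungDiagram.mem_iff_lt_rowLen, hl]
  · have h1 := ((S.getD_rows i).symm.trans ((congrArg (·.getD i []) h).trans (T.getD_rows i)))
    have h2 := YoungDiagram.mem_iff_lt_rowLen.1 hij
    have h3 := congrArg (·.getD j 0) h1
    rw [List.getD_eq_getElem _ _ (by simpa), List.getD_eq_getElem _ _ (by simpa [← hl])] at h3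
    simpa using h3

theorem exists_of_isTab {t : List (List ℕ)} (ht : IsTab t) (hw : IsWord n (rowWord t)) :
    ∃ S : SYT n, S.rows = t := by
  obtain ⟨h1, h2, h3⟩ := isTab_iff.1 ht
  have hlen : ∀ i k, (t.getD (i + k) []).length ≤ (t.getD i []).length := by
    intro i k
    induction k with
    | zero => simp
    | succ k ih => exact (dom_iff.1 (h3 (i + k))).1.trans ih
  have hcol : ∀ i k j, j < (t.getD (i + (k + 1)) []).length →
      (t.getD i []).getD j 0 < (t.getD (i + (k + 1)) []).getD j 0 := by
    intro i k
    induction k with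
    | zero => exact (dom_iff.1 (h3 i)).2
    | succ k ih =>
      intro j hj
      exact (ih j (hj.trans_le (dom_iff.1 (h3 (i + (k + 1)))).1)).trans
        ((dom_iff.1 (h3 (i + (k + 1)))).2 j hj)
  have hsort : (t.map List.length).SortedGE := by
    refine List.Pairwise.sortedGE ?_
    rw [List.pairwise_map, List.pairwise_iff_getElem]
    intro i k hi hk hik
    have := hlen i (k - i)
    rw [show i + (k - i) = k by omega, List.getD_eq_getElem _ _ hi,
      List.getD_eq_getElem _ _ hk] at this
    exact this
  set sh := YoungDiagram.ofRowLens (t.map List.length) hsort with hsh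
  have hmem : ∀ i j, (i, j) ∈ sh ↔ j < (t.getD i []).length := by
    intro i j
    rw [hsh, YoungDiagram.mem_ofRowLens]
    simp only [List.length_map, List.getElem_map]
    by_cases hi : i < t.length
    · rw [List.getD_eq_getElem _ _ hi]; simp [hi]
    · rw [List.getD_eq_default _ _ (by omega)]; simp [hi]
  have hpair : ∀ i, (t.getD i []).Pairwise (· < ·) := by
    intro i
    by_cases hi : i < t.length
    · rw [List.getD_eq_getElem _ _ hi]; exact h2 _ (List.getElem_mem hi)
    · rw [List.getD_eq_default _ _ (by omega)]; simp
  have hin : ∀ i j, (i, j) ∈ sh → (t.getD i []).getD j 0 ∈ t.getD i [] := by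
    intro i j h
    rw [hmem] at h
    rw [List.getD_eq_getElem _ _ h]
    exact List.getElem_mem h
  have hrow : ∀ i, t.getD i [] ≠ [] → t.getD i [] ∈ t := by
    intro i hi
    by_cases hi' : i < t.length
    · rw [List.getD_eq_getElem _ _ hi']; exact List.getElem_mem hi'
    · rw [List.getD_eq_default _ _ (by omega)] at hi; exact absurd rfl hi
  have hnd := hw.nodup
  rw [rowWord, List.nodup_flatten, List.pairwise_reverse, List.pairwise_iff_getElem] at hnd
  let T : SemistandardYoungTableau sh :=
    { entry := fun i j => (t.getD i []).getD j 0
      row_weak' := by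
        intro i j1 j2 hj h
        rw [hmem] at h
        rw [List.getD_eq_getElem _ _ h, List.getD_eq_getElem _ _ (hj.trans h)]
        exact ((List.pairwise_iff_getElem.1 (hpair i)) _ _ _ _ hj).le
      col_strict' := by
        intro i1 i2 j hi h
        rw [hmem] at h
        have := hcol i1 (i2 - i1 - 1) j
        rw [show i1 + (i2 - i1 - 1 + 1) = i2 by omega] at this
        exact this h
      zeros' := by
        intro i j h
        rw [hmem] at h
        exact List.getD_eq_default _ _ (by omega) }
  have hT : ∀ i j, T i j = (t.getD i []).getD j 0 := fun _ _ => rfl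
  have hb : Set.BijOn (fun c : ℕ × ℕ => T c.1 c.2) (sh.cells : Set (ℕ × ℕ)) (Set.Icc 1 n) := by
    refine ⟨?_, ?_, ?_⟩
    · rintro ⟨i, j⟩ h
      have h' : (i, j) ∈ sh := by simpa using h
      have h4 := hin i j h'
      have h5 := hrow i (List.ne_nil_of_mem h4)
      exact (hw.mem_iff).1 (by
        simp only [rowWord, List.mem_flatten, List.mem_reverse]
        exact ⟨_, h5, h4⟩)
    · rintro ⟨i, j⟩ h ⟨k, l⟩ h' he
      have h : (i, j) ∈ sh := by simpa using h
      have h' : (k, l) ∈ sh := by simpa using h'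
      simp only [hT] at he
      have hi : i < t.length := by
        by_contra hc
        rw [hmem, List.getD_eq_default _ _ (by omega)] at h; simp at h
      have hk : k < t.length := by
        by_contra hc
        rw [hmem, List.getD_eq_default _ _ (by omega)] at h'; simp at h'
      have h6 := hin _ _ h
      have h7 := hin _ _ h'
      rw [he] at h6
      have hik : i = k := by
        rcases lt_trichotomy i k with hlt | rfl | hlt
        · exfalso
          refine hnd.2 i k hi hk hlt (?_ : (t.getD k []).getD l 0 ∈ t[k]) ?_
          · rw [← List.getD_eq_getElem t [] hk]; exact h7
          · rw [← List.getD_eq_getElem t [] hi]; exact h6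
        · rfl
        · exfalso
          refine hnd.2 k i hk hi hlt (?_ : (t.getD k []).getD l 0 ∈ t[i]) ?_
          · rw [← List.getD_eq_getElem t [] hi]; exact h6
          · rw [← List.getD_eq_getElem t [] hk]; exact h7
      subst hik
      rw [hmem] at h h'
      rw [List.getD_eq_getElem _ _ h, List.getD_eq_getElem _ _ h'] at he
      have := (List.Nodup.getElem_inj_iff ((hpair i).imp fun h => h.ne)).1 he
      simp [this]
    · intro x hx
      have := (hw.mem_iff).2 hx
      simp only [rowWord, List.mem_flatten, List.mem_reverse] at this
      obtain ⟨r, hr, hxr⟩ := this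
      obtain ⟨i, hi, rfl⟩ := List.getElem_of_mem hr
      obtain ⟨j, hj, rfl⟩ := List.getElem_of_mem hxr
      refine ⟨(i, j), ?_, ?_⟩
      · have : (i, j) ∈ sh := by rw [hmem, List.getD_eq_getElem _ _ hi]; exact hj
        simpa using this
      · simp only [hT]
        rw [List.getD_eq_getElem t _ hi, List.getD_eq_getElem _ _ hj]
  refine ⟨⟨sh, T, hb⟩, ?_⟩
  have hrl : ∀ i, sh.rowLen i = (t.getD i []).length := by
    intro i
    apply Nat.le_antisymm
    · by_contra! hc
      exact lt_irrefl _ ((hmem i _).1 (YoungDiagram.mem_iff_lt_rowLen.2 hc))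
    · by_contra! hc
      exact lt_irrefl _ (YoungDiagram.mem_iff_lt_rowLen.1 ((hmem i _).2 hc))
  have hcl : sh.colLen 0 = t.length := by
    have : ∀ i, i < sh.colLen 0 ↔ i < t.length := by
      intro i
      rw [← YoungDiagram.mem_iff_lt_colLen, hmem]
      by_cases hi : i < t.length
      · rw [List.getD_eq_getElem _ _ hi]
        simpa [hi, List.length_pos_iff] using h1 _ (List.getElem_mem hi)
      · rw [List.getD_eq_default _ _ (by omega)]; simp [hi]
    apply Nat.le_antisymm
    · by_contra! hc; exact lt_irrefl _ ((this _).1 hc)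
    · by_contra! hc; exact lt_irrefl _ ((this _).2 hc)
  refine List.ext_getElem ?_ fun i hi hi' => ?_
  · simp [rows, hcl]
  · simp only [rows, List.getElem_map, List.getElem_range]
    refine List.ext_getElem ?_ fun j hj hj' => ?_
    · simp only [List.length_map, List.length_range]
      rw [hrl, List.getD_eq_getElem _ _ hi']
    · simp only [List.getElem_map, List.getElem_range, hT]
      rw [List.getD_eq_getElem _ _ hi', List.getD_eq_getElem _ _ hj']

theorem insWord_rowWord (S : SYT n) : insWord [] (rowWord S.rows) = S.rows :=
  S.isTab_rows.insWord_rowWord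

theorem exists_rows_eq_insWord {w : List ℕ} (hw : IsWord n w) :
    ∃ S : SYT n, S.rows = insWord [] w :=
  exists_of_isTab (IsTab.insWord (t := []) trivial (by simpa [rowWord] using hw.nodup))
    (hw.ke (KE.rowWord_insWord hw.nodup))

theorem exists_ke {w : List ℕ} (hw : IsWord n w) : ∃ S : SYT n, KE w (rowWord S.rows) := by
  obtain ⟨S, hS⟩ := exists_rows_eq_insWord hw
  exact ⟨S, hS ▸ KE.rowWord_insWord hw.nodup⟩

theorem eq_of_ke {S T : SYT n} (h : KE (rowWord S.rows) (rowWord T.rows)) : S = T := by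
  refine rows_injective ?_
  rw [← S.insWord_rowWord, ← T.insWord_rowWord]
  exact (KE_iff_insWord_eq S.isWord_rowWord.nodup T.isWord_rowWord.nodup).1 h

/-- The descents of a tableau: `x` such that `x + 1` is in a lower row. -/
def des (S : SYT n) : Set ℕ :=
  {x | ∃ i j k l, (i, j) ∈ S.shape ∧ (k, l) ∈ S.shape ∧ S.tab i j = x ∧ S.tab k l = x + 1 ∧ i < k}

end SYT

/-! ### Relative order of two letters in a word -/

theorem pair_sublist_cons {a b c : ℕ} {l : List ℕ} :
    [a, b].Sublist (c :: l) ↔ [a, b].Sublist l ∨ (a = c ∧ b ∈ l) := by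
  constructor
  · intro h
    cases h with
    | cons _ h => exact .inl h
    | cons_cons _ h => exact .inr ⟨rfl, by simpa using h⟩
  · rintro (h | ⟨rfl, h⟩)
    · exact h.cons c
    · exact (List.singleton_sublist.2 h).cons_cons a

theorem pair_sublist_append {a b : ℕ} {l m : List ℕ} :
    [a, b].Sublist (l ++ m) ↔ [a, b].Sublist l ∨ [a, b].Sublist m ∨ (a ∈ l ∧ b ∈ m) := by
  induction l with
  | nil => simp
  | cons c l ih =>
    rw [List.cons_append, pair_sublist_cons, pair_sublist_cons, ih]
    simp only [List.mem_append, List.mem_cons]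
    tauto

theorem pair_sublist_iff_getElem? {a b : ℕ} {l : List ℕ} :
    [a, b].Sublist l ↔ ∃ p q : ℕ, p < q ∧ l[p]? = some a ∧ l[q]? = some b := by
  induction l with
  | nil => simp
  | cons c l ih =>
    rw [pair_sublist_cons, ih]
    constructor
    · rintro (⟨p, q, h, h1, h2⟩ | ⟨rfl, h⟩)
      · exact ⟨p + 1, q + 1, by omega, by simpa, by simpa⟩
      · obtain ⟨q, hq⟩ := List.mem_iff_getElem?.1 h
        exact ⟨0, q + 1, by omega, by simp, by simpa⟩
    · rintro ⟨p, q, h, h1, h2⟩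
      cases q with
      | zero => omega
      | succ q =>
        cases p with
        | zero =>
          right
          simp only [List.getElem?_cons_zero, Option.some.injEq] at h1
          exact ⟨h1.symm, List.mem_iff_getElem?.2 ⟨q, by simpa using h2⟩⟩
        | succ p => exact .inl ⟨p, q, by omega, by simpa using h1, by simpa using h2⟩

theorem pair_sublist_mem {a b : ℕ} {l : List ℕ} (h : [a, b].Sublist l) : a ∈ l ∧ b ∈ l :=
  ⟨h.subset (by simp), h.subset (by simp)⟩

theorem pair_sublist_total {a b : ℕ} {l : List ℕ} (ha : a ∈ l) (hb : b ∈ l) (hab : a ≠ b) :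
    [a, b].Sublist l ∨ [b, a].Sublist l := by
  obtain ⟨p, hp⟩ := List.mem_iff_getElem?.1 ha
  obtain ⟨q, hq⟩ := List.mem_iff_getElem?.1 hb
  rcases lt_trichotomy p q with h | rfl | h
  · exact .inl (pair_sublist_iff_getElem?.2 ⟨p, q, h, hp, hq⟩)
  · rw [hp] at hq; exact absurd (Option.some.inj hq) hab
  · exact .inr (pair_sublist_iff_getElem?.2 ⟨q, p, h, hq, hp⟩)

theorem getElem?_inj_of_nodup {l : List ℕ} (hl : l.Nodup) {p q a : ℕ} (hp : l[p]? = some a)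
    (hq : l[q]? = some a) : p = q := by
  obtain ⟨h1, h2⟩ := List.getElem?_eq_some_iff.1 hp
  obtain ⟨h3, h4⟩ := List.getElem?_eq_some_iff.1 hq
  exact (hl.getElem_inj_iff).1 (h2.trans h4.symm)

theorem pair_sublist_trans {a b c : ℕ} {l : List ℕ} (hl : l.Nodup) (h : [a, b].Sublist l)
    (h' : [b, c].Sublist l) : [a, c].Sublist l := by
  obtain ⟨p, q, hpq, hp, hq⟩ := pair_sublist_iff_getElem?.1 h
  obtain ⟨q', r, hqr, hq', hr⟩ := pair_sublist_iff_getElem?.1 h'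
  have := getElem?_inj_of_nodup hl hq hq'
  exact pair_sublist_iff_getElem?.2 ⟨p, r, by omega, hp, hr⟩

theorem pair_sublist_asymm {a b : ℕ} {l : List ℕ} (hl : l.Nodup) (h : [a, b].Sublist l) :
    ¬ [b, a].Sublist l := by
  intro h'
  obtain ⟨p, q, hpq, hp, hq⟩ := pair_sublist_iff_getElem?.1 h
  obtain ⟨q', r, hqr, hq', hr⟩ := pair_sublist_iff_getElem?.1 h'
  have := getElem?_inj_of_nodup hl hq hq'
  have := getElem?_inj_of_nodup hl hp hr
  omega

theorem not_pair_sublist_iff {a b : ℕ} {l : List ℕ} (hl : l.Nodup) (ha : a ∈ l) (hb : b ∈ l)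
    (hab : a ≠ b) : ¬ [a, b].Sublist l ↔ [b, a].Sublist l :=
  ⟨fun h => (pair_sublist_total ha hb hab).resolve_left h, fun h => pair_sublist_asymm hl h⟩

theorem pair_sublist_filter {a b : ℕ} {l : List ℕ} {p : ℕ → Bool} :
    [a, b].Sublist (l.filter p) ↔ [a, b].Sublist l ∧ p a ∧ p b := by
  constructor
  · intro h
    have h1 := pair_sublist_mem h
    simp only [List.mem_filter] at h1
    exact ⟨h.trans List.filter_sublist, h1.1.2, h1.2.2⟩
  · rintro ⟨h, ha, hb⟩
    have := h.filter p
    simpa [ha, hb] using this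

theorem pair_sublist_map {a b : ℕ} {l : List ℕ} {f : ℕ → ℕ} {s : Set ℕ} (hf : s.InjOn f)
    (hl : ∀ x ∈ l, x ∈ s) (ha : a ∈ s) (hb : b ∈ s) :
    [f a, f b].Sublist (l.map f) ↔ [a, b].Sublist l := by
  constructor
  · intro h
    obtain ⟨p, q, hpq, hp, hq⟩ := pair_sublist_iff_getElem?.1 h
    refine pair_sublist_iff_getElem?.2 ⟨p, q, hpq, ?_, ?_⟩
    · rw [List.getElem?_map, Option.map_eq_some_iff] at hp
      obtain ⟨x, hx, hxa⟩ := hp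
      rw [hx, hf (hl x (List.mem_of_getElem? hx)) ha hxa]
    · rw [List.getElem?_map, Option.map_eq_some_iff] at hq
      obtain ⟨x, hx, hxa⟩ := hq
      rw [hx, hf (hl x (List.mem_of_getElem? hx)) hb hxa]
  · intro h
    simpa using h.map f

theorem pair_sublist_reverse {a b : ℕ} {l : List ℕ} :
    [a, b].Sublist l.reverse ↔ [b, a].Sublist l := by
  rw [← List.reverse_sublist]; simp

theorem pair_sublist_of_pairwise {a b : ℕ} {l : List ℕ} (hl : l.Pairwise (· < ·)) (ha : a ∈ l)
    (hb : b ∈ l) (hab : a < b) : [a, b].Sublist l := by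
  refine (pair_sublist_total ha hb hab.ne).resolve_right fun h => ?_
  have := hl.sublist h
  simp at this
  omega

/-- Knuth equivalence preserves the relative order of two letters that are neighbours in size. -/
theorem KE.pair_sublist {w v : List ℕ} (h : KE w v) (hw : w.Nodup) {a b : ℕ} (hab : a < b)
    (hgap : ∀ x ∈ w, x ≤ a ∨ b ≤ x) :
    ([a, b].Sublist w ↔ [a, b].Sublist v) ∧ ([b, a].Sublist w ↔ [b, a].Sublist v) := by
  have h1 := h.filter (p := fun x => decide (a ≤ x ∧ x ≤ b)) (by simp; omega)
  have h2 : (w.filter fun x => decide (a ≤ x ∧ x ≤ b)).length ≤ 2 := by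
    have : (w.filter fun x => decide (a ≤ x ∧ x ≤ b)) ⊆ [a, b] := by
      intro x hx
      simp only [List.mem_filter, decide_eq_true_eq] at hx
      have := hgap x hx.1
      simp; omega
    exact (List.subperm_of_subset (hw.filter _) this).length_le
  have h3 := h1.eq_of_length_le_two h2
  constructor
  · have h4 := pair_sublist_filter (a := a) (b := b) (l := w) (p := fun x => decide (a ≤ x ∧ x ≤ b))
    have h5 := pair_sublist_filter (a := a) (b := b) (l := v) (p := fun x => decide (a ≤ x ∧ x ≤ b))
    rw [h3] at h4
    simp only [le_refl, hab.le, and_self, decide_true, and_true] at h4 h5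
    exact h4.symm.trans h5
  · have h4 := pair_sublist_filter (a := b) (b := a) (l := w) (p := fun x => decide (a ≤ x ∧ x ≤ b))
    have h5 := pair_sublist_filter (a := b) (b := a) (l := v) (p := fun x => decide (a ≤ x ∧ x ≤ b))
    rw [h3] at h4
    simp only [le_refl, hab.le, and_self, decide_true, and_true] at h4 h5
    exact h4.symm.trans h5

/-- The inverse descents of a word: `i` such that `i + 1` occurs before `i`. -/
def desWord (w : List ℕ) : Set ℕ := {i | [i + 1, i].Sublist w}

theorem KE.desWord_eq {w v : List ℕ} (h : KE w v) (hw : w.Nodup) : desWord w = desWord v := by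
  ext i
  exact (h.pair_sublist hw (Nat.lt_succ_self i) (fun x _ => by omega)).2

theorem pair_sublist_rowWord {t : List (List ℕ)} {i k x y : ℕ} (hik : i < k)
    (hx : x ∈ t.getD k []) (hy : y ∈ t.getD i []) : [x, y].Sublist (rowWord t) := by
  induction t generalizing i k with
  | nil => simp at hx
  | cons r t ih =>
    obtain ⟨k, rfl⟩ : ∃ k', k = k' + 1 := ⟨k - 1, by omega⟩
    rw [rowWord_cons, pair_sublist_append]
    simp only [List.getD_cons_succ] at hx
    cases i with
    | zero =>
      simp only [List.getD_cons_zero] at hy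
      refine .inr (.inr ⟨?_, hy⟩)
      by_cases hk : k < t.length
      · rw [List.getD_eq_getElem _ _ hk] at hx
        simp only [rowWord, List.mem_flatten, List.mem_reverse]
        exact ⟨_, List.getElem_mem hk, hx⟩
      · rw [List.getD_eq_default _ _ (by omega)] at hx; simp at hx
    | succ i => exact .inl (ih (i := i) (k := k) (by omega) hx (by simpa using hy))

theorem mem_rowWord_of_getD {t : List (List ℕ)} {k x : ℕ} (hx : x ∈ t.getD k []) :
    t.getD k [] ∈ t := by
  by_cases hk : k < t.length
  · rw [List.getD_eq_getElem _ _ hk]; exact List.getElem_mem hk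
  · rw [List.getD_eq_default _ _ (by omega)] at hx; simp at hx

namespace SYT

variable {n : ℕ}

theorem mem_getD_rows (S : SYT n) {i x : ℕ} :
    x ∈ S.rows.getD i [] ↔ ∃ j, (i, j) ∈ S.shape ∧ S.tab i j = x := by
  rw [getD_rows]
  simp [YoungDiagram.mem_iff_lt_rowLen]

theorem pair_sublist_rowWord_of_lt (S : SYT n) {i j k l : ℕ} (h : (i, j) ∈ S.shape)
    (h' : (k, l) ∈ S.shape) (hik : i < k) :
    [S.tab k l, S.tab i j].Sublist (rowWord S.rows) :=
  pair_sublist_rowWord hik (S.mem_getD_rows.2 ⟨l, h', rfl⟩) (S.mem_getD_rows.2 ⟨j, h, rfl⟩)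

theorem desWord_rowWord (S : SYT n) : desWord (rowWord S.rows) = S.des := by
  ext x
  constructor
  · intro h
    obtain ⟨h1, h2⟩ := pair_sublist_mem h
    obtain ⟨k, l, hkl, hx1⟩ := S.mem_rowWord_rows.1 h1
    obtain ⟨i, j, hij, hx2⟩ := S.mem_rowWord_rows.1 h2
    refine ⟨i, j, k, l, hij, hkl, hx2, hx1, ?_⟩
    by_contra hc
    rcases (not_lt.1 hc).lt_or_eq with hc | rfl
    · have := S.pair_sublist_rowWord_of_lt hkl hij hc
      rw [hx1, hx2] at this
      exact pair_sublist_asymm S.isWord_rowWord.nodup this h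
    · have h3 := S.mem_getD_rows.2 ⟨l, hkl, hx1⟩
      have h4 := S.mem_getD_rows.2 ⟨j, hij, hx2⟩
      have h5 := mem_rowWord_of_getD h3
      have h6 := pair_sublist_of_pairwise ((isTab_iff.1 S.isTab_rows).2.1 _ h5) h4 h3 (by omega)
      have h7 : (S.rows.getD k []).Sublist (rowWord S.rows) :=
        List.sublist_flatten_of_mem (by simpa using h5)
      exact pair_sublist_asymm S.isWord_rowWord.nodup (h6.trans h7) h
  · rintro ⟨i, j, k, l, h, h', h1, h2, hik⟩
    have := S.pair_sublist_rowWord_of_lt h h' hik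
    rwa [h1, h2] at this

end SYT

/-! ### Words of permutations -/

theorem getElem?_word {n : ℕ} (π : Equiv.Perm (Fin n)) {p x : ℕ} :
    (word π)[p]? = some x ↔ ∃ h : p < n, (π ⟨p, h⟩ : ℕ) + 1 = x := by
  rw [word, List.getElem?_ofFn]
  split
  · rename_i h; simp [h]
  · rename_i h; simp [h]

theorem isWord_word {n : ℕ} (π : Equiv.Perm (Fin n)) : IsWord n (word π) := by
  refine IsWord.of_nodup ?_ fun x => ?_
  · rw [word, List.nodup_ofFn]
    intro i j h
    exact π.injective (Fin.ext (by simpa using h))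
  · rw [word, List.mem_ofFn]
    constructor
    · rintro ⟨i, rfl⟩
      have := (π i).isLt
      constructor <;> omega
    · rintro ⟨h1, h2⟩
      refine ⟨π.symm ⟨x - 1, by omega⟩, ?_⟩
      simp; omega

theorem exists_word_eq {n : ℕ} {w : List ℕ} (hw : IsWord n w) :
    ∃ π : Equiv.Perm (Fin n), word π = w := by
  have hl := hw.length_eq
  have hm : ∀ i : Fin n, 1 ≤ w[(i : ℕ)]'(by omega) ∧ w[(i : ℕ)]'(by omega) ≤ n := fun i =>
    hw.mem_iff.1 (List.getElem_mem _)
  let f : Fin n → Fin n := fun i => ⟨w[(i : ℕ)]'(by omega) - 1, by have := hm i; omega⟩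
  have hf : Function.Injective f := by
    intro i j h
    have h1 : w[(i : ℕ)]'(by omega) = w[(j : ℕ)]'(by omega) := by
      have := congrArg Fin.val h
      simp only [f] at this
      have := hm i
      have := hm j
      omega
    exact Fin.ext ((hw.nodup.getElem_inj_iff).1 h1)
  refine ⟨Equiv.ofBijective f (Finite.injective_iff_bijective.1 hf), ?_⟩
  refine List.ext_getElem (by simp [word, hl]) fun i h1 h2 => ?_
  have := hm ⟨i, by omega⟩
  simp only [word, List.getElem_ofFn, Equiv.ofBijective_apply, f]
  simp only at this
  omega

theorem word_injective {n : ℕ} {π σ : Equiv.Perm (Fin n)} (h : word π = word σ) : π = σ := by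
  ext i
  have := congrFun (List.ofFn_injective h) i
  simpa using this

theorem mem_K_iff {n : ℕ} {S : SYT n} {π : Equiv.Perm (Fin n)} :
    π ∈ K S ↔ KE (word π) (rowWord S.rows) := by
  rw [KE_iff_insWord_eq (isWord_word π).nodup S.isWord_rowWord.nodup, S.insWord_rowWord]
  exact Iff.rfl

theorem exists_mem_K {n : ℕ} (π : Equiv.Perm (Fin n)) : ∃ S : SYT n, π ∈ K S := by
  obtain ⟨S, hS⟩ := SYT.exists_ke (isWord_word π)
  exact ⟨S, mem_K_iff.2 hS⟩

theorem K_nonempty {n : ℕ} (S : SYT n) : (K S).Nonempty := by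
  obtain ⟨π, hπ⟩ := exists_word_eq S.isWord_rowWord
  exact ⟨π, mem_K_iff.2 (KE.of_eq hπ)⟩

theorem Des_inv {n : ℕ} (π : Equiv.Perm (Fin n)) : Des π⁻¹ = desWord (word π) := by
  ext i
  simp only [Des, desWord, Set.mem_ofPred_eq, pair_sublist_iff_getElem?, getElem?_word]
  constructor
  · rintro ⟨a, b, ha, hb, h⟩
    refine ⟨π⁻¹ b, π⁻¹ a, h, ⟨(π⁻¹ b).isLt, ?_⟩, ⟨(π⁻¹ a).isLt, ?_⟩⟩
    · simp [hb]
    · simp [ha]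
  · rintro ⟨p, q, hpq, ⟨hp, hp'⟩, ⟨hq, hq'⟩⟩
    refine ⟨π ⟨q, hq⟩, π ⟨p, hp⟩, hq', by omega, by simpa⟩

theorem mem_inv_D_iff {n : ℕ} {π : Equiv.Perm (Fin n)} {J : Set ℕ} :
    π ∈ (D n J)⁻¹ ↔ desWord (word π) = J := by
  rw [Set.mem_inv, ← Des_inv]; exact Iff.rfl

theorem desWord_of_mem_K {n : ℕ} {S : SYT n} {π : Equiv.Perm (Fin n)} (h : π ∈ K S) :
    desWord (word π) = S.des :=
  ((mem_K_iff.1 h).desWord_eq (isWord_word π).nodup).trans S.desWord_rowWord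

/-! ### Moves and invariants of Knuth equivalence -/

/-- A large letter moves through a decreasing word whose left neighbour is between. -/
theorem KE.cons_cons_ke_cons_append {y z : ℕ} {d : List ℕ} (hd : (y :: d).Pairwise (· > ·))
    (hyz : y < z) : KE (y :: z :: d) (y :: (d ++ [z])) := by
  induction d generalizing y with
  | nil => exact KE.refl _
  | cons x d ih =>
    rw [List.pairwise_cons] at hd
    have hx : x < y := hd.1 x (by simp)
    exact (KE.left [] d hx hyz).symm.trans ((ih hd.2 (hx.trans hyz)).cons y)

/-- A large letter moves through an increasing word whose right neighbour is between. -/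
theorem KE.append_pair_ke_cons_append {y z : ℕ} {a : List ℕ}
    (ha : (a ++ [y]).Pairwise (· < ·)) (hyz : y < z) : KE (a ++ [z, y]) (z :: (a ++ [y])) := by
  have h := (KE.cons_cons_ke_cons_append (d := a.reverse) (y := y) ?_ hyz).reverse
  · simpa using h
  · have := List.pairwise_reverse.2 ha
    simpa using this

/-! ### Increasing subwords as an invariant of Knuth classes -/

/-- The word has an increasing subword of length `m`. -/
def HasInc (w : List ℕ) (m : ℕ) : Prop :=
  ∃ s : List ℕ, s.Sublist w ∧ s.Pairwise (· < ·) ∧ s.length = m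

/-- An increasing subword of the factor may be exchanged for another one lying between letters of
the old one in value, since the parts before and after then still fit. -/
theorem HasInc.of_factor {a b u u' : List ℕ} {m : ℕ}
    (hu : ∀ s : List ℕ, s.Sublist u → s.Pairwise (· < ·) → ∃ s' : List ℕ, s'.Sublist u' ∧
      s'.Pairwise (· < ·) ∧ s'.length = s.length ∧
      ∀ e ∈ s', (∃ f ∈ s, f ≤ e) ∧ ∃ f ∈ s, e ≤ f)
    (h : HasInc (a ++ u ++ b) m) : HasInc (a ++ u' ++ b) m := by
  obtain ⟨s, hs, hp, hl⟩ := h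
  obtain ⟨s12, s3, rfl, h12, h3⟩ := List.sublist_append_iff.1 hs
  obtain ⟨s1, s2, rfl, h1, h2⟩ := List.sublist_append_iff.1 h12
  simp only [List.pairwise_append, List.mem_append] at hp
  obtain ⟨⟨hp1, hp2, hp12⟩, hp3, hp123⟩ := hp
  obtain ⟨t, ht, htp, htl, hte⟩ := hu s2 h2 hp2
  refine ⟨s1 ++ t ++ s3, (h1.append ht).append h3, ?_, ?_⟩
  · simp only [List.pairwise_append, List.mem_append]
    refine ⟨⟨hp1, htp, fun x hx e he => ?_⟩, hp3, fun x hx z hz => ?_⟩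
    · obtain ⟨⟨f, hf, hfe⟩, -⟩ := hte e he
      exact (hp12 x hx f hf).trans_le hfe
    · rcases hx with hx | hx
      · exact hp123 x (.inl hx) z hz
      · obtain ⟨-, f, hf, hfe⟩ := hte x hx
        exact hfe.trans_lt (hp123 f (.inr hf) z hz)
  · simpa [htl] using hl

theorem sublist_triple {s : List ℕ} {a b c : ℕ} (h : s.Sublist [a, b, c]) :
    s = [] ∨ s = [a] ∨ s = [b] ∨ s = [c] ∨ s = [a, b] ∨ s = [a, c] ∨ s = [b, c] ∨
      s = [a, b, c] := by
  have := List.mem_sublists.2 h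
  simp [List.sublists] at this
  tauto

/-- The only increasing pair that a move can destroy is x z. It is replaced by y z if the witness y
stands in front, by x y if it stands behind. -/
theorem KStep.hasInc {w v : List ℕ} (h : KStep w v) (m : ℕ) : HasInc w m ↔ HasInc v m := by
  cases h with
  | left a b hxy hyz =>
    rename_i x y z
    have e1 : a ++ y :: x :: z :: b = a ++ [y, x, z] ++ b := by simp
    have e2 : a ++ y :: z :: x :: b = a ++ [y, z, x] ++ b := by simp
    rw [e1, e2]
    constructor <;> refine HasInc.of_factor fun s hs hp => ?_
    · rcases sublist_triple hs with rfl | rfl | rfl | rfl | rfl | rfl | rfl | rfl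
      · exact ⟨[], by simp, by simp, rfl, by simp⟩
      · exact ⟨[y], by simp, by simp, rfl, by simp⟩
      · exact ⟨[x], by simp, by simp, rfl, by simp⟩
      · exact ⟨[z], by simp, by simp, rfl, by simp⟩
      · simp at hp; omega
      · exact ⟨[y, z], by simp, by simp; omega, rfl, by simp⟩
      · exact ⟨[y, z], by simp, by simp; omega, rfl, by simp; omega⟩
      · simp at hp; omega
    · rcases sublist_triple hs with rfl | rfl | rfl | rfl | rfl | rfl | rfl | rfl
      · exact ⟨[], by simp, by simp, rfl, by simp⟩
      · exact ⟨[y], by simp, by simp, rfl, by simp⟩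
      · exact ⟨[z], by simp, by simp, rfl, by simp⟩
      · exact ⟨[x], by simp, by simp, rfl, by simp⟩
      · exact ⟨[y, z], by simp, by simp; omega, rfl, by simp⟩
      · simp at hp; omega
      · simp at hp; omega
      · simp at hp; omega
  | right a b hxy hyz =>
    rename_i x y z
    have e1 : a ++ x :: z :: y :: b = a ++ [x, z, y] ++ b := by simp
    have e2 : a ++ z :: x :: y :: b = a ++ [z, x, y] ++ b := by simp
    rw [e1, e2]
    constructor <;> refine HasInc.of_factor fun s hs hp => ?_
    · rcases sublist_triple hs with rfl | rfl | rfl | rfl | rfl | rfl | rfl | rfl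
      · exact ⟨[], by simp, by simp, rfl, by simp⟩
      · exact ⟨[x], by simp, by simp, rfl, by simp⟩
      · exact ⟨[z], by simp, by simp, rfl, by simp⟩
      · exact ⟨[y], by simp, by simp, rfl, by simp⟩
      · exact ⟨[x, y], by simp, by simp; omega, rfl, by simp; omega⟩
      · exact ⟨[x, y], by simp, by simp; omega, rfl, by simp⟩
      · simp at hp; omega
      · simp at hp; omega
    · rcases sublist_triple hs with rfl | rfl | rfl | rfl | rfl | rfl | rfl | rfl
      · exact ⟨[], by simp, by simp, rfl, by simp⟩
      · exact ⟨[z], by simp, by simp, rfl, by simp⟩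
      · exact ⟨[x], by simp, by simp, rfl, by simp⟩
      · exact ⟨[y], by simp, by simp, rfl, by simp⟩
      · simp at hp; omega
      · simp at hp; omega
      · exact ⟨[x, y], by simp, by simp; omega, rfl, by simp⟩
      · simp at hp; omega

theorem KE.hasInc {w v : List ℕ} (h : KE w v) (m : ℕ) : HasInc w m ↔ HasInc v m := by
  induction h with
  | rel _ _ h => exact h.hasInc m
  | refl _ => exact Iff.rfl
  | symm _ _ _ ih => exact ih.symm
  | trans _ _ _ _ _ ih ih' => exact ih.trans ih'

/-- An increasing subword of `u ++ v` lies in `u` or in `v` if all letters of `u` exceed those of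
`v`. -/
theorem HasInc.append_or {u v : List ℕ} {m : ℕ} (huv : ∀ x ∈ u, ∀ y ∈ v, y < x)
    (h : HasInc (u ++ v) m) : HasInc u m ∨ HasInc v m := by
  obtain ⟨s, hs, hp, hl⟩ := h
  obtain ⟨s1, s2, rfl, h1, h2⟩ := List.sublist_append_iff.1 hs
  rcases s1 with - | ⟨x, s1⟩
  · exact .inr ⟨s2, h2, by simpa using hp, by simpa using hl⟩
  · rcases s2 with - | ⟨y, s2⟩
    · exact .inl ⟨x :: s1, h1, by simpa using hp, by simpa using hl⟩
    · have h3 := huv x (h1.subset (by simp)) y (h2.subset (by simp))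
      simp at hp
      have := hp.1 y (by simp)
      omega

theorem HasInc.le_length {u : List ℕ} {m : ℕ} (h : HasInc u m) : m ≤ u.length := by
  obtain ⟨s, hs, -, rfl⟩ := h
  exact hs.length_le

theorem HasInc.le_one {u : List ℕ} {m : ℕ} (hu : u.Pairwise (· > ·)) (h : HasInc u m) : m ≤ 1 := by
  obtain ⟨s, hs, hp, rfl⟩ := h
  rcases s with - | ⟨x, - | ⟨y, s⟩⟩
  · simp
  · simp
  · have := hu.sublist hs
    simp at this hp
    omega

theorem HasInc.of_sublist {u v : List ℕ} {m : ℕ} (h : u.Sublist v) (hu : u.Pairwise (· < ·))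
    (hm : u.length = m) : HasInc v m := ⟨u, h, hu, hm⟩

/-! ### Deleting a letter -/

/-- The order isomorphism from `ℕ` to `ℕ` without `c`. -/
def up (c x : ℕ) : ℕ := if x < c then x else x + 1

/-- The inverse of `up c` away from `c`. -/
def dn (c x : ℕ) : ℕ := if x < c then x else x - 1

/-- Delete the letter `c` and standardise. -/
def del (c : ℕ) (s : List ℕ) : List ℕ := (s.filter (fun x => x ≠ c)).map (dn c)

theorem dn_up (c x : ℕ) : dn c (up c x) = x := by unfold dn up; split_ifs <;> omega

theorem up_ne (c x : ℕ) : up c x ≠ c := by unfold up; split_ifs <;> omega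

theorem up_dn {c x : ℕ} (h : x ≠ c) : up c (dn c x) = x := by
  unfold dn up; split_ifs <;> omega

theorem up_strictMono (c : ℕ) : StrictMono (up c) := by
  intro x y h; unfold up; split_ifs <;> omega

theorem dn_strictMonoOn (c : ℕ) : StrictMonoOn (dn c) {x | x ≠ c} := by
  intro x hx y hy h
  simp only [Set.mem_ofPred_eq] at hx hy
  unfold dn; split_ifs <;> omega

theorem del_append (c : ℕ) (s t : List ℕ) : del c (s ++ t) = del c s ++ del c t := by simp [del]

theorem del_reverse (c : ℕ) (s : List ℕ) : del c s.reverse = (del c s).reverse := by simp [del]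

@[simp] theorem del_nil (c : ℕ) : del c [] = [] := rfl

theorem del_cons (c x : ℕ) (s : List ℕ) :
    del c (x :: s) = if x = c then del c s else dn c x :: del c s := by
  unfold del
  split_ifs with h <;> simp [h]

theorem del_cons_self (c : ℕ) (s : List ℕ) : del c (c :: s) = del c s := by simp [del_cons]

theorem del_cons_lt {c x : ℕ} (h : x < c) (s : List ℕ) : del c (x :: s) = x :: del c s := by
  rw [del_cons, if_neg h.ne, dn, if_pos h]

theorem del_cons_gt {c x : ℕ} (h : c < x) (s : List ℕ) : del c (x :: s) = (x - 1) :: del c s := by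
  rw [del_cons, if_neg h.ne', dn, if_neg (by omega)]

theorem del_of_lt {c : ℕ} {s : List ℕ} (h : ∀ x ∈ s, x < c) : del c s = s := by
  induction s with
  | nil => rfl
  | cons x s ih => rw [del_cons_lt (h x (by simp)), ih fun y hy => h y (by simp [hy])]

theorem del_map_up (c : ℕ) (s : List ℕ) : del c (s.map (up c)) = s := by
  induction s with
  | nil => rfl
  | cons x s ih => rw [List.map_cons, del_cons, if_neg (up_ne c x), dn_up, ih]

theorem del_range'_lt {c a m : ℕ} (h : c < a) :
    del c (List.range' a m) = List.range' (a - 1) m := by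
  induction m generalizing a with
  | zero => rfl
  | succ m ih =>
    rw [List.range'_succ, del_cons_gt h, ih (by omega), List.range'_succ]
    congr 2; omega

theorem del_range'_ge {c a m : ℕ} (h : a + m ≤ c) : del c (List.range' a m) = List.range' a m :=
  del_of_lt fun x hx => by rw [List.mem_range'_1] at hx; omega

theorem del_range'_mem {c a m : ℕ} (h : a ≤ c) (h' : c < a + m + 1) :
    del c (List.range' a (m + 1)) = List.range' a m := by
  obtain ⟨k, rfl⟩ : ∃ k, c = a + k := ⟨c - a, by omega⟩
  obtain ⟨l, rfl⟩ : ∃ l, m = k + l := ⟨m - k, by omega⟩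
  have e : List.range' a (k + l + 1) =
      List.range' a k ++ (a + k) :: List.range' (a + k + 1) l := by
    rw [← List.range'_succ, List.range'_append_1]; rfl
  rw [e, del_append, del_range'_ge le_rfl, del_cons_self, del_range'_lt (by omega)]
  simp [List.range'_append_1]

theorem mem_del {c x : ℕ} {s : List ℕ} : x ∈ del c s ↔ up c x ∈ s := by
  simp only [del, List.mem_map, List.mem_filter, decide_eq_true_eq]
  constructor
  · rintro ⟨y, ⟨hy, hyc⟩, rfl⟩; rwa [up_dn hyc]
  · intro h; exact ⟨_, ⟨h, up_ne c x⟩, dn_up c x⟩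

theorem pair_sublist_del {c x y : ℕ} {s : List ℕ} :
    [x, y].Sublist (del c s) ↔ [up c x, up c y].Sublist s := by
  have h1 : [x, y] = [dn c (up c x), dn c (up c y)] := by rw [dn_up, dn_up]
  rw [del, h1, pair_sublist_map (dn_strictMonoOn c).injOn (by simp) (up_ne c x) (up_ne c y),
    pair_sublist_filter]
  simp [up_ne]

theorem length_del_add_one {c : ℕ} {s : List ℕ} (h : s.Nodup) :
    s.length ≤ (del c s).length + 1 := by
  rw [del, List.length_map]
  induction s with
  | nil => simp
  | cons x s ih =>
    rw [List.nodup_cons] at h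
    by_cases hx : x = c
    · have : s.filter (fun y => y ≠ c) = s := List.filter_eq_self.2 fun y hy => by
        simp; rintro rfl; exact h.1 (hx ▸ hy)
      simp only [List.length_cons]
      rw [List.filter_cons_of_neg (by simp [hx]), this]
    · rw [List.filter_cons_of_pos (by simp [hx])]
      have := ih h.2
      simp only [List.length_cons]; omega

theorem IsWord.del {n c : ℕ} {s : List ℕ} (hs : IsWord (n + 1) s) (h1 : 1 ≤ c) (h2 : c ≤ n + 1) :
    IsWord n (del c s) := by
  refine IsWord.of_nodup ?_ fun x => ?_
  · refine (hs.nodup.filter _).map_on fun x hx y hy h => ?_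
    simp only [List.mem_filter, decide_eq_true_eq] at hx hy
    exact (dn_strictMonoOn c).injOn hx.2 hy.2 h
  · rw [mem_del, hs.mem_iff]
    unfold up; split_ifs <;> omega

theorem pair_sublist_range' {a b s m : ℕ} :
    [a, b].Sublist (List.range' s m) ↔ s ≤ a ∧ a < b ∧ b < s + m := by
  constructor
  · intro h
    have h1 := pair_sublist_mem h
    simp only [List.mem_range'_1] at h1
    have := (List.pairwise_lt_range' (s := s) (n := m)).sublist h
    simp at this
    omega
  · rintro ⟨h1, h2, h3⟩
    exact pair_sublist_of_pairwise List.pairwise_lt_range' (by simp; omega) (by simp; omega) h2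

theorem pair_sublist_range'_reverse {a b s m : ℕ} :
    [a, b].Sublist (List.range' s m).reverse ↔ s ≤ b ∧ b < a ∧ a < s + m := by
  rw [pair_sublist_reverse, pair_sublist_range']

theorem pairwise_gt_range'_reverse {s m : ℕ} : (List.range' s m).reverse.Pairwise (· > ·) :=
  List.pairwise_reverse.2 List.pairwise_lt_range'

/-! ### Closure under deletion of one letter -/

/-- If a word contains an element of the class of `w` after deleting one letter, then every
equivalent word contains an element of the class of `w` or `v` in the same way. -/
def DelClosed (n : ℕ) (w v : List ℕ) : Prop :=
  ∀ σ σ' c, IsWord (n + 1) σ → KE σ σ' → 1 ≤ c → c ≤ n + 1 → KE (del c σ) w →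
    ∃ c', 1 ≤ c' ∧ c' ≤ n + 1 ∧ (KE (del c' σ') w ∨ KE (del c' σ') v)

theorem DelClosed.congr {n : ℕ} {w v w' v' : List ℕ} (h : DelClosed n w v) (hw : KE w w')
    (hv : KE v v') : DelClosed n w' v' := by
  intro σ σ' c hσ hσσ' h1 h2 hc
  obtain ⟨c', h3, h4, h5⟩ := h σ σ' c hσ hσσ' h1 h2 (hc.trans hw.symm)
  exact ⟨c', h3, h4, h5.imp (fun h => h.trans hw) fun h => h.trans hv⟩

theorem KE.pair_succ {w v : List ℕ} (h : KE w v) (hw : w.Nodup) (j : ℕ) :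
    [j, j + 1].Sublist w ↔ [j, j + 1].Sublist v :=
  (h.pair_sublist hw (Nat.lt_succ_self j) (fun x _ => by omega)).1

theorem pair_sublist_chain {w : List ℕ} (hw : w.Nodup) {a b : ℕ} (hab : a < b)
    (h : ∀ j, a ≤ j → j < b → [j, j + 1].Sublist w) : [a, b].Sublist w := by
  induction b, hab using Nat.le_induction with
  | base => exact h a le_rfl (Nat.lt_succ_self a)
  | succ b hb ih =>
    exact pair_sublist_trans hw (ih fun j h1 h2 => h j h1 (by omega)) (h b (by omega) (by omega))

theorem pair_sublist_chain_desc {w : List ℕ} (hw : w.Nodup) {a b : ℕ} (hab : a < b)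
    (h : ∀ j, a ≤ j → j < b → [j + 1, j].Sublist w) : [b, a].Sublist w := by
  induction b, hab using Nat.le_induction with
  | base => exact h a le_rfl (Nat.lt_succ_self a)
  | succ b hb ih =>
    exact pair_sublist_trans hw (h b (by omega) (by omega)) (ih fun j h1 h2 => h j h1 (by omega))

theorem pair_sublist_swap {x y a b : ℕ} {l m : List ℕ} (h : ¬ (x = a ∧ y = b))
    (hs : [x, y].Sublist (l ++ a :: b :: m)) : [x, y].Sublist (l ++ b :: a :: m) := by
  simp only [pair_sublist_append, pair_sublist_cons, List.mem_cons] at hs ⊢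
  tauto

theorem mem_left_of_pair_sublist {x y : ℕ} {a b : List ℕ} (h : [x, y].Sublist (a ++ b))
    (hy : y ∈ a) (hn : (a ++ b).Nodup) : x ∈ a := by
  by_contra hx
  have h1 : x ∈ b := (List.mem_append.1 (pair_sublist_mem h).1).resolve_left hx
  exact pair_sublist_asymm hn h (pair_sublist_append.2 (.inr (.inr ⟨hy, h1⟩)))

theorem IsWord.cons_map_up {n y : ℕ} {w : List ℕ} (hw : IsWord n w) (h1 : 1 ≤ y)
    (h2 : y ≤ n + 1) : IsWord (n + 1) (y :: w.map (up y)) := by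
  refine IsWord.of_nodup ?_ fun x => ?_
  · rw [List.nodup_cons]
    refine ⟨?_, hw.nodup.map (up_strictMono y).injective⟩
    simp only [List.mem_map, not_exists, not_and]
    exact fun x _ => up_ne y x
  · simp only [List.mem_cons, List.mem_map, hw.mem_iff]
    constructor
    · rintro (rfl | ⟨z, hz, rfl⟩)
      · omega
      · unfold up; split_ifs <;> omega
    · rintro ⟨h3, h4⟩
      by_cases hx : x = y
      · exact .inl hx
      · refine .inr ⟨dn y x, ?_, up_dn hx⟩
        unfold dn; split_ifs <;> omega

/-! ### Deletion closed pairs: a largest letter that cannot reach the end of the word -/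

section

variable {n u : ℕ} {α γ v : List ℕ}

/-- A word whose letter `n` can not occur further to the right in its class. -/
theorem not_ke_del_of_length
    (hmax : ∀ a b, KE (α ++ n :: u :: γ) (a ++ n :: b) → a.length ≤ α.length)
    {A B : List ℕ} (hA : A.Nodup) (hl : α.length + 2 ≤ A.length) {c : ℕ} (hc : c ≤ n) :
    ¬ KE (del c (A ++ (n + 1) :: B)) (α ++ n :: u :: γ) := by
  intro h
  rw [del_append, del_cons_gt (by omega), Nat.add_sub_cancel] at h
  have h1 := hmax _ _ h.symm
  have := length_del_add_one (c := c) hA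
  omega

theorem letter_bounds (hπ : IsWord n (α ++ n :: u :: γ)) (hα : n - 1 ∈ α) :
    1 ≤ u ∧ u + 2 ≤ n := by
  have h1 := hπ.mem_iff (x := u)
  simp only [List.mem_append, List.mem_cons, true_or, or_true, true_iff] at h1
  have hn := hπ.nodup
  rw [List.nodup_append] at hn
  have h2 : u ≠ n := by
    have := hn.2.1
    rw [List.nodup_cons] at this
    rintro rfl
    simp at this
  have h3 := hn.2.2 (n - 1) hα u (by simp)
  omega

/-- A new letter i+1, with larger letters shifted up, is inserted just before n. Since u < i+1 <
n+1, it witnesses the exchange of n+1 and u. Deleting it from the word before the exchange gives π =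
α n u γ, so some deletion from the word after the exchange falls into one of the two classes. The
class of π is excluded, as its largest letter cannot stand so far right. -/
theorem exists_ke_of_slot (hπ : IsWord n (α ++ n :: u :: γ)) (hα : n - 1 ∈ α)
    (hmax : ∀ a b, KE (α ++ n :: u :: γ) (a ++ n :: b) → a.length ≤ α.length)
    (hG : DelClosed n (α ++ n :: u :: γ) v) {i : ℕ} (hui : u ≤ i) (hin : i + 2 ≤ n) :
    IsWord (n + 1) (α.map (up (i + 1)) ++ (i + 1) :: u :: (n + 1) :: γ.map (up (i + 1))) ∧
    ∃ c, 1 ≤ c ∧ c ≤ n + 1 ∧ KE (del c (α.map (up (i + 1)) ++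
      (i + 1) :: u :: (n + 1) :: γ.map (up (i + 1)))) v := by
  have hup_n : up (i + 1) n = n + 1 := by unfold up; split_ifs <;> omega
  have hup_u : up (i + 1) u = u := by unfold up; split_ifs <;> omega
  set α' := α.map (up (i + 1)) with hα'
  set γ' := γ.map (up (i + 1)) with hγ'
  have hσ : IsWord (n + 1) (α' ++ (i + 1) :: (n + 1) :: u :: γ') := by
    refine List.Perm.trans ?_ (hπ.cons_map_up (y := i + 1) (by omega) (by omega))
    simp only [List.map_append, List.map_cons, hup_n, hup_u]
    exact List.perm_middle
  have hσσ' : KE (α' ++ (i + 1) :: (n + 1) :: u :: γ') (α' ++ (i + 1) :: u :: (n + 1) :: γ') :=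
    (KE.left α' γ' (by omega) (by omega)).symm
  have hσ' := hσ.ke hσσ'
  refine ⟨hσ', ?_⟩
  have hdel : del (i + 1) (α' ++ (i + 1) :: (n + 1) :: u :: γ') = α ++ n :: u :: γ := by
    rw [del_append, del_cons_self, hα', del_map_up, del_cons_gt (by omega),
      del_cons_lt (by omega), hγ', del_map_up, Nat.add_sub_cancel]
  obtain ⟨c, h1, h2, h3⟩ := hG _ _ (i + 1) hσ hσσ' (by omega) (by omega) (KE.of_eq hdel)
  refine ⟨c, h1, h2, h3.resolve_left fun h => ?_⟩
  have e : α' ++ (i + 1) :: u :: (n + 1) :: γ' = (α' ++ [i + 1, u]) ++ (n + 1) :: γ' := by simp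
  have hn' := hσ'.nodup
  rw [e] at h hn'
  -- A deletion c ≤ n leaves the largest letter to the right of its extreme position. Deleting n+1
  -- itself needs a separate argument about ascents.
  rcases Nat.lt_succ_iff_lt_or_eq.1 (Nat.lt_succ_of_le h2) with hc | rfl
  · exact not_ke_del_of_length hmax (List.nodup_append.1 hn').1 (by simp [hα']) (by omega) h
  · rw [del_append, del_cons_self, ← del_append, del_of_lt] at h
    swap
    · intro x hx
      have h5 : x ∈ (α' ++ [i + 1, u]) ++ (n + 1) :: γ' := by
        simp only [List.mem_append, List.mem_cons] at hx ⊢; tauto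
      have h6 := hσ'.mem_iff (x := x)
      rw [e] at h6
      have h7 := h6.1 h5
      have h8 : x ≠ n + 1 := by
        rintro rfl
        rw [List.nodup_append, List.nodup_cons] at hn'
        rcases List.mem_append.1 hx with hx | hx
        · exact hn'.2.2 _ hx _ (by simp) rfl
        · exact hn'.2.1.1 hx
      omega
    have hτn := hπ.nodup
    rw [← h.perm.nodup_iff] at hτn
    set τ := (α' ++ [i + 1, u]) ++ γ' with hτ
    have hdelτ : del (i + 1) τ = α ++ u :: γ := by
      rw [hτ, del_append, del_append, hα', hγ', del_map_up, del_map_up, del_cons_self,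
        del_cons_lt (by omega)]
      simp
    have hsub : (α ++ u :: γ).Sublist (α ++ n :: u :: γ) :=
      List.Sublist.append (List.Sublist.refl _) (List.sublist_cons_self _ _)
    -- Downward induction starting from the ascent at n-1. An ascent of π at j is also one of τ; and
    -- since τ without i+1 is π without n, an ascent of τ at j is an ascent of π at j-1 as long as
    -- j-1 ≥ i+1.
    have key : ∀ k, i + 1 ≤ n - 1 - k → [n - 1 - k, n - 1 - k + 1].Sublist (α ++ n :: u :: γ) := by
      intro k
      induction k with
      | zero =>
        intro _
        rw [Nat.sub_zero, Nat.sub_add_cancel (by omega), pair_sublist_append]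
        exact .inr (.inr ⟨hα, by simp⟩)
      | succ k ih =>
        intro hk
        have h5 := (h.pair_succ hτn _).2 (ih (by omega))
        have e1 : n - 1 - k = up (i + 1) (n - 1 - (k + 1)) := by
          unfold up; split_ifs <;> omega
        have e2 : n - 1 - k + 1 = up (i + 1) (n - 1 - (k + 1) + 1) := by
          unfold up; split_ifs <;> omega
        rw [e2, e1, ← pair_sublist_del, hdelτ] at h5
        exact h5.trans hsub
    have key' : ∀ j, i + 1 ≤ j → j < n → [j, j + 1].Sublist (α ++ n :: u :: γ) := by
      intro j hj hjn
      have := key (n - 1 - j) (by omega)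
      rwa [show n - 1 - (n - 1 - j) = j by omega] at this
    have hmem : i + 1 ∈ α := by
      rcases (show i + 1 ≤ n - 1 by omega).eq_or_lt with h5 | h5
      · rwa [h5]
      · exact mem_left_of_pair_sublist
          (pair_sublist_chain hπ.nodup h5 fun j h1 h2 => key' j h1 (by omega)) hα hπ.nodup
    -- The letter i+1 of α became i+2 in τ and stands before the inserted i+1, whereas the ascent of
    -- π at i+1 demands the opposite order.
    have h5 := (h.pair_succ hτn _).2 (key' (i + 1) le_rfl (by omega))
    refine pair_sublist_asymm hτn h5 ?_
    rw [hτ, List.append_assoc, pair_sublist_append]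
    refine .inr (.inr ⟨?_, by simp⟩)
    rw [hα', List.mem_map]
    exact ⟨i + 1, hmem, by simp [up]⟩

/-- The extra letter n is placed after u and the old n becomes n+1; the new letter witnesses the
exchange of n+1 and u. Deleting n or n+1 after the exchange gives α u n γ, which maximality keeps
out of the class of π. Deleting a smaller letter leaves n before n-1, which also excludes π. -/
theorem ke_of_top_slot (hπ : IsWord n (α ++ n :: u :: γ)) (hα : n - 1 ∈ α)
    (hmax : ∀ a b, KE (α ++ n :: u :: γ) (a ++ n :: b) → a.length ≤ α.length)
    (hG : DelClosed n (α ++ n :: u :: γ) v) :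
    IsWord (n + 1) (α ++ u :: (n + 1) :: n :: γ) ∧
    (KE v (α ++ u :: n :: γ) ∨ ∃ c, 1 ≤ c ∧ c ≤ n - 1 ∧
      KE (del c (α ++ u :: (n + 1) :: n :: γ)) v) := by
  obtain ⟨hu1, hu2⟩ := letter_bounds hπ hα
  have hlt : ∀ x, x ∈ α ∨ x = u ∨ x ∈ γ → x < n := by
    intro x hx
    have h1 : x ∈ α ++ n :: u :: γ := by
      simp only [List.mem_append, List.mem_cons]; tauto
    have h2 := hπ.mem_iff.1 h1
    have hn := hπ.nodup
    have : x ≠ n := by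
      rintro rfl
      rw [List.nodup_append, List.nodup_cons] at hn
      rcases hx with hx | rfl | hx
      · exact hn.2.2 _ hx _ (by simp) rfl
      · exact hn.2.1.1 (by simp)
      · exact hn.2.1.1 (by simp [hx])
    omega
  have hσ : IsWord (n + 1) (α ++ (n + 1) :: u :: n :: γ) := by
    refine List.Perm.trans ?_ (hπ.cons_map_up (y := n + 1) (by omega) (by omega))
    have : (α ++ n :: u :: γ).map (up (n + 1)) = α ++ n :: u :: γ := by
      refine (List.map_congr_left fun x hx => ?_).trans (List.map_id _)
      have := hπ.mem_iff.1 hx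
      rw [up, if_pos (by omega), id]
    rw [this]
    refine List.perm_middle.trans (List.Perm.cons _ (List.Perm.append_left α ?_))
    exact List.Perm.swap _ _ _
  have hσσ' : KE (α ++ (n + 1) :: u :: n :: γ) (α ++ u :: (n + 1) :: n :: γ) :=
    (KE.right α γ (by omega) (by omega)).symm
  have hσ' := hσ.ke hσσ'
  have hdelα : ∀ c, n ≤ c → del c α = α := fun c hc => del_of_lt fun x hx => by
    have := hlt x (.inl hx); omega
  have hdelγ : ∀ c, n ≤ c → del c γ = γ := fun c hc => del_of_lt fun x hx => by
    have := hlt x (.inr (.inr hx)); omega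
  have hdel : del n (α ++ (n + 1) :: u :: n :: γ) = α ++ n :: u :: γ := by
    rw [del_append, del_cons_gt (by omega), del_cons_lt (by omega), del_cons_self,
      hdelα n le_rfl, hdelγ n le_rfl, Nat.add_sub_cancel]
  have hdel1 : del n (α ++ u :: (n + 1) :: n :: γ) = α ++ u :: n :: γ := by
    rw [del_append, del_cons_lt (by omega), del_cons_gt (by omega), del_cons_self,
      hdelα n le_rfl, hdelγ n le_rfl, Nat.add_sub_cancel]
  have hdel2 : del (n + 1) (α ++ u :: (n + 1) :: n :: γ) = α ++ u :: n :: γ := by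
    rw [del_append, del_cons_lt (by omega), del_cons_self, del_cons_lt (by omega),
      hdelα _ (by omega), hdelγ _ (by omega)]
  have hno : ¬ KE (α ++ u :: n :: γ) (α ++ n :: u :: γ) := by
    intro h
    have := hmax (α ++ [u]) γ (by simpa using h.symm)
    simp at this
  refine ⟨hσ', ?_⟩
  obtain ⟨c, h1, h2, h3⟩ := hG _ _ n hσ hσσ' (by omega) (by omega) (KE.of_eq hdel)
  rcases lt_trichotomy c n with hc | rfl | hc
  · refine .inr ⟨c, h1, by omega, h3.resolve_left fun h => ?_⟩
    have h4 : [n - 1, n - 1 + 1].Sublist (α ++ n :: u :: γ) := by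
      rw [Nat.sub_add_cancel (by omega), pair_sublist_append]
      exact .inr (.inr ⟨hα, by simp⟩)
    have h5 := (h.symm.pair_succ hπ.nodup _).1 h4
    rw [pair_sublist_del, up, if_neg (by omega), up, if_neg (by omega),
      Nat.sub_add_cancel (by omega)] at h5
    refine pair_sublist_asymm hσ'.nodup h5 ?_
    rw [pair_sublist_append, pair_sublist_cons, pair_sublist_cons]
    exact .inr (.inl (.inl (.inr ⟨rfl, by simp⟩)))
  · rw [hdel1] at h3
    exact .inl (h3.resolve_left hno).symm
  · obtain rfl : c = n + 1 := by omega
    rw [hdel2] at h3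
    exact .inl (h3.resolve_left hno).symm

/-- The second alternative of `ke_of_top_slot` has to be refuted. It makes n-1 a descent of v, so
the deletions in all the slots u, …, n-2 must remove one of the two largest letters. The ascents of
v below n-1 can then be read off every slot word at once, and these readings contradict each other.
-/
theorem ke_swap_of_delClosed (hπ : IsWord n (α ++ n :: u :: γ)) (hα : n - 1 ∈ α)
    (hmax : ∀ a b, KE (α ++ n :: u :: γ) (a ++ n :: b) → a.length ≤ α.length)
    (hG : DelClosed n (α ++ n :: u :: γ) v) : KE v (α ++ u :: n :: γ) := by
  obtain ⟨hu1, hu2⟩ := letter_bounds hπ hα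
  obtain ⟨hσ, h | ⟨c, h1, h2, h3⟩⟩ := ke_of_top_slot hπ hα hmax hG
  · exact h
  exfalso
  have hord : ∀ c, 1 ≤ c → c ≤ n + 1 → ∀ σ, IsWord (n + 1) σ → KE (del c σ) v → ∀ j,
      [j, j + 1].Sublist v ↔ [up c j, up c (j + 1)].Sublist σ := by
    intro c h1 h2 σ hσ h j
    rw [← h.pair_succ (hσ.del h1 h2).nodup, pair_sublist_del]
  -- the letters `n - 1` and `n` of `v`
  have htop : ¬ [n - 1, n].Sublist v := by
    intro h4
    have h5 := hord c h1 (by omega) _ hσ h3 (n - 1)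
    rw [Nat.sub_add_cancel (by omega), up, if_neg (by omega), up, if_neg (by omega),
      Nat.sub_add_cancel (by omega)] at h5
    refine pair_sublist_asymm hσ.nodup (h5.1 h4) ?_
    rw [pair_sublist_append, pair_sublist_cons, pair_sublist_cons]
    exact .inr (.inl (.inl (.inr ⟨rfl, by simp⟩)))
  have hslot : ∀ i, u ≤ i → i + 2 ≤ n → ∀ j, j + 2 ≤ n → ([j, j + 1].Sublist v ↔
      [j, j + 1].Sublist (α.map (up (i + 1)) ++ (i + 1) :: u :: (n + 1) ::
        γ.map (up (i + 1)))) := by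
    intro i hui hin j hj
    obtain ⟨hσ, d, hd1, hd2, hd⟩ := exists_ke_of_slot hπ hα hmax hG hui hin
    have hdn : n ≤ d := by
      -- If d < n, the letters that become n-1 and n are n, which lies in the image of α, and n+1,
      -- which stands behind: an ascent of v at n-1.
      by_contra hc
      refine htop ?_
      have h5 := hord d hd1 hd2 _ hσ hd (n - 1)
      rw [Nat.sub_add_cancel (by omega), up, if_neg (by omega), up, if_neg (by omega),
        Nat.sub_add_cancel (by omega)] at h5
      rw [h5, pair_sublist_append]
      refine .inr (.inr ⟨?_, by simp⟩)
      rw [List.mem_map]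
      exact ⟨n - 1, hα, by rw [up, if_neg (by omega)]; omega⟩
    have h5 := hord d hd1 hd2 _ hσ hd j
    rwa [up, if_pos (by omega), up, if_pos (by omega)] at h5
  have hvu : ¬ [u, u + 1].Sublist v := by
    rw [hslot u le_rfl hu2 u hu2]
    intro h5
    refine pair_sublist_asymm (exists_ke_of_slot hπ hα hmax hG le_rfl hu2).1.nodup h5 ?_
    rw [pair_sublist_append, pair_sublist_cons]
    exact .inr (.inl (.inr ⟨rfl, by simp⟩))
  rcases hu2.eq_or_lt with hun | hun
  · -- `u = n - 2`
    -- For every c ≤ n-1 the letters that become u and u+1 are either u and n, or n-1 and n, and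
    -- both pairs stand in this order.
    refine hvu ?_
    rw [hord c h1 (by omega) _ hσ h3 u]
    by_cases hc : c = u + 1
    · rw [up, if_pos (by omega), up, if_neg (by omega), pair_sublist_append, pair_sublist_cons]
      exact .inr (.inl (.inr ⟨rfl, by simp; omega⟩))
    · rw [up, if_neg (by omega), up, if_neg (by omega), pair_sublist_append]
      refine .inr (.inr ⟨?_, by simp; omega⟩)
      rwa [show u + 1 = n - 1 by omega]
  · -- `u < n - 2`
    -- orders in `v` from the slot `n - 2`
    have htopslot : ∀ j, j + 3 ≤ n → [j, j + 1].Sublist (α ++ n :: u :: γ) →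
        [j, j + 1].Sublist v := by
      intro j hj h5
      rw [hslot (n - 2) (by omega) (by omega) j (by omega)]
      have e : n - 2 + 1 = n - 1 := by omega
      rw [e]
      have hup : ∀ x, x < n - 1 → up (n - 1) x = x := fun x hx => by rw [up, if_pos hx]
      have h6 : [up (n - 1) j, up (n - 1) (j + 1)].Sublist
          (α.map (up (n - 1)) ++ (n - 1) :: u :: (n + 1) :: γ.map (up (n - 1))) := by
        rw [← pair_sublist_del, del_append, del_map_up, del_cons_self, del_cons_lt (by omega),
          del_cons_gt (by omega), del_map_up, Nat.add_sub_cancel]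
        exact pair_sublist_swap (by omega) h5
      rwa [hup j (by omega), hup (j + 1) (by omega)] at h6
    -- orders in `v` from the slot `u`
    have hlowslot : ∀ j, u ≤ j → j + 3 ≤ n → [j + 1, j + 2].Sublist v →
        [j, j + 1].Sublist (α ++ n :: u :: γ) := by
      intro j hj hjn h5
      rw [hslot u le_rfl (by omega) (j + 1) (by omega)] at h5
      have h6 : [up (u + 1) j, up (u + 1) (j + 1)].Sublist
          (α.map (up (u + 1)) ++ (u + 1) :: u :: (n + 1) :: γ.map (up (u + 1))) := by
        rw [up.eq_def _ (j + 1), if_neg (by omega)]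
        rcases hj.eq_or_lt with rfl | hj
        · rw [up, if_pos (by omega)]
          have hα' : u + 1 ∉ α.map (up (u + 1)) := by
            simp only [List.mem_map, not_exists, not_and]
            exact fun x _ => up_ne _ x
          have hγ' : u + 1 ∉ u :: (n + 1) :: γ.map (up (u + 1)) := by
            simp only [List.mem_cons, List.mem_map, not_or, not_exists, not_and]
            exact ⟨by omega, by omega, fun x _ => up_ne _ x⟩
          rw [pair_sublist_append, pair_sublist_cons] at h5
          rcases h5 with h5 | (h5 | h5) | h5
          · exact absurd (pair_sublist_mem h5).1 hα'
          · exact absurd (pair_sublist_mem h5).1 hγ'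
          · rw [pair_sublist_append, pair_sublist_cons, pair_sublist_cons]
            refine .inr (.inl (.inl (.inr ⟨rfl, ?_⟩)))
            exact (List.mem_cons.1 h5.2).resolve_left (by omega)
          · exact absurd h5.1 hα'
        · rwa [up, if_neg (by omega)]
      rw [← pair_sublist_del, del_append, del_map_up, del_cons_self, del_cons_lt (by omega),
          del_cons_gt (by omega), del_map_up, Nat.add_sub_cancel] at h6
      exact pair_sublist_swap (by omega) h6
    -- Going up from u: by the slot u an ascent of v at j+1 comes from an ascent of π at j, which by
    -- the slot n-2 is an ascent of v at j.
    have hdesc : ∀ j, u ≤ j → j + 2 ≤ n → ¬ [j, j + 1].Sublist v := by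
      intro j hj
      induction j, hj using Nat.le_induction with
      | base => exact fun _ => hvu
      | succ j hj ih =>
        intro hjn h5
        exact ih (by omega) (htopslot j (by omega) (hlowslot j hj (by omega) h5))
    have hdescπ : ∀ j, u ≤ j → j + 3 ≤ n → [j + 1, j].Sublist (α ++ n :: u :: γ) := by
      intro j hj hjn
      refine (not_pair_sublist_iff hπ.nodup (hπ.mem_iff.2 (by omega)) (hπ.mem_iff.2 (by omega))
        (by omega)).1 fun h5 => hdesc j hj (by omega) (htopslot j hjn h5)
    have h5 : [n - 2, u].Sublist (α ++ n :: u :: γ) :=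
      pair_sublist_chain_desc hπ.nodup (by omega) fun j h1 h2 => hdescπ j h1 (by omega)
    have h6 : n - 2 ∈ α := by
      have h7 : [n - 2, u].Sublist (α ++ [n, u] ++ γ) := by simpa using h5
      have h8 := mem_left_of_pair_sublist h7 (by simp) (by simpa using hπ.nodup)
      simp only [List.mem_append, List.mem_cons, List.not_mem_nil, or_false] at h8
      rcases h8 with h8 | h8 | h8
      · exact h8
      · omega
      · omega
    -- In the word of the slot n-2 the letter n-2 of α stands before the inserted letter n-1, so v
    -- has an ascent at n-2 after all.
    refine hdesc (n - 2) (by omega) (by omega) ?_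
    rw [hslot (n - 2) (by omega) (by omega) (n - 2) (by omega), pair_sublist_append]
    refine .inr (.inr ⟨?_, by simp⟩)
    rw [List.mem_map]
    exact ⟨n - 2, h6, by rw [up, if_pos (by omega)]⟩

end

/-- Among the words of the class, take one in which n stands furthest right. It is not last there,
so a letter u follows it, and the ascent at n-1 puts n-1 into α. -/
theorem exists_swap_of_delClosed {n : ℕ} {w v : List ℕ} (hw : IsWord n w)
    (hasc : [n - 1, n].Sublist w) (hne : ∀ a, ¬ KE w (a ++ [n])) (hG : DelClosed n w v) :
    ∃ α u γ, KE w (α ++ n :: u :: γ) ∧ KE v (α ++ u :: n :: γ) ∧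
      (∀ a b, KE w (a ++ n :: b) → a.length ≤ α.length) ∧ n - 1 ∈ α := by
  classical
  have hlen : ∀ a b, KE w (a ++ n :: b) → a.length ≤ n := by
    intro a b h
    have := (hw.ke h).length_eq
    simp at this
    omega
  obtain ⟨s, t, hst⟩ := List.append_of_mem (pair_sublist_mem hasc).2
  have hex := Nat.findGreatest_spec (P := fun k => ∃ a b, a.length = k ∧ KE w (a ++ n :: b))
    (hlen s t (KE.of_eq hst)) ⟨s, t, rfl, KE.of_eq hst⟩
  obtain ⟨α, b, hα, hb⟩ := hex
  have hmax : ∀ a b, KE w (a ++ n :: b) → a.length ≤ α.length := by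
    intro a b h
    rw [hα]
    exact Nat.le_findGreatest (hlen a b h) ⟨a, b, rfl, h⟩
  rcases b with - | ⟨u, γ⟩
  · exact absurd hb (hne α)
  have hπ := hw.ke hb
  have hmem : n - 1 ∈ α := by
    have hn : n - 1 < n := by
      have := hw.nodup.sublist hasc
      simp at this
      omega
    have h1 : [n - 1, n - 1 + 1].Sublist w := by rwa [Nat.sub_add_cancel (by omega)]
    have h2 := (hb.pair_succ hw.nodup _).1 h1
    rw [Nat.sub_add_cancel (by omega)] at h2
    have e : α ++ n :: u :: γ = α ++ [n] ++ u :: γ := by simp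
    rw [e] at h2
    have h3 := mem_left_of_pair_sublist h2 (by simp) (by rw [← e]; exact hπ.nodup)
    simp only [List.mem_append, List.mem_singleton] at h3
    exact h3.resolve_right (by omega)
  exact ⟨α, u, γ, hb, ke_swap_of_delClosed hπ hmem (fun a b h => hmax a b (hb.trans h))
    (hG.congr hb (KE.refl v)), hmax, hmem⟩

/-! ### Three explicit families of words -/

/-- A hook word: with `D` the decreasing word of `p+2, …, p+q+1`, this is
`(p+q+2) D 1 ⋯ (p+1) (p+q+3)`. -/
def hookW (p q : ℕ) : List ℕ :=
  (p + q + 2) :: ((List.range' (p + 2) q).reverse ++ (List.range' 1 (p + 1) ++ [p + q + 3]))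

/-- `(p+q+2) (p+q+3) D 1 ⋯ (p+1)` -/
def bumpW (p q : ℕ) : List ℕ :=
  (p + q + 2) :: (p + q + 3) :: ((List.range' (p + 2) q).reverse ++ List.range' 1 (p + 1))

theorem HasInc.of_cons {x m : ℕ} {l : List ℕ} (h : HasInc (x :: l) (m + 1)) : HasInc l m := by
  obtain ⟨s, hs, hp, hl⟩ := h
  rcases s with - | ⟨y, s⟩
  · simp at hl
  · exact ⟨s, by simpa using hs.tail, (List.pairwise_cons.1 hp).2, by simpa using hl⟩

theorem isWord_hookW (p q : ℕ) : IsWord (p + q + 3) (hookW p q) := by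
  refine IsWord.of_nodup ?_ fun x => ?_
  · simp [hookW, List.nodup_append, List.nodup_range']
    grind
  · simp [hookW]; omega

theorem isWord_bumpW (p q : ℕ) : IsWord (p + q + 3) (bumpW p q) := by
  refine IsWord.of_nodup ?_ fun x => ?_
  · simp [bumpW, List.nodup_append, List.nodup_range']
    grind
  · simp [bumpW]; omega

theorem hasInc_hookW (p q : ℕ) : HasInc (hookW p q) (p + 2) := by
  refine HasInc.of_sublist (u := List.range' 1 (p + 1) ++ [p + q + 3]) ?_ ?_ (by simp)
  · exact (List.sublist_append_right _ _).trans (List.sublist_cons_self _ _)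
  · simp [List.pairwise_append, List.pairwise_lt_range']
    grind

/-- All letters before 1 ⋯ (p+1) exceed it, so an increasing subword lies in this run or before it.
The part before is decreasing after its first letter and contributes at most two letters. This
separates the class from that of `hookW p q`, although both have the same descents. -/
theorem not_hasInc_bumpW {p : ℕ} (hp : 1 ≤ p) (q : ℕ) : ¬ HasInc (bumpW p q) (p + 2) := by
  intro h
  have e : bumpW p q = ([p + q + 2] ++ [p + q + 3] ++ (List.range' (p + 2) q).reverse) ++
    List.range' 1 (p + 1) := by simp [bumpW]
  rw [e] at h
  rcases h.append_or (by intro x hx y hy; simp at hx hy; omega) with h | h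
  · have h1 := HasInc.of_cons (x := p + q + 2) (m := p + 1) (by simpa using h)
    have h2 := h1.le_one (by
      rw [List.pairwise_cons]
      exact ⟨by simp; omega, pairwise_gt_range'_reverse⟩)
    omega
  · have := h.le_length
    simp at this

theorem not_ke_hookW_bumpW {p : ℕ} (hp : 1 ≤ p) (q : ℕ) : ¬ KE (hookW p q) (bumpW p q) :=
  fun h => not_hasInc_bumpW hp q ((h.hasInc _).1 (hasInc_hookW p q))

/-- Moves a letter through the increasing word `1 ⋯ m`. -/
theorem KE.range'_append_pair {m z : ℕ} (h : m + 1 < z) :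
    KE (List.range' 1 m ++ [z, m + 1]) (z :: List.range' 1 (m + 1)) := by
  have e : List.range' 1 (m + 1) = List.range' 1 m ++ [m + 1] := by
    rw [List.range'_1_concat]; congr 2; omega
  rw [e]
  refine KE.append_pair_ke_cons_append ?_ h
  rw [← e]
  exact List.pairwise_lt_range'

/-- Moves a letter through a decreasing word of consecutive letters. -/
theorem KE.cons_cons_range'_reverse {a q y z : ℕ} (hy : a + q ≤ y) (hyz : y < z) :
    KE (y :: z :: (List.range' a q).reverse) (y :: ((List.range' a q).reverse ++ [z])) := by
  refine KE.cons_cons_ke_cons_append ?_ hyz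
  rw [List.pairwise_cons]
  exact ⟨by simp; omega, pairwise_gt_range'_reverse⟩

/-- The first of the two words used to compare the class of a hook with a deletion closed one. -/
theorem ke_left_witness (p q : ℕ) :
    KE ((List.range' (p + 3) (q + 1)).reverse ++ (List.range' 1 (p + 1) ++ [p + q + 4, p + 2]))
      ((p + q + 3) :: (p + q + 4) :: ((List.range' (p + 3) q).reverse ++ List.range' 1 (p + 2))) := by
  refine ((KE.range'_append_pair (m := p + 1) (by omega)).append_left _).trans ?_
  have e : (List.range' (p + 3) (q + 1)).reverse =
      (p + q + 3) :: (List.range' (p + 3) q).reverse := by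
    rw [List.range'_1_concat, List.reverse_append]; simp; omega
  rw [e]
  have := (KE.cons_cons_range'_reverse (a := p + 3) (q := q) (y := p + q + 3) (z := p + q + 4)
    (by omega) (by omega)).symm.append_right (List.range' 1 (p + 2))
  simpa using this

theorem isWord_left_witness (p q : ℕ) : IsWord (p + q + 4) ((List.range' (p + 3) (q + 1)).reverse ++
    (List.range' 1 (p + 1) ++ [p + q + 4, p + 2])) := by
  refine IsWord.of_nodup ?_ fun x => ?_
  · simp [List.nodup_append, List.nodup_range']
    grind
  · simp; omega

theorem range'_succ_reverse (a q : ℕ) :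
    (List.range' a (q + 1)).reverse = (a + q) :: (List.range' a q).reverse := by
  rw [List.range'_1_concat, List.reverse_append]; rfl

theorem range'_succ_reverse' (a q : ℕ) :
    (List.range' a (q + 1)).reverse = (List.range' (a + 1) q).reverse ++ [a] := by
  rw [List.range'_succ, List.reverse_cons]

theorem range'_one_succ (m : ℕ) : List.range' 1 (m + 1) = List.range' 1 m ++ [m + 1] := by
  rw [List.range'_1_concat, Nat.add_comm]

/-- This representative exposes the two places where a larger letter can be moved, as needed in
`ke_right_witness`; it also identifies deletions from the second witness. -/
theorem bumpW_ke (r q : ℕ) : KE (bumpW (r + 1) q)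
    ((List.range' (r + 4) q).reverse ++
      (List.range' 1 r ++ [r + 3, r + 1, r + q + 4, r + 2])) := by
  have h1 := (KE.cons_cons_range'_reverse (a := r + 3) (q := q) (y := r + q + 3)
    (z := r + q + 4) (by omega) (by omega)).append_right (List.range' 1 (r + 2))
  have h2 := (KE.range'_append_pair (m := r + 1) (z := r + q + 4) (by omega)).symm.append_left
    ((r + q + 3) :: (List.range' (r + 3) q).reverse)
  have h3 := ((KE.range'_append_pair (m := r) (z := r + 3) (by omega)).symm.append_left
    (List.range' (r + 4) q).reverse).append_right [r + q + 4, r + 2]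
  have e1 : (r + q + 3) :: (List.range' (r + 3) q).reverse =
      (List.range' (r + 4) q).reverse ++ [r + 3] := by
    rw [← range'_succ_reverse', range'_succ_reverse]; congr 1; omega
  refine KE.trans ?_ ((h1.trans ?_).trans (h2.trans ?_) |>.trans h3 |>.trans ?_)
  · refine KE.of_eq ?_
    simp [bumpW]
    omega
  · exact KE.of_eq (by simp)
  · rw [e1]
    exact KE.of_eq (by simp)
  · exact KE.of_eq (by simp)

/-- The second of the two words used to compare the class of a hook with a deletion closed one. -/
theorem ke_right_witness (r q : ℕ) :
    KE (bumpW (r + 1) q ++ [r + q + 5])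
      ((List.range' (r + 4) q).reverse ++
      (List.range' 1 r ++ [r + 3, r + q + 4, r + 1, r + q + 5, r + 2])) := by
  have h1 := (bumpW_ke r q).append_right [r + q + 5]
  have h2 := KE.left ((List.range' (r + 4) q).reverse ++ (List.range' 1 r ++ [r + 3, r + 1])) []
    (x := r + 2) (y := r + q + 4) (z := r + q + 5) (by omega) (by omega)
  have h3 := KE.left ((List.range' (r + 4) q).reverse ++ List.range' 1 r) [r + q + 5, r + 2]
    (x := r + 1) (y := r + 3) (z := r + q + 4) (by omega) (by omega)
  simp only [List.append_assoc, List.cons_append, List.nil_append] at h1 h2 h3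
  exact h1.trans (h2.trans h3)

theorem KE.pair_succ_desc {w v : List ℕ} (h : KE w v) (hw : w.Nodup) (j : ℕ) :
    [j + 1, j].Sublist w ↔ [j + 1, j].Sublist v :=
  (h.pair_sublist hw (Nat.lt_succ_self j) (fun x _ => by omega)).2

/-- A class which together with a hook class is closed under deletions is determined by it. -/
theorem ke_bumpW_of_delClosed {p q : ℕ} (hp : 1 ≤ p) {v : List ℕ}
    (hG : DelClosed (p + q + 3) (hookW p q) v) : KE v (bumpW p q) := by
  obtain ⟨r, rfl⟩ : ∃ r, p = r + 1 := ⟨p - 1, by omega⟩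
  have hH := isWord_hookW (r + 1) q
  have hHn := hH.nodup
  -- the second pair of words
  have hw2 : IsWord (r + 1 + q + 3 + 1) (bumpW (r + 1) q ++ [r + q + 5]) := by
    have h1 := (isWord_bumpW (r + 1) q).append (List.Perm.refl [r + q + 5])
    rw [IsWord, List.range'_1_concat]
    convert h1 using 3
    omega
  have hd2 : del (r + q + 4) (bumpW (r + 1) q ++ [r + q + 5]) = hookW (r + 1) q := by
    rw [bumpW, hookW, List.cons_append, List.cons_append, del_cons_lt (by omega), del_cons,
      if_pos (by omega), List.append_assoc, del_append, del_append, del_reverse,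
      del_range'_ge (by omega), del_range'_ge (by omega), del_cons_gt (by omega), del_nil]
    congr 4; omega
  obtain ⟨c2, hc1, hc2, hc⟩ := hG _ _ _ hw2 (ke_right_witness r q) (by omega) (by omega)
    (KE.of_eq hd2)
  have hs2 := hw2.ke (ke_right_witness r q)
  have hs2c := (hs2.del hc1 hc2).nodup
  -- A deletion in the class of the hook must have its descent at p+q+1 = r+q+2. This leaves only
  -- the values of c2 in `hcases`, and those deletions turn out to lie in the class of `bumpW`.
  have hcv := hc.resolve_left fun h => by
    have h1 : [r + q + 2 + 1, r + q + 2].Sublist (hookW (r + 1) q) := by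
      simp [hookW, pair_sublist_cons]; omega
    have h2 := (h.pair_succ_desc hs2c _).2 h1
    rw [pair_sublist_del] at h2
    have hcases : c2 = r + q + 4 ∨ c2 = r + q + 5 ∨ (q = 0 ∧ c2 = r + 3) := by
      by_contra hcon
      unfold up at h2
      simp only [pair_sublist_append, pair_sublist_cons, pair_sublist_range',
        pair_sublist_range'_reverse, List.mem_append, List.mem_cons, List.mem_reverse,
        List.mem_range'_1, List.not_mem_nil, or_false, List.sublist_nil, reduceCtorEq, and_false, false_or] at h2
      split_ifs at h2 <;> omega
    refine not_ke_hookW_bumpW hp q (h.symm.trans (KE.trans ?_ (bumpW_ke r q).symm))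
    rcases hcases with rfl | rfl | ⟨rfl, rfl⟩
    · refine KE.of_eq ?_
      rw [del_append, del_append, del_reverse, del_range'_ge (by omega), del_range'_ge (by omega)]
      simp (disch := omega) [del_cons_lt, del_cons_self, del_cons_gt]
    · refine KE.trans (KE.of_eq ?_) (KE.left ((List.range' (r + 4) q).reverse ++ List.range' 1 r)
        [r + 2] (x := r + 1) (y := r + 3) (z := r + q + 4) (by omega) (by omega)).symm |>.trans
        (KE.of_eq ?_)
      · rw [del_append, del_append, del_reverse, del_range'_ge (by omega),
          del_range'_ge (by omega)]
        simp (disch := omega) [del_cons_lt, del_cons_self]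
      · simp
    · refine KE.of_eq ?_
      rw [del_append, del_append, del_range'_ge (by omega)]
      simp (disch := omega) [del_cons_lt, del_cons_gt, del_cons_self]
  -- The second witness, for any c2, gives two facts about v: no descent at p+q+2 and, if q ≥ 1, no
  -- ascent at p+1.
  have hv1 : ¬ [r + q + 3 + 1, r + q + 3].Sublist v := by
    intro h
    have h2 := (hcv.pair_succ_desc hs2c _).2 h
    rw [pair_sublist_del] at h2
    unfold up at h2
    simp only [pair_sublist_append, pair_sublist_cons, pair_sublist_range',
        pair_sublist_range'_reverse, List.mem_append, List.mem_cons, List.mem_reverse,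
        List.mem_range'_1, List.not_mem_nil, or_false, List.sublist_nil, reduceCtorEq, and_false, false_or] at h2
    split_ifs at h2 <;> omega
  have hv2 : 1 ≤ q → ¬ [r + 2, r + 2 + 1].Sublist v := by
    intro hq h
    have h2 := (hcv.pair_succ hs2c _).2 h
    rw [pair_sublist_del] at h2
    unfold up at h2
    simp only [pair_sublist_append, pair_sublist_cons, pair_sublist_range',
        pair_sublist_range'_reverse, List.mem_append, List.mem_cons, List.mem_reverse,
        List.mem_range'_1, List.not_mem_nil, or_false, List.sublist_nil, reduceCtorEq, and_false, false_or] at h2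
    split_ifs at h2 <;> omega
  -- the first pair of words
  have hw1 := ke_left_witness (r + 1) q
  have hwl := isWord_left_witness (r + 1) q
  have hd1 : del (r + 1 + 2) ((List.range' (r + 1 + 3) (q + 1)).reverse ++
      (List.range' 1 (r + 1 + 1) ++ [r + 1 + q + 4, r + 1 + 2])) = hookW (r + 1) q := by
    rw [del_append, del_append, del_reverse, del_range'_lt (by omega), del_range'_ge (by omega),
      range'_succ_reverse, hookW]
    simp (disch := omega) [del_cons_gt, del_cons_self]
    omega
  obtain ⟨c1, hc1', hc2', hc'⟩ := hG _ _ _ hwl hw1 (by omega) (by omega) (KE.of_eq hd1)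
  have hs1 := hwl.ke hw1
  have hs1c := (hs1.del hc1' hc2').nodup
  -- In the first witness, deleting any letter of the final run 1 ⋯ (p+2) gives `bumpW` itself.
  -- Deleting a larger letter creates a descent at p+q+2 or, if q ≥ 1, an ascent at p+1, and neither
  -- class has these.
  rcases le_or_gt c1 (r + 3) with hle | hgt
  · have e : del c1 ((r + 1 + q + 3) :: (r + 1 + q + 4) ::
        ((List.range' (r + 1 + 3) q).reverse ++ List.range' 1 (r + 1 + 2))) = bumpW (r + 1) q := by
      rw [del_cons_gt (by omega), del_cons_gt (by omega), del_append, del_reverse,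
        del_range'_lt (by omega), del_range'_mem (by omega) (by omega), bumpW]
      rfl
    rw [e] at hc'
    exact (hc'.resolve_left fun h => not_ke_hookW_bumpW hp q h.symm).symm
  · exfalso
    have key : ∀ w, IsWord (r + 1 + q + 3) w → KE (del c1 ((r + 1 + q + 3) :: (r + 1 + q + 4) ::
        ((List.range' (r + 1 + 3) q).reverse ++ List.range' 1 (r + 1 + 2)))) w →
        [r + q + 3 + 1, r + q + 3].Sublist w ∨ (1 ≤ q ∧ [r + 2, r + 2 + 1].Sublist w) := by
      intro w hw h
      rw [← h.pair_succ_desc hs1c, ← h.pair_succ hs1c, pair_sublist_del, pair_sublist_del]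
      unfold up
      simp only [pair_sublist_append, pair_sublist_cons, pair_sublist_range',
        pair_sublist_range'_reverse, List.mem_append, List.mem_cons, List.mem_reverse,
        List.mem_range'_1]
      split_ifs <;> omega
    rcases hc' with h | h
    · have h1 := key _ hH h
      simp only [hookW, pair_sublist_append, pair_sublist_cons, pair_sublist_range',
        pair_sublist_range'_reverse, List.mem_append, List.mem_cons, List.mem_reverse,
        List.mem_range'_1, List.not_mem_nil, or_false, List.sublist_nil, reduceCtorEq, and_false, false_or] at h1
      omega
    · rcases key _ ((hs1.del hc1' hc2').ke h) h with h1 | ⟨h1, h2⟩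
      · exact hv1 h1
      · exact hv2 h1 h2

/-- This excludes descent intervals with at least two ascents before them and two after. The word
used is equivalent to one that begins with three large increasing letters and ends in 1 ⋯ (p+2).
Deleting a letter of the final run leaves no increasing subword of length p+2, because 3 < p+2.
Deleting another letter leaves an ascent at p+1. Both target classes have increasing subwords of
length p+2 and a descent at p+1. -/
theorem not_delClosed_bumpW {p q : ℕ} (hp : 2 ≤ p) :
    ¬ DelClosed (p + q + 4) (bumpW p q ++ [p + q + 4]) (hookW p q ++ [p + q + 4]) := by
  intro hG
  have hke : KE ((p + q + 3) :: (p + q + 4) :: ((List.range' (p + 3) q).reverse ++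
      (List.range' 1 (p + 1) ++ [p + q + 5, p + 2])))
      ((p + q + 3) :: (p + q + 4) :: (p + q + 5) :: ((List.range' (p + 3) q).reverse ++
        List.range' 1 (p + 2))) := by
    have h1 := (KE.range'_append_pair (m := p + 1) (z := p + q + 5) (by omega)).append_left
      ((p + q + 4) :: (List.range' (p + 3) q).reverse)
    have h2 := (KE.cons_cons_range'_reverse (a := p + 3) (q := q) (y := p + q + 4)
      (z := p + q + 5) (by omega) (by omega)).symm.append_right (List.range' 1 (p + 2))
    have h3 := (h1.trans (KE.trans (KE.of_eq (by simp)) h2)).cons (p + q + 3)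
    simpa using h3
  have hw : IsWord (p + q + 4 + 1) ((p + q + 3) :: (p + q + 4) ::
      ((List.range' (p + 3) q).reverse ++ (List.range' 1 (p + 1) ++ [p + q + 5, p + 2]))) := by
    clear hG hke
    refine IsWord.of_nodup ?_ fun x => ?_
    · simp [List.nodup_append, List.nodup_range']
      grind
    · simp; omega
  have hd : del (p + 2) ((p + q + 3) :: (p + q + 4) ::
      ((List.range' (p + 3) q).reverse ++ (List.range' 1 (p + 1) ++ [p + q + 5, p + 2]))) =
      bumpW p q ++ [p + q + 4] := by
    rw [del_cons_gt (by omega), del_cons_gt (by omega), del_append, del_append, del_reverse,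
      del_range'_lt (by omega), del_range'_ge (by omega), bumpW]
    simp (disch := omega) [del_cons_gt, del_cons_self]
  obtain ⟨c, hc1, hc2, hc⟩ := hG _ _ _ hw hke (by omega) (by omega) (KE.of_eq hd)
  have hn := ((hw.ke hke).del hc1 hc2).nodup
  rcases le_or_gt c (p + 2) with hle | hgt
  · have e : del c ((p + q + 3) :: (p + q + 4) :: (p + q + 5) ::
        ((List.range' (p + 3) q).reverse ++ List.range' 1 (p + 2))) =
        (p + q + 2) :: (p + q + 3) :: (p + q + 4) :: ((List.range' (p + 2) q).reverse ++
        List.range' 1 (p + 1)) := by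
      rw [del_cons_gt (by omega), del_cons_gt (by omega), del_cons_gt (by omega), del_append,
        del_reverse, del_range'_lt (by omega), del_range'_mem (by omega) (by omega)]
      rfl
    have hinc : HasInc (del c ((p + q + 3) :: (p + q + 4) :: (p + q + 5) ::
        ((List.range' (p + 3) q).reverse ++ List.range' 1 (p + 2)))) (p + 2) := by
      have h1 : (List.range' 1 (p + 1) ++ [p + q + 4]).Pairwise (· < ·) := by
        simp [List.pairwise_append, List.pairwise_lt_range']
        grind
      rcases hc with h | h
      · rw [h.hasInc]
        refine HasInc.of_sublist (u := List.range' 1 (p + 1) ++ [p + q + 4]) ?_ h1 (by simp)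
        refine List.Sublist.append ?_ (List.Sublist.refl _)
        exact ((List.sublist_append_right _ _).trans (List.sublist_cons_self _ _)).trans
          (List.sublist_cons_self _ _)
      · rw [h.hasInc]
        refine HasInc.of_sublist (u := List.range' 1 (p + 1) ++ [p + q + 4]) ?_ h1 (by simp)
        refine List.Sublist.append ?_ (List.Sublist.refl _)
        exact (List.sublist_append_left _ _).trans ((List.sublist_append_right _ _).trans
          (List.sublist_cons_self _ _))
    rw [e] at hinc
    have e' : (p + q + 2) :: (p + q + 3) :: (p + q + 4) :: ((List.range' (p + 2) q).reverse ++
        List.range' 1 (p + 1)) = ((p + q + 2) :: (p + q + 3) :: (p + q + 4) ::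
        (List.range' (p + 2) q).reverse) ++ List.range' 1 (p + 1) := by simp
    rw [e'] at hinc
    rcases hinc.append_or (by intro x hx y hy; simp at hx hy; omega) with h | h
    · have h2 := h.of_cons.of_cons.le_one (by
        rw [List.pairwise_cons]
        exact ⟨by simp; omega, pairwise_gt_range'_reverse⟩)
      omega
    · have := h.le_length
      simp at this
  · have h1 : [p + 1, p + 1 + 1].Sublist (del c ((p + q + 3) :: (p + q + 4) :: (p + q + 5) ::
        ((List.range' (p + 3) q).reverse ++ List.range' 1 (p + 2)))) := by
      rw [pair_sublist_del, up, if_pos (by omega), up, if_pos (by omega)]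
      simp only [pair_sublist_append, pair_sublist_cons, pair_sublist_range']
      omega
    rcases hc with h | h
    · rw [h.pair_succ hn] at h1
      simp only [bumpW, List.cons_append, pair_sublist_append, pair_sublist_cons,
        pair_sublist_range', pair_sublist_range'_reverse, List.mem_append, List.mem_cons,
        List.mem_reverse, List.mem_range'_1, List.not_mem_nil, or_false, List.sublist_nil,
        reduceCtorEq, and_false, false_or] at h1
      omega
    · rw [h.pair_succ hn] at h1
      simp only [hookW, List.cons_append, pair_sublist_append, pair_sublist_cons,
        pair_sublist_range', pair_sublist_range'_reverse, List.mem_append, List.mem_cons,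
        List.mem_reverse, List.mem_range'_1, List.not_mem_nil, or_false, List.sublist_nil,
        reduceCtorEq, and_false, false_or] at h1
      omega

/-! ### Truncation of words and hook classes -/

/-- The subword of letters at most `k`. -/
def trunc (w : List ℕ) (k : ℕ) : List ℕ := w.filter fun x => x ≤ k

theorem mem_trunc {w : List ℕ} {k x : ℕ} : x ∈ trunc w k ↔ x ∈ w ∧ x ≤ k := by simp [trunc]

theorem trunc_append (w v : List ℕ) (k : ℕ) : trunc (w ++ v) k = trunc w k ++ trunc v k := by
  simp [trunc]

theorem trunc_reverse (w : List ℕ) (k : ℕ) : trunc w.reverse k = (trunc w k).reverse := by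
  simp [trunc]

theorem trunc_trunc (w : List ℕ) {k l : ℕ} (h : l ≤ k) : trunc (trunc w k) l = trunc w l := by
  rw [trunc, trunc, trunc, List.filter_filter]
  refine List.filter_congr fun x _ => ?_
  simp; omega

theorem trunc_eq_self {w : List ℕ} {k : ℕ} (h : ∀ x ∈ w, x ≤ k) : trunc w k = w :=
  List.filter_eq_self.2 fun x hx => by simpa using h x hx

theorem trunc_eq_nil {w : List ℕ} {k : ℕ} (h : ∀ x ∈ w, k < x) : trunc w k = [] :=
  List.filter_eq_nil_iff.2 fun x hx => by simpa using h x hx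

theorem KE.trunc {w v : List ℕ} (h : KE w v) (k : ℕ) : KE (trunc w k) (trunc v k) :=
  h.filter fun x y z _ hyz _ hz => by simp at hz ⊢; omega

theorem nodup_trunc {w : List ℕ} (h : w.Nodup) (k : ℕ) : (trunc w k).Nodup := h.filter _

theorem IsWord.trunc {n k : ℕ} {w : List ℕ} (h : IsWord n w) (hk : k ≤ n) :
    IsWord k (trunc w k) := by
  refine IsWord.of_nodup (nodup_trunc h.nodup k) fun x => ?_
  rw [mem_trunc, h.mem_iff]; omega

theorem pair_sublist_trunc {w : List ℕ} {a b k : ℕ} :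
    [a, b].Sublist (trunc w k) ↔ [a, b].Sublist w ∧ a ≤ k ∧ b ≤ k := by
  rw [trunc, pair_sublist_filter]; simp

/-- In the class of the subword of letters at most `k`, the letter `k` may be first or last. -/
def Ext (w : List ℕ) (k : ℕ) : Prop :=
  ∃ u, KE (trunc w k) (u ++ [k]) ∨ KE (trunc w k) (k :: u)

theorem Ext.of_ke {w v : List ℕ} {k : ℕ} (h : KE w v) (hw : Ext w k) : Ext v k := by
  obtain ⟨u, hu⟩ := hw
  exact ⟨u, hu.imp (h.trunc k).symm.trans (h.trunc k).symm.trans⟩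

theorem Ext.reverse {w : List ℕ} {k : ℕ} (h : Ext w k) : Ext w.reverse k := by
  obtain ⟨u, hu | hu⟩ := h
  · exact ⟨u.reverse, .inr (by simpa [trunc_reverse] using hu.reverse)⟩
  · exact ⟨u.reverse, .inl (by simpa [trunc_reverse] using hu.reverse)⟩

theorem ext_reverse {w : List ℕ} {k : ℕ} : Ext w.reverse k ↔ Ext w k :=
  ⟨fun h => by simpa using h.reverse, Ext.reverse⟩

theorem ext_trunc {w : List ℕ} {k l : ℕ} (h : k ≤ l) : Ext (trunc w l) k ↔ Ext w k := by
  rw [Ext, Ext, trunc_trunc w h]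

theorem trunc_pred_of_perm {w u : List ℕ} (hw : w.Nodup) {k : ℕ} (hk : 1 ≤ k)
    (h : (trunc w k).Perm (k :: u)) : trunc u (k - 1) = u := by
  have hn := h.nodup_iff.1 (nodup_trunc hw k)
  rw [List.nodup_cons] at hn
  refine trunc_eq_self fun x hx => ?_
  have h1 := (mem_trunc.1 (h.mem_iff.2 (List.mem_cons_of_mem k hx))).2
  have : x ≠ k := by rintro rfl; exact hn.1 hx
  omega

theorem ke_trunc_of_append {w u : List ℕ} (hw : w.Nodup) {k : ℕ} (hk : 1 ≤ k)
    (h : KE (trunc w k) (u ++ [k])) : KE (trunc w (k - 1)) u := by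
  have h1 := h.trunc (k - 1)
  rw [trunc_trunc _ (by omega), trunc_append, trunc_pred_of_perm hw hk
    (h.perm.trans (List.perm_append_singleton k u)),
    trunc_eq_nil (w := [k]) (by simp; omega), List.append_nil] at h1
  exact h1

theorem ke_trunc_of_cons {w u : List ℕ} (hw : w.Nodup) {k : ℕ} (hk : 1 ≤ k)
    (h : KE (trunc w k) (k :: u)) : KE (trunc w (k - 1)) u := by
  have h1 := h.trunc (k - 1)
  rw [trunc_trunc _ (by omega), ← List.singleton_append, trunc_append,
    trunc_pred_of_perm hw hk h.perm,
    trunc_eq_nil (w := [k]) (by simp; omega), List.nil_append] at h1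
  exact h1

/-- Restriction to letters below k identifies the unknown rest u, up to equivalence, with the
truncation of w to k-1. -/
theorem Ext.eq_or {w : List ℕ} (hw : w.Nodup) {k : ℕ} (hk : 1 ≤ k) (h : Ext w k) :
    KE (trunc w k) (trunc w (k - 1) ++ [k]) ∨ KE (trunc w k) (k :: trunc w (k - 1)) := by
  obtain ⟨u, hu | hu⟩ := h
  · exact .inl (hu.trans ((ke_trunc_of_append hw hk hu).symm.append_right [k]))
  · exact .inr (hu.trans ((ke_trunc_of_cons hw hk hu).symm.cons k))

/-- A word which increases up to its largest letter and then decreases. -/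
theorem exists_ke_of_unimodal {a b : List ℕ} {k : ℕ} (ha : (a ++ [k]).Pairwise (· < ·))
    (hb : (k :: b).Pairwise (· > ·)) (hn : (a ++ k :: b).Nodup) :
    ∃ u, KE (a ++ k :: b) (u ++ [k]) ∨ KE (a ++ k :: b) (k :: u) := by
  rcases a.eq_nil_or_concat' with rfl | ⟨a, x, rfl⟩
  · exact ⟨b, .inr (KE.refl _)⟩
  rcases b with - | ⟨y, b⟩
  · exact ⟨a ++ [x], .inl (KE.of_eq (by simp))⟩
  have hx : x < k := by simp [List.pairwise_append] at ha; omega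
  have hy : y < k := by simp at hb; omega
  -- The neighbours x and y of the peak decide. If x < y, the letters up to y, with k left out,
  -- increase and k moves to the front; if y < x, the letters from x on, with k left out, decrease
  -- and k moves to the end.
  rcases lt_trichotomy x y with h | rfl | h
  · refine ⟨(a ++ [x] ++ [y]) ++ b, .inr ?_⟩
    have h1 := (KE.append_pair_ke_cons_append (a := a ++ [x]) (y := y) (z := k) ?_ hy).append_right b
    · simpa using h1
    · have ha' := (List.pairwise_append.1 ha).1
      rw [List.pairwise_append]
      refine ⟨ha', by simp, fun z hz => ?_⟩
      rw [List.pairwise_append] at ha'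
      simp only [List.mem_append, List.mem_singleton] at hz
      rcases hz with hz | rfl
      · have := ha'.2.2 z hz x (by simp)
        simp; omega
      · simpa using h
  · simp [List.nodup_append] at hn
  · refine ⟨a ++ x :: y :: b, .inl ?_⟩
    have h1 := (KE.cons_cons_ke_cons_append (y := x) (z := k) (d := y :: b) ?_ hx).append_left a
    · simpa using h1
    · have hb' := (List.pairwise_cons.1 hb).2
      rw [List.pairwise_cons]
      refine ⟨fun z hz => ?_, hb'⟩
      rw [List.pairwise_cons] at hb'
      rcases List.mem_cons.1 hz with rfl | hz
      · exact h
      · have := hb'.1 z hz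
        omega

/-- Words that increase and then decrease also represent hook classes: truncation to k keeps this
form and makes k the peak. -/
theorem ext_of_mem_unimodal {w a b : List ℕ} (hw : w.Nodup) (ha : a.Pairwise (· < ·))
    (hb : b.Pairwise (· > ·)) (h : KE w (a ++ b)) {k : ℕ} (hk : k ∈ w) : Ext w k := by
  have hke := h.trunc k
  have hn := (hke.perm.nodup_iff).1 (nodup_trunc hw k)
  rw [trunc_append] at hke hn
  have hle : ∀ x, x ∈ trunc a k ∨ x ∈ trunc b k → x ≤ k := by
    simp only [mem_trunc]; tauto
  have hmem : k ∈ trunc a k ∨ k ∈ trunc b k := by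
    rw [← List.mem_append, ← hke.perm.mem_iff, mem_trunc]
    exact ⟨hk, le_rfl⟩
  have ha' : (trunc a k).Pairwise (· < ·) := ha.filter _
  have hb' : (trunc b k).Pairwise (· > ·) := hb.filter _
  generalize trunc a k = A at *
  generalize trunc b k = B at *
  have key : ∀ A B : List ℕ, (A ++ [k]).Pairwise (· < ·) → (k :: B).Pairwise (· > ·) →
      KE (trunc w k) (A ++ k :: B) → Ext w k := by
    intro A B hA hB hAB
    obtain ⟨u, hu⟩ := exists_ke_of_unimodal hA hB ((hAB.perm.nodup_iff).1 (nodup_trunc hw k))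
    exact ⟨u, hu.imp hAB.trans hAB.trans⟩
  rw [List.nodup_append] at hn
  rcases hmem with hmem | hmem
  · obtain ⟨s, t, rfl⟩ := List.append_of_mem hmem
    rcases t with - | ⟨y, t⟩
    · refine key s B ha' ?_ (by simpa using hke)
      rw [List.pairwise_cons]
      refine ⟨fun x hx => ?_, hb'⟩
      have := hle x (.inr hx)
      have := hn.2.2 k (by simp) x hx
      omega
    · have h1 := hle y (.inl (by simp))
      simp [List.pairwise_append] at ha'
      omega
  · obtain ⟨s, t, rfl⟩ := List.append_of_mem hmem
    rcases s with - | ⟨y, s⟩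
    · refine key A t ?_ hb' (by simpa using hke)
      rw [List.pairwise_append]
      refine ⟨ha', by simp, fun x hx z hz => ?_⟩
      rw [List.mem_singleton] at hz
      subst hz
      have := hle x (.inl hx)
      have := hn.2.2 x hx z (by simp)
      omega
    · have h1 := hle y (.inr (by simp))
      rw [List.cons_append, List.pairwise_cons] at hb'
      have := hb'.1 k (by simp)
      omega

/-- Words all of whose truncations are extensions are equivalent to `V`-shaped words. -/
theorem exists_ke_vshape {w : List ℕ} (hw : w.Nodup) (h0 : 0 ∉ w) (h : ∀ k ∈ w, Ext w k) :
    ∃ d a : List ℕ, d.Pairwise (· > ·) ∧ a.Pairwise (· < ·) ∧ KE w (d ++ a) := by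
  have key : ∀ k, ∃ d a : List ℕ, d.Pairwise (· > ·) ∧ a.Pairwise (· < ·) ∧
      KE (trunc w k) (d ++ a) := by
    intro k
    induction k with
    | zero =>
      refine ⟨[], [], by simp, by simp, KE.of_eq ?_⟩
      exact trunc_eq_nil fun x hx => Nat.pos_of_ne_zero fun h => h0 (h ▸ hx)
    | succ k ih =>
      obtain ⟨d, a, hd, ha, hda⟩ := ih
      by_cases hk : k + 1 ∈ w
      · have hlt : ∀ x, x ∈ d ∨ x ∈ a → x < k + 1 := by
          intro x hx
          rw [← List.mem_append, ← hda.perm.mem_iff, mem_trunc] at hx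
          omega
        rcases (h _ hk).eq_or hw (by omega) with h1 | h1
        · refine ⟨d, a ++ [k + 1], hd, ?_, h1.trans ?_⟩
          · rw [List.pairwise_append]
            exact ⟨ha, by simp, fun x hx y hy => by
              rw [List.mem_singleton] at hy; have := hlt x (.inr hx); omega⟩
          · simpa using hda.append_right [k + 1]
        · refine ⟨(k + 1) :: d, a, ?_, ha, h1.trans (hda.cons _)⟩
          rw [List.pairwise_cons]
          exact ⟨fun x hx => hlt x (.inl hx), hd⟩
      · refine ⟨d, a, hd, ha, ?_⟩
        have e : trunc w (k + 1) = trunc w k := by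
          refine List.filter_congr fun x hx => ?_
          have : x ≠ k + 1 := by rintro rfl; exact hk hx
          simp; omega
        rwa [e]
  obtain ⟨d, a, hd, ha, hda⟩ := key (w.foldr max 0)
  refine ⟨d, a, hd, ha, ?_⟩
  rwa [trunc_eq_self] at hda
  intro x hx
  exact List.le_max_of_le hx le_rfl

/-! ### Hook classes and their descent sets -/

/-- The `V`-shaped word of `1, …, n` with inverse descent set `J`. -/
noncomputable def vWord (J : Set ℕ) : ℕ → List ℕ
  | 0 => []
  | k + 1 => open Classical in if k ∈ J then (k + 1) :: vWord J k else vWord J k ++ [k + 1]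

/-- A hook class is determined by its descent set: k+1 can be brought to the front or to the end,
and the order of k and k+1, an invariant, tells which. -/
theorem ke_vWord {n : ℕ} {w : List ℕ} (hw : IsWord n w) (h : ∀ k, 1 ≤ k → k ≤ n → Ext w k) :
    ∀ k ≤ n, KE (trunc w k) (vWord (desWord w) k) := by
  intro k
  induction k with
  | zero =>
    intro _
    exact KE.of_eq (trunc_eq_nil fun x hx => (hw.mem_iff.1 hx).1)
  | succ k ih =>
    intro hk
    have ih := ih (by omega)
    rw [vWord]
    -- Whether 0 belongs to the set does not matter: both branches of `vWord` give the word 1.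
    rcases k.eq_zero_or_pos with rfl | hk0
    · have e : trunc w 1 = [1] := by
        have := (hw.trunc hk)
        simpa [IsWord] using this
      rw [e]
      split_ifs <;> exact KE.refl _
    have hn := nodup_trunc hw.nodup (k + 1)
    have hmem : k ∈ trunc w k := mem_trunc.2 ⟨hw.mem_iff.2 (by omega), le_rfl⟩
    rcases (h (k + 1) (by omega) hk).eq_or hw.nodup (by omega) with h1 | h1
    · have h2 : [k, k + 1].Sublist w := by
        have h3 : [k, k + 1].Sublist (trunc w k ++ [k + 1]) :=
          pair_sublist_append.2 (.inr (.inr ⟨hmem, by simp⟩))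
        exact (pair_sublist_trunc.1 ((h1.pair_succ hn k).2 h3)).1
      rw [if_neg (show k ∉ desWord w from fun h3 => pair_sublist_asymm hw.nodup h2 h3)]
      exact h1.trans (ih.append_right _)
    · have h2 : [k + 1, k].Sublist w := by
        have h3 : [k + 1, k].Sublist ((k + 1) :: trunc w k) :=
          pair_sublist_cons.2 (.inr ⟨rfl, hmem⟩)
        exact (pair_sublist_trunc.1 ((h1.pair_succ_desc hn k).2 h3)).1
      rw [if_pos (show k ∈ desWord w from h2)]
      exact h1.trans (ih.cons _)

/-- There is no change of direction followed by a change back below `k`. -/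
def NoPattern (J : Set ℕ) (k : ℕ) : Prop :=
  ∀ i j m, 1 ≤ i → i < j → j < m → m < k → (i ∈ J ↔ m ∈ J) → (i ∈ J ↔ j ∈ J)

theorem desWord_reverse {n : ℕ} {w : List ℕ} (hw : IsWord n w) {i : ℕ} (h1 : 1 ≤ i) (h2 : i < n) :
    i ∈ desWord w.reverse ↔ i ∉ desWord w := by
  simp only [desWord, Set.mem_ofPred_eq, pair_sublist_reverse]
  exact (not_pair_sublist_iff hw.nodup (hw.mem_iff.2 (by omega)) (hw.mem_iff.2 (by omega))
    (by omega)).symm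

theorem IsWord.reverse {n : ℕ} {w : List ℕ} (hw : IsWord n w) : IsWord n w.reverse :=
  (List.reverse_perm w).trans hw

theorem NoPattern.congr {J L : Set ℕ} {k : ℕ} (h : NoPattern J k)
    (hJL : ∀ i, 1 ≤ i → i < k → (i ∈ L ↔ i ∉ J)) : NoPattern L k := by
  intro i j m h1 h2 h3 h4 h5
  have := h i j m h1 h2 h3 h4
  rw [hJL i (by omega) (by omega), hJL j (by omega) (by omega)]
  rw [hJL i (by omega) (by omega), hJL m (by omega) (by omega)] at h5
  tauto

/-- Here k-1 precedes k. Every letter y behind k turns out to be smaller than all letters before it;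
hence the letters behind k decrease, the left neighbour of k exceeds them, and k moves to the end.
If x < y stood before y, then, as k-1 precedes y, there would be a descent i with y ≤ i < k-1.
Because k-1 is an ascent, everything below i would be a descent too, so y would precede x. -/
theorem ext_of_noPattern_of_notMem {n : ℕ} {w : List ℕ} (hw : IsWord n w) {k : ℕ} (h1 : 2 ≤ k)
    (h2 : k ≤ n) (hJ : NoPattern (desWord w) k) (hk : k - 1 ∉ desWord w) : Ext w k := by
  have hmemk : k ∈ trunc w k := mem_trunc.2 ⟨hw.mem_iff.2 (by omega), le_rfl⟩
  have hn := nodup_trunc hw.nodup k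
  have hT := hw.trunc h2
  obtain ⟨a, b, hab⟩ := List.append_of_mem hmemk
  have hord : ∀ x y, [x, y].Sublist (trunc w k) → [x, y].Sublist w := fun x y h =>
    (pair_sublist_trunc.1 h).1
  have hka : k - 1 ∈ a := by
    have h3 : [k - 1, k - 1 + 1].Sublist w :=
      (not_pair_sublist_iff hw.nodup (hw.mem_iff.2 (by omega)) (hw.mem_iff.2 (by omega))
        (by omega)).1 hk
    rw [Nat.sub_add_cancel (by omega)] at h3
    have h4 : [k - 1, k].Sublist (a ++ [k] ++ b) := by
      have := pair_sublist_trunc.2 ⟨h3, by omega, le_refl k⟩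
      rw [hab] at this
      simpa using this
    have h5 := mem_left_of_pair_sublist h4 (by simp) (by rw [hab] at hn; simpa using hn)
    simp only [List.mem_append, List.mem_singleton] at h5
    exact h5.resolve_right (by omega)
  -- letters to the right of `k` are smaller than everything before them
  have key : ∀ y ∈ b, ∀ x, [x, y].Sublist (trunc w k) → y < x := by
    intro y hy x hxy
    by_contra hc
    have hxw := hT.mem_iff.1 (pair_sublist_mem hxy).1
    have hyw := hT.mem_iff.1 (pair_sublist_mem hxy).2
    have hne : x ≠ y := by
      have := hn.sublist hxy
      simpa using this
    have hky : [k - 1, y].Sublist (trunc w k) := by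
      rw [hab]
      exact pair_sublist_append.2 (.inr (.inr ⟨hka, by simp [hy]⟩))
    have hy1 : y ≠ k - 1 := by
      have := hn.sublist hky
      simp at this; omega
    have hy2 : y ≠ k := by
      rintro rfl
      rw [hab] at hn
      simp [List.nodup_append] at hn
      exact hn.2.1.1 hy
    obtain ⟨i, hi1, hi2, hi⟩ : ∃ i, y ≤ i ∧ i < k - 1 ∧ i ∈ desWord w := by
      by_contra hcon
      push Not at hcon
      refine pair_sublist_asymm hw.nodup (hord _ _ hky)
        (pair_sublist_chain hw.nodup (by omega) fun j hj1 hj2 => ?_)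
      exact (not_pair_sublist_iff hw.nodup (hw.mem_iff.2 (by omega)) (hw.mem_iff.2 (by omega))
        (by omega)).1 (hcon j hj1 hj2)
    refine pair_sublist_asymm hw.nodup (hord _ _ hxy)
      (pair_sublist_chain_desc hw.nodup (by omega) fun j hj1 hj2 => ?_)
    by_contra hj
    have h3 := hJ j i (k - 1) (by omega) (by omega) hi2 (by omega)
    have hj' : j ∉ desWord w := hj
    tauto
  rw [hab] at key
  have hb : b.Pairwise (· > ·) := by
    rw [List.pairwise_iff_forall_sublist]
    intro x y hxy
    refine key y (pair_sublist_mem hxy).2 x ?_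
    exact hxy.trans ((List.sublist_cons_self _ _).trans (List.sublist_append_right _ _))
  rcases a.eq_nil_or_concat' with rfl | ⟨a, x, rfl⟩
  · simp at hka
  refine ⟨a ++ x :: b, .inl ?_⟩
  rw [hab]
  have hx : x < k := by
    have h3 : x ∈ trunc w k := by rw [hab]; simp
    have h4 := (mem_trunc.1 h3).2
    rw [hab] at hn
    simp [List.nodup_append] at hn
    omega
  have h3 := (KE.cons_cons_ke_cons_append (y := x) (z := k) (d := b) ?_ hx).append_left a
  · simpa using h3
  · rw [List.pairwise_cons]
    exact ⟨fun y hy => key y hy x (pair_sublist_append.2 (.inr (.inr ⟨by simp, by simp [hy]⟩))),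
      hb⟩

theorem ext_of_noPattern {n : ℕ} {w : List ℕ} (hw : IsWord n w) {k : ℕ} (h1 : 1 ≤ k)
    (h2 : k ≤ n) (hJ : NoPattern (desWord w) k) : Ext w k := by
  rcases h1.eq_or_lt with rfl | h1
  · have : trunc w 1 = [1] := by simpa [IsWord] using hw.trunc h2
    exact ⟨[], .inl (KE.of_eq this)⟩
  by_cases hk : k - 1 ∈ desWord w
  · refine ext_reverse.1 (ext_of_noPattern_of_notMem hw.reverse h1 h2 ?_ ?_)
    · exact hJ.congr fun i hi1 hi2 => desWord_reverse hw hi1 (by omega)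
    · rw [desWord_reverse hw (by omega) (by omega)]
      exact not_not_intro hk
  · exact ext_of_noPattern_of_notMem hw h1 h2 hJ hk

/-! ### Symmetries and restriction of deletion closed pairs -/

theorem DelClosed.reverse {n : ℕ} {w v : List ℕ} (h : DelClosed n w v) :
    DelClosed n w.reverse v.reverse := by
  intro σ σ' c hσ hσσ' h1 h2 hc
  have hc' : KE (PatternKnuth.del c σ.reverse) w := by
    rw [del_reverse]
    simpa using hc.reverse
  obtain ⟨c', h3, h4, h5⟩ := h σ.reverse σ'.reverse c hσ.reverse hσσ'.reverse h1 h2 hc'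
  refine ⟨c', h3, h4, ?_⟩
  rw [del_reverse] at h5
  exact h5.imp (fun h => by simpa using h.reverse) fun h => by simpa using h.reverse

/-- The reverse complement of a word of `1, …, n`. -/
def revComp (n : ℕ) (w : List ℕ) : List ℕ := (w.map (n + 1 - ·)).reverse

theorem revComp_append (n : ℕ) (w v : List ℕ) :
    revComp n (w ++ v) = revComp n v ++ revComp n w := by simp [revComp]

theorem revComp_revComp {n : ℕ} {w : List ℕ} (h : ∀ x ∈ w, x ≤ n + 1) :
    revComp n (revComp n w) = w := by
  simp only [revComp, List.map_reverse, List.reverse_reverse, List.map_map]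
  refine (List.map_congr_left fun x hx => ?_).trans (List.map_id w)
  have := h x hx
  simp; omega

theorem KE.revComp {n : ℕ} {w v : List ℕ} (h : KE w v) (hw : ∀ x ∈ w, x ≤ n + 1) :
    KE (revComp n w) (revComp n v) := by
  refine KE.reverse (KE.map_of_strictAntiOn (s := {x | x ≤ n + 1}) ?_ h hw)
  intro x hx y hy hxy
  simp only [Set.mem_ofPred_eq] at hx hy
  show n + 1 - y < n + 1 - x
  omega

theorem mem_revComp {n x : ℕ} {w : List ℕ} (h : ∀ x ∈ w, x ≤ n + 1) :
    x ∈ revComp n w ↔ x ≤ n + 1 ∧ n + 1 - x ∈ w := by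
  simp only [revComp, List.mem_reverse, List.mem_map]
  constructor
  · rintro ⟨y, hy, rfl⟩
    have := h y hy
    rw [show n + 1 - (n + 1 - y) = y by omega]
    exact ⟨by omega, hy⟩
  · rintro ⟨h1, h2⟩
    exact ⟨_, h2, by omega⟩

theorem IsWord.revComp {n : ℕ} {w : List ℕ} (h : IsWord n w) : IsWord n (revComp n w) := by
  have hle : ∀ x ∈ w, x ≤ n + 1 := fun x hx => by have := h.mem_iff.1 hx; omega
  refine IsWord.of_nodup ?_ fun x => ?_
  · rw [PatternKnuth.revComp, List.nodup_reverse]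
    refine h.nodup.map_on fun x hx y hy hxy => ?_
    have := hle x hx
    have := hle y hy
    omega
  · rw [mem_revComp hle, h.mem_iff]; omega

theorem del_revComp {n c : ℕ} {s : List ℕ} (hs : ∀ x ∈ s, 1 ≤ x ∧ x ≤ n + 1)
    (h2 : c ≤ n + 1) : del (n + 2 - c) (revComp (n + 1) s) = revComp n (del c s) := by
  rw [revComp, revComp, del_reverse]
  congr 1
  induction s with
  | nil => rfl
  | cons x s ih =>
    have hx := hs x (by simp)
    have ih := ih fun y hy => hs y (by simp [hy])
    rw [List.map_cons, del_cons, del_cons, ih]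
    by_cases hxc : x = c
    · rw [if_pos hxc, if_pos (by omega)]
    · rw [if_neg hxc, if_neg (by omega), List.map_cons]
      congr 1
      unfold dn; split_ifs <;> omega

theorem DelClosed.revComp {n : ℕ} {w v : List ℕ} (h : DelClosed n w v) (hw : IsWord n w) :
    DelClosed n (revComp n w) (revComp n v) := by
  intro σ σ' c hσ hσσ' h1 h2 hc
  have hle : ∀ {m s}, IsWord m s → ∀ x ∈ s, x ≤ m + 1 := fun hs x hx => by
    have := hs.mem_iff.1 hx; omega
  have hb : ∀ {s}, IsWord (n + 1) s → ∀ x ∈ s, 1 ≤ x ∧ x ≤ n + 1 := fun hs x hx =>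
    hs.mem_iff.1 hx
  have hσ' := hσ.ke hσσ'
  have hc' : KE (PatternKnuth.del (n + 2 - c) (PatternKnuth.revComp (n + 1) σ)) w := by
    rw [del_revComp (hb hσ) h2]
    have := hc.revComp (hle (hσ.del h1 h2))
    rwa [revComp_revComp (hle hw)] at this
  obtain ⟨c', h3, h4, h5⟩ := h _ _ _ hσ.revComp (hσσ'.revComp (hle hσ)) (by omega) (by omega) hc'
  refine ⟨n + 2 - c', by omega, by omega, ?_⟩
  have e : PatternKnuth.del (n + 2 - c') σ' =
      PatternKnuth.revComp n (PatternKnuth.del c' (PatternKnuth.revComp (n + 1) σ')) := by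
    rw [← del_revComp (hb hσ'.revComp) h4, revComp_revComp (hle hσ')]
  rw [e]
  have hw' := hσ'.revComp.del h3 h4
  exact h5.imp (fun h => h.revComp (hle hw')) fun h => h.revComp (hle hw')

theorem desWord_subset {n : ℕ} {w : List ℕ} (hw : IsWord n w) {i : ℕ} (hi : i ∈ desWord w) :
    1 ≤ i ∧ i < n := by
  have h := pair_sublist_mem (a := i + 1) (b := i) hi
  rw [hw.mem_iff, hw.mem_iff] at h
  omega

theorem desWord_revComp {n : ℕ} {w : List ℕ} (hw : IsWord n w) {i : ℕ} (h1 : 1 ≤ i) (h2 : i < n) :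
    i ∈ desWord (revComp n w) ↔ n - i ∈ desWord w := by
  simp only [desWord, Set.mem_ofPred_eq, revComp, pair_sublist_reverse]
  rw [show i = n + 1 - (n - i + 1) by omega, show n + 1 - (n - i + 1) + 1 = n + 1 - (n - i) by omega,
    pair_sublist_map (s := {x | x ≤ n}) (f := fun x => n + 1 - x)]
  · rw [show n - (n + 1 - (n - i + 1)) = n - i by omega]
  · intro x hx y hy hxy
    simp only [Set.mem_ofPred_eq] at hx hy hxy
    omega
  · intro x hx
    exact (hw.mem_iff.1 hx).2
  · simp; omega
  · simp

theorem del_eq_trunc {n : ℕ} {s : List ℕ} (hs : ∀ x ∈ s, x ≤ n + 1) :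
    del (n + 1) s = trunc s n := by
  rw [del, trunc]
  have e : s.filter (fun x => x ≠ n + 1) = s.filter fun x => x ≤ n :=
    List.filter_congr fun x hx => by
      have := hs x hx
      rw [decide_eq_decide]; omega
  rw [e]
  refine (List.map_congr_left fun x hx => ?_).trans (List.map_id _)
  have hx := (List.mem_filter.1 hx).2
  simp only [decide_eq_true_eq] at hx
  rw [dn, if_pos (by omega), id]

/-- A new largest letter n+2 is appended to both words of length n+1; deletions of smaller letters
ignore it. If closure answers by deleting n+2 itself, truncation to n shows that n+1 can be deleted
from the original word instead. -/
theorem DelClosed.trunc_of_append {n : ℕ} {w v : List ℕ} (h : DelClosed (n + 1) w v)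
    (hw' : KE w (trunc w n ++ [n + 1])) :
    DelClosed n (trunc w n) (trunc v n) := by
  intro σ σ' c hσ hσσ' h1 h2 hc
  have hσ' := hσ.ke hσσ'
  have hd : ∀ c s, c ≤ n + 1 → PatternKnuth.del c (s ++ [n + 2]) = PatternKnuth.del c s ++ [n + 1] := by
    intro c s hc
    rw [del_append, del_cons_gt (by omega)]; rfl
  have hword : IsWord (n + 1 + 1) (σ ++ [n + 2]) := by
    rw [IsWord, List.range'_1_concat]
    convert hσ.append (List.Perm.refl [n + 2]) using 3
    omega
  obtain ⟨c', h3, h4, h5⟩ := h (σ ++ [n + 2]) (σ' ++ [n + 2]) c hword (hσσ'.append_right _) h1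
    (by omega) (by rw [hd c σ h2]; exact (hc.append_right _).trans hw'.symm)
  rcases Nat.lt_or_ge (n + 1) c' with h6 | h6
  · obtain rfl : c' = n + 1 + 1 := by omega
    have e : PatternKnuth.del (n + 2) (σ' ++ [n + 2]) = σ' := by
      rw [del_append, del_cons_self, del_nil, List.append_nil, del_of_lt]
      intro x hx; have := hσ'.mem_iff.1 hx; omega
    rw [e] at h5
    have e2 : PatternKnuth.del (n + 1) σ' = PatternKnuth.trunc σ' n :=
      del_eq_trunc fun x hx => (hσ'.mem_iff.1 hx).2
    exact ⟨n + 1, by omega, le_rfl, by rw [e2]; exact h5.imp (fun h => h.trunc n) fun h => h.trunc n⟩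
  · refine ⟨c', h3, h6, ?_⟩
    rw [hd c' σ' h6] at h5
    have e : PatternKnuth.trunc (PatternKnuth.del c' σ' ++ [n + 1]) n = PatternKnuth.del c' σ' := by
      rw [trunc_append, trunc_eq_nil (w := [n + 1]) (by simp), List.append_nil, trunc_eq_self]
      exact fun x hx => ((hσ'.del h3 h6).mem_iff.1 hx).2
    have := h5.imp (fun h => h.trunc n) fun h => h.trunc n
    rwa [e] at this

theorem DelClosed.trunc_of_ext {n : ℕ} {w v : List ℕ} (h : DelClosed (n + 1) w v)
    (hw : IsWord (n + 1) w) (hE : Ext w (n + 1)) : DelClosed n (trunc w n) (trunc v n) := by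
  have e : PatternKnuth.trunc w (n + 1) = w := trunc_eq_self fun x hx => (hw.mem_iff.1 hx).2
  rcases hE.eq_or hw.nodup (by omega) with h1 | h1
  · rw [e] at h1
    exact h.trunc_of_append h1
  · rw [e] at h1
    have := h.reverse.trunc_of_append (by simpa [trunc_reverse] using h1.reverse)
    have := this.reverse
    simpa [trunc_reverse] using this

theorem DelClosed.trunc {n m : ℕ} {w v : List ℕ} (h : DelClosed n w v) (hw : IsWord n w)
    (hv : IsWord n v) (hm : m ≤ n) (hE : ∀ k, m < k → k ≤ n → Ext w k) :
    DelClosed m (trunc w m) (trunc v m) := by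
  induction n, hm using Nat.le_induction generalizing w v with
  | base =>
    rwa [trunc_eq_self fun x hx => (hw.mem_iff.1 hx).2, trunc_eq_self fun x hx => (hv.mem_iff.1 hx).2]
  | succ n hn ih =>
    have := ih (h.trunc_of_ext hw (hE _ (by omega) le_rfl)) (hw.trunc (by omega))
      (hv.trunc (by omega)) fun k h1 h2 => (ext_trunc h2).2 (hE k h1 (by omega))
    rwa [trunc_trunc _ hn, trunc_trunc _ hn] at this

/-! ### Classes that are not hooks -/

/-- The classes contain α n u γ and α u n γ. They agree without n and both have an ascent at n-1,
but in the class of v the letter n reaches further right than in that of w. This last comparison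
cannot hold in both directions. -/
theorem not_ext_of_delClosed_of_asc {n : ℕ} {w v : List ℕ} (hw : IsWord n w) (hv : IsWord n v)
    (hG : DelClosed n w v) (hE : ¬ Ext w n) (hasc : [n - 1, n].Sublist w) :
    KE (trunc w (n - 1)) (trunc v (n - 1)) ∧ (n - 1 ∈ desWord w ↔ n - 1 ∈ desWord v) ∧ ¬ KE w v ∧ (¬ Ext v n → ¬ DelClosed n v w) := by
  have ew : trunc w n = w := trunc_eq_self fun x hx => (hw.mem_iff.1 hx).2
  have ev : trunc v n = v := trunc_eq_self fun x hx => (hv.mem_iff.1 hx).2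
  have hne : ∀ a, ¬ KE w (a ++ [n]) := fun a h => hE ⟨a, .inl (by rwa [ew])⟩
  obtain ⟨α, u, γ, h1, h2, h3, h4⟩ := exists_swap_of_delClosed hw hasc hne hG
  have hn : 1 ≤ n := (hw.mem_iff.1 (pair_sublist_mem hasc).2).1
  have hasc' : [n - 1, n].Sublist v := by
    have h5 : [n - 1, n - 1 + 1].Sublist (α ++ u :: n :: γ) := by
      rw [Nat.sub_add_cancel hn]
      exact pair_sublist_append.2 (.inr (.inr ⟨h4, by simp⟩))
    have h6 := (h2.pair_succ hv.nodup _).2 h5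
    rwa [Nat.sub_add_cancel hn] at h6
  refine ⟨?_, ?_, fun h => ?_, fun hE' hG' => ?_⟩
  · have h5 := h1.trunc (n - 1)
    have h6 := h2.trunc (n - 1)
    have hc : ∀ l, trunc (n :: l) (n - 1) = trunc l (n - 1) := fun l => by
      rw [trunc, List.filter_cons_of_neg (by simp; omega)]; rfl
    have h7 : trunc (α ++ n :: u :: γ) (n - 1) = trunc (α ++ u :: n :: γ) (n - 1) := by
      rw [show α ++ u :: n :: γ = (α ++ [u]) ++ n :: γ by simp, trunc_append, trunc_append, hc, hc,
        ← trunc_append, ← trunc_append]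
      simp
    rw [h7] at h5
    exact h5.trans h6.symm
  · simp only [desWord, Set.mem_ofPred_eq, Nat.sub_add_cancel hn]
    exact iff_of_false (pair_sublist_asymm hw.nodup hasc) (pair_sublist_asymm hv.nodup hasc')
  · have := h3 (α ++ [u]) γ (by simpa using h.trans h2)
    simp at this
  · have hne' : ∀ a, ¬ KE v (a ++ [n]) := fun a h => hE' ⟨a, .inl (by rwa [ev])⟩
    obtain ⟨α', u', γ', h1', h2', h3', h4'⟩ := exists_swap_of_delClosed hv hasc' hne' hG'
    have h5 := h3 (α' ++ [u']) γ' (by simpa using h2')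
    have h6 := h3' (α ++ [u]) γ (by simpa using h2)
    simp at h5 h6
    omega

theorem not_ext_of_delClosed {n : ℕ} {w v : List ℕ} (hw : IsWord n w) (hv : IsWord n v)
    (hG : DelClosed n w v) (hn : 1 ≤ n) (hE : ¬ Ext w n) :
    KE (trunc w (n - 1)) (trunc v (n - 1)) ∧ (n - 1 ∈ desWord w ↔ n - 1 ∈ desWord v) ∧ ¬ KE w v ∧ (¬ Ext v n → ¬ DelClosed n v w) := by
  have hn2 : 2 ≤ n := by
    by_contra hc
    obtain rfl : n = 1 := by omega
    refine hE (ext_of_noPattern hw le_rfl le_rfl ?_)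
    intro i j m; omega
  have hmem : ∀ x, 1 ≤ x → x ≤ n → x ∈ w := fun x h1 h2 => hw.mem_iff.2 ⟨h1, h2⟩
  rcases pair_sublist_total (hmem (n - 1) (by omega) (by omega)) (hmem n hn le_rfl) (by omega)
    with h | h
  · exact not_ext_of_delClosed_of_asc hw hv hG hE h
  · obtain ⟨h1, h0, h2, h3⟩ := not_ext_of_delClosed_of_asc hw.reverse hv.reverse hG.reverse
      (fun h => hE (ext_reverse.1 h)) (pair_sublist_reverse.2 h)
    rw [desWord_reverse hw (by omega) (by omega), desWord_reverse hv (by omega) (by omega),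
      not_iff_not] at h0
    refine ⟨by simpa [trunc_reverse] using h1.reverse, h0, fun h => h2 h.reverse, fun h4 h5 => ?_⟩
    exact h3 (fun h => h4 (ext_reverse.1 h)) h5.reverse

theorem exists_max_not_ext {n : ℕ} {w : List ℕ} (h : ¬ ∀ k, 1 ≤ k → k ≤ n → Ext w k) :
    ∃ k, 1 ≤ k ∧ k ≤ n ∧ ¬ Ext w k ∧ ∀ l, k < l → l ≤ n → Ext w l := by
  classical
  push Not at h
  obtain ⟨k, h1, h2, h3⟩ := h
  have hP := Nat.findGreatest_spec (P := fun k => 1 ≤ k ∧ ¬ Ext w k) h2 ⟨h1, h3⟩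
  refine ⟨_, hP.1, Nat.findGreatest_le n, hP.2, fun l h4 h5 => ?_⟩
  by_contra h6
  exact Nat.findGreatest_is_greatest h4 h5 ⟨by omega, h6⟩

/-- A pair of classes closed under deletions contains a hook class. -/
theorem hook_or_hook_of_delClosed {n : ℕ} {w v : List ℕ} (hw : IsWord n w) (hv : IsWord n v)
    (hwv : DelClosed n w v) (hvw : DelClosed n v w) :
    (∀ k, 1 ≤ k → k ≤ n → Ext w k) ∨ ∀ k, 1 ≤ k → k ≤ n → Ext v k := by
  by_contra hcon
  rw [not_or] at hcon
  obtain ⟨k, hk1, hk2, hk3, hk4⟩ := exists_max_not_ext hcon.1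
  obtain ⟨l, hl1, hl2, hl3, hl4⟩ := exists_max_not_ext hcon.2
  -- Truncate to the largest letters k of w and l of v at which `Ext` fails, with l ≤ k. If l < k,
  -- the classes agree below k, hence up to l, yet must differ when truncated to l. If l = k,
  -- closure in both directions is impossible.
  have main : ∀ w v k l, IsWord n w → IsWord n v → DelClosed n w v → DelClosed n v w →
      1 ≤ k → k ≤ n → ¬ Ext w k → (∀ l, k < l → l ≤ n → Ext w l) → 1 ≤ l → ¬ Ext v l →
      (∀ k, l < k → k ≤ n → Ext v k) → l ≤ k → False := by
    intro w v k l hw hv hwv hvw hk1 hk2 hk3 hk4 hl1 hl3 hl4 hlk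
    have h1 := hwv.trunc hw hv hk2 hk4
    have h2 := hvw.trunc hv hw (hlk.trans hk2) hl4
    obtain ⟨h3, -, h4, h5⟩ := not_ext_of_delClosed (hw.trunc hk2) (hv.trunc hk2) h1 hk1
      (by rwa [ext_trunc le_rfl])
    rcases hlk.eq_or_lt with rfl | hlk
    · exact h5 (by rwa [ext_trunc le_rfl]) h2
    · obtain ⟨-, -, h6, -⟩ := not_ext_of_delClosed (hv.trunc (by omega)) (hw.trunc (by omega)) h2 hl1
        (by rwa [ext_trunc le_rfl])
      have h7 := h3.trunc l
      rw [trunc_trunc _ (by omega), trunc_trunc _ (by omega), trunc_trunc _ (by omega),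
        trunc_trunc _ (by omega)] at h7
      exact h6 h7.symm
  rcases le_total l k with h | h
  · exact main w v k l hw hv hwv hvw hk1 hk2 hk3 hk4 hl1 hl3 hl4 h
  · exact main v w l k hv hw hvw hwv hl1 hl2 hl3 hl4 hk1 hk3 hk4 h

/-! ### Deletion closed pairs containing a hook -/

theorem vWord_of_asc {J : Set ℕ} {m : ℕ} (h : ∀ i, 1 ≤ i → i < m → i ∉ J) :
    vWord J m = List.range' 1 m := by
  induction m with
  | zero => rfl
  | succ m ih =>
    rw [vWord, ih fun i h1 h2 => h i h1 (by omega)]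
    rcases m.eq_zero_or_pos with rfl | hm
    · split_ifs <;> rfl
    · rw [if_neg (h m hm (by omega)), range'_one_succ]

theorem vWord_of_asc_desc {J : Set ℕ} {p t : ℕ} (h : ∀ i, 1 ≤ i → i ≤ p → i ∉ J)
    (h' : ∀ i, p < i → i ≤ p + t → i ∈ J) :
    vWord J (p + 1 + t) = (List.range' (p + 2) t).reverse ++ List.range' 1 (p + 1) := by
  induction t with
  | zero => exact vWord_of_asc fun i h1 h2 => h i h1 (by omega)
  | succ t ih =>
    rw [← Nat.add_assoc, vWord, ih fun i h1 h2 => h' i h1 (by omega),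
      if_pos (h' _ (by omega) (by omega)), range'_succ_reverse]
    simp; omega

theorem vWord_eq_hookW {J : Set ℕ} {p q : ℕ} (h : ∀ i, 1 ≤ i → i ≤ p → i ∉ J)
    (h' : ∀ i, p < i → i ≤ p + q + 1 → i ∈ J) (h'' : p + q + 2 ∉ J) :
    vWord J (p + q + 3) = hookW p q := by
  have h1 := vWord_of_asc_desc (t := q + 1) h fun i h1 h2 => h' i h1 (by omega)
  rw [show p + q + 3 = p + 1 + (q + 1) + 1 by omega, vWord,
    if_neg (by rwa [show p + 1 + (q + 1) = p + q + 2 by omega]), h1, range'_succ_reverse, hookW]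
  simp; omega

/-- With the largest letter last, the class would be that of `hookW p q`; with it first, the ascent
at p+q+2 would be lost. -/
theorem not_ext_bumpW {p : ℕ} (hp : 1 ≤ p) (q : ℕ) : ¬ Ext (bumpW p q) (p + q + 3) := by
  intro h
  have hB := isWord_bumpW p q
  have hn := hB.nodup
  have e : trunc (bumpW p q) (p + q + 3) = bumpW p q := trunc_eq_self fun x hx => (hB.mem_iff.1 hx).2
  have e' : trunc (bumpW p q) (p + q + 2) =
      (p + q + 2) :: ((List.range' (p + 2) q).reverse ++ List.range' 1 (p + 1)) := by
    rw [trunc, bumpW, List.filter_cons_of_pos (by simp), List.filter_cons_of_neg (by simp)]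
    congr 1
    exact trunc_eq_self (by simp; omega)
  rcases h.eq_or hn (by omega) with h | h
  · rw [e, Nat.add_sub_cancel_right (n := p + q + 2) (m := 1), e'] at h
    exact not_ke_hookW_bumpW hp q ((KE.of_eq (by simp [hookW])).trans h.symm)
  · rw [e] at h
    have h1 : [p + q + 2, p + q + 2 + 1].Sublist (bumpW p q) := by
      rw [bumpW, pair_sublist_cons]
      exact .inr ⟨rfl, by simp⟩
    have h2 := (h.pair_succ hn _).1 h1
    have h3 := (h.perm.nodup_iff).1 hn
    refine pair_sublist_asymm h3 h2 ?_
    rw [pair_sublist_cons]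
    exact .inr ⟨rfl, mem_trunc.2 ⟨by simp [bumpW], by omega⟩⟩

/-- The first change of direction and back in the descents of a hook class. -/
theorem first_pattern_of_notMem {J : Set ℕ} {m : ℕ} (hmin : NoPattern J m) (hm : m ∉ J)
    (hpat : ¬ NoPattern J (m + 1)) : ∃ p q, 1 ≤ p ∧ m = p + q + 2 ∧
      (∀ i, 1 ≤ i → i ≤ p → i ∉ J) ∧ ∀ i, p < i → i ≤ p + q + 1 → i ∈ J := by
  classical
  unfold NoPattern at hpat
  push Not at hpat
  obtain ⟨i, j, m', h1, h2, h3, h4, h5⟩ := hpat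
  have hm' : m' = m := by
    by_contra hne
    have := hmin i j m' h1 h2 h3 (by omega) h5.1
    tauto
  subst hm'
  have hi : i ∉ J := by tauto
  have hj : j ∈ J := by tauto
  have hex : ∃ k, 1 ≤ k ∧ k ∈ J := ⟨j, by omega, hj⟩
  obtain ⟨hk1, hk2⟩ := Nat.find_spec hex
  have hk3 : ∀ l, 1 ≤ l → l < Nat.find hex → l ∉ J := fun l hl1 hl2 hl3 =>
    Nat.find_min hex hl2 ⟨hl1, hl3⟩
  have hkj : Nat.find hex ≤ j := Nat.find_min' hex ⟨by omega, hj⟩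
  generalize Nat.find hex = k at *
  -- Let k be the first descent. If k = 1, then 1 < i < j is a pattern ending before m. Later, an
  -- ascent l between k and m would make 1 < k < l such a pattern.
  have hk : k ≠ 1 := by
    rintro rfl
    have hi1 : i ≠ 1 := by rintro rfl; exact hi hk2
    have := hmin 1 i j le_rfl (by omega) h2 h3
    tauto
  refine ⟨k - 1, m' - k - 1, by omega, by omega, fun l hl1 hl2 => hk3 l hl1 (by omega), ?_⟩
  intro l hl1 hl2
  by_contra hl
  have hlk : l ≠ k := by rintro rfl; exact hl hk2
  have h6 := hmin 1 k l le_rfl (by omega) (by omega) (by omega)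
  have h7 := hk3 1 le_rfl (by omega)
  tauto

theorem ke_bumpW_of_hook {n : ℕ} {w v : List ℕ} (hw : IsWord n w) (hv : IsWord n v)
    (hE : ∀ k, 1 ≤ k → k ≤ n → Ext w k) (hwv : DelClosed n w v) {p q : ℕ} (hp : 1 ≤ p)
    (hn : p + q + 3 ≤ n) (h : ∀ i, 1 ≤ i → i ≤ p → i ∉ desWord w)
    (h' : ∀ i, p < i → i ≤ p + q + 1 → i ∈ desWord w) (h'' : p + q + 2 ∉ desWord w) :
    KE (trunc w (p + q + 3)) (hookW p q) ∧ KE (trunc v (p + q + 3)) (bumpW p q) := by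
  have h1 := ke_vWord hw hE _ hn
  rw [vWord_eq_hookW h h' h''] at h1
  exact ⟨h1, ke_bumpW_of_delClosed hp ((hwv.trunc hw hv hn fun k h1 h2 => hE k (by omega) h2).congr
    h1 (KE.refl _))⟩

/-- Truncated to m+1, the classes are those of `hookW` and `bumpW`, which differ but have equal
descents. If `Ext` failed for v at a letter beyond m+1, then `not_ext_of_delClosed` at the largest
such letter would make the two truncations to m+1 equivalent. -/
theorem first_change_of_notMem {n : ℕ} {w v : List ℕ} (hw : IsWord n w) (hv : IsWord n v)
    (hE : ∀ k, 1 ≤ k → k ≤ n → Ext w k) (hwv : DelClosed n w v) (hvw : DelClosed n v w) {m : ℕ}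
    (hmn : m < n) (hmin : NoPattern (desWord w) m) (hpat : ¬ NoPattern (desWord w) (m + 1))
    (hm : m ∉ desWord w) : (∀ k, m + 1 < k → k ≤ n → Ext v k) ∧ ¬ Ext v (m + 1) ∧
      ∀ i, i ≤ m → (i ∈ desWord v ↔ i ∈ desWord w) := by
  obtain ⟨p, q, hp, rfl, h1, h2⟩ := first_pattern_of_notMem hmin hm hpat
  obtain ⟨h3, h4⟩ := ke_bumpW_of_hook hw hv hE hwv hp hmn h1 h2 hm
  have h5 : ¬ Ext v (p + q + 2 + 1) := by
    intro h
    refine not_ext_bumpW hp q ((ext_trunc le_rfl).2 h |>.of_ke h4)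
  have h6 : ∀ k, p + q + 2 + 1 < k → k ≤ n → Ext v k := by
    by_contra hcon
    obtain ⟨k, hk1, hk2, hk3, hk4⟩ := exists_max_not_ext (n := n) (w := v)
      (fun h => hcon fun k h1 h2 => h k (by omega) h2)
    have hk5 : p + q + 3 < k := by
      by_contra hle
      exact hcon fun l h1 h2 => hk4 l (by omega) h2
    obtain ⟨h7, -⟩ := not_ext_of_delClosed (hv.trunc hk2) (hw.trunc hk2)
      (hvw.trunc hv hw hk2 hk4) hk1 (by rwa [ext_trunc le_rfl])
    have h8 := h7.trunc (p + q + 3)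
    rw [trunc_trunc _ (by omega), trunc_trunc _ (by omega), trunc_trunc _ (by omega),
      trunc_trunc _ (by omega)] at h8
    exact not_ke_hookW_bumpW hp q (h3.symm.trans (h8.symm.trans h4))
  refine ⟨h6, h5, ?_⟩
  intro i hi
  have e : ∀ {l : List ℕ}, i ∈ desWord l ↔ i ∈ desWord (trunc l (p + q + 3)) := by
    intro l
    simp only [desWord, Set.mem_ofPred_eq, pair_sublist_trunc]
    constructor
    · exact fun h => ⟨h, by omega, by omega⟩
    · exact fun h => h.1
  rw [e, e (l := w), h3.desWord_eq (nodup_trunc hw.nodup _),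
    h4.desWord_eq (nodup_trunc hv.nodup _)]
  simp only [desWord, Set.mem_ofPred_eq, hookW, bumpW, pair_sublist_append, pair_sublist_cons,
    pair_sublist_range', pair_sublist_range'_reverse, List.mem_append, List.mem_cons,
    List.mem_reverse, List.mem_range'_1, List.not_mem_nil, or_false, List.sublist_nil,
    reduceCtorEq, and_false, false_or]
  omega

theorem first_change {n : ℕ} {w v : List ℕ} (hw : IsWord n w) (hv : IsWord n v)
    (hE : ∀ k, 1 ≤ k → k ≤ n → Ext w k) (hwv : DelClosed n w v) (hvw : DelClosed n v w) {m : ℕ}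
    (hmn : m < n) (hmin : NoPattern (desWord w) m) (hpat : ¬ NoPattern (desWord w) (m + 1)) :
    (∀ k, m + 1 < k → k ≤ n → Ext v k) ∧ ¬ Ext v (m + 1) ∧
      ∀ i, i ≤ m → (i ∈ desWord v ↔ i ∈ desWord w) := by
  by_cases hm : m ∈ desWord w
  · have hm1 := (desWord_subset hw hm).1
    have hrev : ∀ i, 1 ≤ i → i < n → (i ∈ desWord w.reverse ↔ i ∉ desWord w) := fun i h1 h2 =>
      desWord_reverse hw h1 h2
    obtain ⟨h1, h2, h3⟩ := first_change_of_notMem hw.reverse hv.reverse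
      (fun k h1 h2 => (hE k h1 h2).reverse) hwv.reverse hvw.reverse hmn
      (hmin.congr fun i h1 h2 => hrev i h1 (by omega))
      (fun h => hpat (h.congr fun i h1 h2 => by rw [hrev i h1 (by omega), not_not]))
      (by rw [hrev m hm1 hmn]; exact not_not_intro hm)
    refine ⟨fun k h4 h5 => ext_reverse.1 (h1 k h4 h5), fun h => h2 h.reverse, fun i hi => ?_⟩
    rcases i.eq_zero_or_pos with rfl | hi0
    · constructor
      · intro h; exact absurd (desWord_subset hv h).1 (by omega)
      · intro h; exact absurd (desWord_subset hw h).1 (by omega)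
    · have := h3 i hi
      rw [hrev i hi0 (by omega), desWord_reverse hv hi0 (by omega)] at this
      tauto
  · exact first_change_of_notMem hw hv hE hwv hvw hmn hmin hpat hm

/-! ### Comparing the first patterns from both ends -/

theorem exists_min_pattern {J : Set ℕ} {n : ℕ} (h : ¬ NoPattern J n) :
    ∃ m, m < n ∧ NoPattern J m ∧ ¬ NoPattern J (m + 1) := by
  classical
  have h0 : NoPattern J 0 := by intro i j m; omega
  have hex : ∃ k, ¬ NoPattern J k := ⟨n, h⟩
  have h1 := Nat.find_spec hex
  have h2 := Nat.find_min' hex h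
  have h3 : Nat.find hex ≠ 0 := fun h => by rw [h] at h1; exact h1 h0
  refine ⟨Nat.find hex - 1, by omega, ?_, ?_⟩
  · by_contra h4
    exact Nat.find_min hex (by omega) h4
  · rwa [Nat.sub_add_cancel (by omega)]

/-- If large truncations extend then so do reverse complements of short upper parts. -/
theorem ext_revComp {n e : ℕ} {v : List ℕ} (hv : IsWord n v) (hE : ∀ k, e < k → k ≤ n → Ext v k)
    {f : ℕ} (hf1 : 1 ≤ f) (hfn : f ≤ n) (hef : e + f ≤ n + 3) : Ext (revComp n v) f := by
  have hle : ∀ x ∈ v, x ≤ n + 1 := fun x hx => by have := hv.mem_iff.1 hx; omega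
  -- the letters at least `l`
  set l := n + 1 - f with hl
  set u := v.filter fun x => l ≤ x with hu
  have hun : u.Nodup := hv.nodup.filter _
  have hmu : ∀ x, x ∈ u ↔ l ≤ x ∧ x ≤ n := by
    intro x
    simp only [hu, List.mem_filter, hv.mem_iff, decide_eq_true_eq]
    omega
  have hEu : ∀ k ∈ u, Ext u k := by
    intro k hk
    have hk' := (hmu k).1 hk
    have htr : trunc u k = (trunc v k).filter fun x => l ≤ x := by
      rw [trunc, trunc, hu, List.filter_filter, List.filter_filter]
      exact List.filter_congr fun x _ => Bool.and_comm _ _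
    rcases lt_or_ge e k with hek | hek
    · obtain ⟨s, hs⟩ := hE k hek hk'.2
      refine ⟨s.filter fun x => l ≤ x, ?_⟩
      have hconv : ∀ x y z, x < y → y < z → decide (l ≤ x) = true → decide (l ≤ z) = true →
          decide (l ≤ y) = true := by
        intro x y z; simp; omega
      rw [htr]
      refine hs.imp (fun h => ?_) fun h => ?_
      · have := h.filter hconv
        simpa [List.filter_cons, hk'.1] using this
      · have := h.filter hconv
        simpa [List.filter_cons, hk'.1] using this
    -- For k ≤ e the bound e + f ≤ n + 3 leaves only the letters l, l+1, l+2. In a word of at most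
    -- three letters the largest is first, last, or a peak between two smaller ones.
    · have hkm : k ∈ trunc u k := mem_trunc.2 ⟨hk, le_rfl⟩
      have hn3 := nodup_trunc hun k
      have hlen : (trunc u k).length ≤ 3 := by
        have : trunc u k ⊆ [k, k - 1, k - 2] := by
          intro x hx
          rw [mem_trunc, hmu] at hx
          simp; omega
        simpa using (List.subperm_of_subset hn3 this).length_le
      have hlt : ∀ x ∈ trunc u k, x ≠ k → x < k := fun x hx hxk => by
        have := (mem_trunc.1 hx).2; omega
      obtain ⟨s, t, hst⟩ := List.append_of_mem hkm
      rw [Ext, hst]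
      rw [hst] at hlen hn3 hlt
      rcases s with - | ⟨x, s⟩
      · exact ⟨t, .inr (KE.refl _)⟩
      rcases t with - | ⟨y, t⟩
      · exact ⟨x :: s, .inl (KE.refl _)⟩
      simp only [List.length_append, List.length_cons] at hlen
      obtain rfl : s = [] := List.eq_nil_of_length_eq_zero (by omega)
      obtain rfl : t = [] := List.eq_nil_of_length_eq_zero (by omega)
      have hxk : x < k := hlt x (by simp) (by rintro rfl; simp at hn3)
      have hyk : y < k := hlt y (by simp) (by rintro rfl; simp at hn3)
      exact exists_ke_of_unimodal (by simpa using hxk) (by simpa using hyk) hn3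
  obtain ⟨d, a, hd, ha, hda⟩ := exists_ke_vshape hun (fun h => by
    have := (hmu 0).1 h; omega) hEu
  have hule : ∀ x ∈ u, x ≤ n + 1 := fun x hx => by have := (hmu x).1 hx; omega
  have hdale : ∀ x ∈ d ++ a, x ≤ n + 1 := fun x hx => hule x (hda.perm.mem_iff.2 hx)
  -- The reverse complement of a word that decreases and then increases is one that increases and
  -- then decreases.
  have h1 := hda.revComp hule
  rw [revComp_append] at h1
  have htr : trunc (revComp n v) f = revComp n u := by
    rw [trunc, revComp, revComp, List.filter_reverse, List.filter_map, hu]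
    congr 2
    refine List.filter_congr fun x hx => ?_
    have := hv.mem_iff.1 hx
    simp; omega
  rw [← ext_trunc le_rfl, htr]
  refine ext_of_mem_unimodal ?_ ?_ ?_ h1 ?_
  · rw [← htr]; exact nodup_trunc hv.revComp.nodup f
  · rw [revComp, List.pairwise_reverse, List.pairwise_map]
    refine List.Pairwise.imp_of_mem (fun hx hy hxy => ?_) ha
    have := hdale _ (List.mem_append_right d hx)
    have := hdale _ (List.mem_append_right d hy)
    omega
  · rw [revComp, List.pairwise_reverse, List.pairwise_map]
    refine List.Pairwise.imp_of_mem (fun {x y} hx hy hxy => ?_) hd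
    have := hdale _ (List.mem_append_left a hx)
    have := hdale _ (List.mem_append_left a hy)
    show n + 1 - y > n + 1 - x
    omega
  · rw [← htr, mem_trunc, hv.revComp.mem_iff]
    omega

theorem mem_desWord_trunc {w : List ℕ} {i k : ℕ} (h : i < k) :
    i ∈ desWord (trunc w k) ↔ i ∈ desWord w := by
  simp only [desWord, Set.mem_ofPred_eq, pair_sublist_trunc]
  exact ⟨fun h => h.1, fun h' => ⟨h', by omega, by omega⟩⟩

/-- If the pattern of a hook class starts with an ascent then the class and its partner have a
common descent set, which is an interval of one of the two basic kinds. -/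
theorem isBasicPair_of_notMem {n : ℕ} {w v : List ℕ} (hw : IsWord n w) (hv : IsWord n v)
    (hE : ∀ k, 1 ≤ k → k ≤ n → Ext w k) (hwv : DelClosed n w v) (hvw : DelClosed n v w) {m : ℕ}
    (hmn : m < n) (hmin : NoPattern (desWord w) m) (hpat : ¬ NoPattern (desWord w) (m + 1))
    (hm : m ∉ desWord w) : desWord v = desWord w ∧ IsBasicPairDescentSet n (desWord w) := by
  have hle : ∀ x ∈ w, x ≤ n + 1 := fun x hx => by have := hw.mem_iff.1 hx; omega
  have hlev : ∀ x ∈ v, x ≤ n + 1 := fun x hx => by have := hv.mem_iff.1 hx; omega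
  obtain ⟨p, q, hp, rfl, h1, h2⟩ := first_pattern_of_notMem hmin hm hpat
  obtain ⟨h3, h4, h5⟩ := first_change hw hv hE hwv hvw hmn hmin hpat
  have hrc : ∀ i, 1 ≤ i → i < n → (i ∈ desWord (revComp n w) ↔ n - i ∈ desWord w) :=
    fun i h1 h2 => desWord_revComp hw h1 h2
  -- the reverse complement of `w` is again a hook
  have hErc : ∀ k, 1 ≤ k → k ≤ n → Ext (revComp n w) k := fun k hk1 hk2 =>
    ext_revComp (e := 0) hw (fun l hl1 hl2 => hE l hl1 hl2) hk1 hk2 (by omega)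
  -- A pattern of w starting at i is a pattern of the reverse complement ending at n-i.
  have hpat' : ∀ i j t, 1 ≤ i → i < j → j < t → t < n → (i ∈ desWord w ↔ t ∈ desWord w) →
      ¬ (i ∈ desWord w ↔ j ∈ desWord w) → ¬ NoPattern (desWord (revComp n w)) (n - i + 1) := by
    intro i j t hi hij hjt htn hit hij' hno
    have := hno (n - t) (n - j) (n - i) (by omega) (by omega) (by omega) (by omega)
    rw [hrc _ (by omega) (by omega), hrc _ (by omega) (by omega), hrc _ (by omega) (by omega),
      show n - (n - t) = t by omega, show n - (n - j) = j by omega,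
      show n - (n - i) = i by omega] at this
    tauto
  have hp1 : p ∉ desWord w := h1 p hp le_rfl
  have hp2 : p + 1 ∈ desWord w := h2 (p + 1) (by omega) (by omega)
  obtain ⟨m', hm'n, hmin', hpm'⟩ := exists_min_pattern (J := desWord (revComp n w)) (n := n)
    (by
      intro hno
      refine hpat' p (p + 1) (p + q + 2) hp (by omega) (by omega) hmn (by tauto) (by tauto) ?_
      intro i j t a b c d
      exact hno i j t a b c (by omega))
  obtain ⟨h6, h7, h8⟩ := first_change hw.revComp hv.revComp hErc (hwv.revComp hw) (hvw.revComp hv)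
    hm'n hmin' hpm'
  -- The class of v satisfies `Ext` above p+q+3, so its reverse complement satisfies it at every f ≤
  -- n-p-q; but it fails at m'+1.
  have hsum : n + 2 ≤ (p + q + 2) + m' := by
    by_contra hcon
    exact h7 (ext_revComp hv h3 (by omega) (by omega) (by omega))
  -- no pattern starts late
  have hlate : ∀ i j t, p + q + 1 ≤ i → i < j → j < t → t < n →
      (i ∈ desWord w ↔ t ∈ desWord w) → (i ∈ desWord w ↔ j ∈ desWord w) := by
    intro i j t hi hij hjt htn hit
    by_contra hij'
    refine hpat' i j t (by omega) hij hjt htn hit hij' ?_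
    intro a b c ha hab hbc hc
    exact hmin' a b c ha hab hbc (by omega)
  -- A descent beyond the ascent p+q+2 would complete a pattern starting at the descent p+q+1, and
  -- such late patterns are excluded.
  have hJ : desWord w = Set.Icc (p + 1) (p + q + 1) := by
    ext i
    rw [Set.mem_Icc]
    constructor
    · intro hi
      have hb := desWord_subset hw hi
      have : ¬ i ≤ p := fun h => h1 i hb.1 h hi
      refine ⟨by omega, ?_⟩
      by_contra hc
      have hi2 : i ≠ p + q + 2 := by rintro rfl; exact hm hi
      have := hlate (p + q + 1) (p + q + 2) i le_rfl (by omega) (by omega) hb.2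
      have := h2 (p + q + 1) (by omega) le_rfl
      tauto
    · rintro ⟨hi1, hi2⟩
      exact h2 i (by omega) hi2
  have hJv : desWord v = desWord w := by
    ext i
    by_cases hi : 1 ≤ i ∧ i < n
    -- The cut from the left gives agreement up to p+q+2, the cut from the right gives it from n-m'
    -- on; by `hsum` these ranges cover everything.
    · rcases le_total i (p + q + 2) with hi2 | hi2
      · exact h5 i hi2
      · have := h8 (n - i) (by omega)
        rwa [hrc _ (by omega) (by omega), desWord_revComp hv (by omega) (by omega),
          show n - (n - i) = i by omega] at this
    · exact iff_of_false (fun h => hi (desWord_subset hv h)) fun h => hi (desWord_subset hw h)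
  refine ⟨hJv, ?_⟩
  rw [hJ]
  by_cases hn : n = p + q + 3
  · exact .inl ⟨p + 1, by omega, by omega, by rw [hn]; rfl⟩
  by_cases hp' : p = 1
  · exact .inr ⟨q + 4, by omega, by omega, by rw [hp']; congr 1; omega⟩
  -- Now p ≥ 2 and p+q+3 is an ascent of both classes. Truncated to p+q+4 they are the classes of
  -- `hookW` and `bumpW` with the largest letter appended.
  exfalso
  obtain ⟨h9, h10⟩ := ke_bumpW_of_hook hw hv hE hwv hp hmn h1 h2 hm
  have hext : ∀ u : List ℕ, IsWord n u → desWord u = desWord w → Ext u (p + q + 4) →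
      KE (trunc u (p + q + 4)) (trunc u (p + q + 3) ++ [p + q + 4]) := by
    intro u hu hud hue
    refine (hue.eq_or hu.nodup (by omega)).resolve_right fun h => ?_
    have hd : p + q + 3 ∈ desWord u := by
      rw [← mem_desWord_trunc (k := p + q + 4) (by omega), h.desWord_eq (nodup_trunc hu.nodup _)]
      show [_, _].Sublist _
      rw [pair_sublist_cons]
      exact .inr ⟨rfl, mem_trunc.2 ⟨hu.mem_iff.2 (by omega), by omega⟩⟩
    rw [hud, hJ, Set.mem_Icc] at hd
    omega
  have h11 := (hext w hw rfl (hE _ (by omega) (by omega))).trans (h9.append_right _)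
  have h12 := (hext v hv hJv (h3 _ (by omega) (by omega))).trans (h10.append_right _)
  exact not_delClosed_bumpW (by omega) ((hvw.trunc hv hw (by omega)
    fun k hk1 hk2 => h3 k (by omega) hk2).congr h12 h11)

theorem isPair_of_hook {n : ℕ} {w v : List ℕ} (hw : IsWord n w) (hv : IsWord n v)
    (hE : ∀ k, 1 ≤ k → k ≤ n → Ext w k) (hwv : DelClosed n w v) (hvw : DelClosed n v w)
    (hpat : ¬ NoPattern (desWord w) n) :
    desWord v = desWord w ∧ IsPairDescentSet n (desWord w) := by
  obtain ⟨m, hmn, hmin, hpm⟩ := exists_min_pattern hpat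
  by_cases hm : m ∈ desWord w
  · have hm1 := (desWord_subset hw hm).1
    have hrev : ∀ i, 1 ≤ i → i < n → (i ∈ desWord w.reverse ↔ i ∉ desWord w) := fun i h1 h2 =>
      desWord_reverse hw h1 h2
    obtain ⟨h1, h2⟩ := isBasicPair_of_notMem hw.reverse hv.reverse
      (fun k h1 h2 => (hE k h1 h2).reverse) hwv.reverse hvw.reverse hmn
      (hmin.congr fun i h1 h2 => hrev i h1 (by omega))
      (fun h => hpm (h.congr fun i h1 h2 => by rw [hrev i h1 (by omega), not_not]))
      (by rw [hrev m hm1 hmn]; exact not_not_intro hm)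
    constructor
    · ext i
      by_cases hi : 1 ≤ i ∧ i < n
      · have := Set.ext_iff.1 h1 i
        rwa [hrev i hi.1 hi.2, desWord_reverse hv hi.1 hi.2, not_iff_not] at this
      · exact iff_of_false (fun h => hi (desWord_subset hv h)) fun h => hi (desWord_subset hw h)
    · refine .inr ⟨_, h2, ?_⟩
      ext i
      rw [Set.mem_sdiff, Set.mem_Icc]
      by_cases hi : 1 ≤ i ∧ i < n
      · rw [hrev i hi.1 hi.2, not_not]
        exact ⟨fun h => ⟨⟨hi.1, by omega⟩, h⟩, fun h => h.2⟩
      · exact iff_of_false (fun h => hi (desWord_subset hw h)) fun h => hi (by omega)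
  · obtain ⟨h1, h2⟩ := isBasicPair_of_notMem hw hv hE hwv hvw hmn hmin hpm hm
    exact ⟨h1, .inl h2⟩

theorem isHookDescentSet_of_noPattern {n : ℕ} (hn : 1 ≤ n) {J : Set ℕ} (hJ : NoPattern J n)
    (hsub : ∀ i ∈ J, 1 ≤ i ∧ i < n) : IsHookDescentSet n J := by
  classical
  by_cases h1 : 1 ∈ J
  · left
    by_cases hex : ∃ k, (1 ≤ k ∧ k < n) ∧ k ∉ J
    · obtain ⟨⟨hk1, hk2⟩, hk3⟩ := Nat.find_spec hex
      have hk4 : ∀ l, 1 ≤ l → l < Nat.find hex → l ∈ J := fun l hl1 hl2 => by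
        by_contra hl
        exact Nat.find_min hex hl2 ⟨⟨hl1, by omega⟩, hl⟩
      generalize Nat.find hex = k at *
      refine ⟨k - 1, by omega, ?_⟩
      ext i
      rw [Set.mem_Icc]
      constructor
      · intro hi
        have hb := hsub i hi
        refine ⟨hb.1, ?_⟩
        by_contra hc
        have hik : i ≠ k := by rintro rfl; exact hk3 hi
        have hk1' : k ≠ 1 := by rintro rfl; exact hk3 h1
        have := hJ 1 k i le_rfl (by omega) (by omega) hb.2
        tauto
      · rintro ⟨hi1, hi2⟩
        exact hk4 i hi1 (by omega)
    · push Not at hex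
      refine ⟨n - 1, by omega, ?_⟩
      ext i
      rw [Set.mem_Icc]
      constructor
      · intro hi; have := hsub i hi; omega
      · intro hi; exact hex i (by omega)
  · by_cases hex : ∃ k, k ∈ J
    · have hk1 := Nat.find_spec hex
      have hk2 : ∀ l, l < Nat.find hex → l ∉ J := fun l hl => Nat.find_min hex hl
      generalize Nat.find hex = k at *
      have hk3 := hsub k hk1
      refine .inr ⟨k, hk3.1, by omega, ?_⟩
      ext i
      rw [Set.mem_Icc]
      constructor
      · intro hi
        have := hsub i hi
        refine ⟨?_, by omega⟩
        by_contra hc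
        exact hk2 i (by omega) hi
      · rintro ⟨hi1, hi2⟩
        by_contra hi
        have hik : i ≠ k := by rintro rfl; exact hi hk1
        have hk1' : k ≠ 1 := by rintro rfl; exact h1 hk1
        have := hJ 1 k i le_rfl (by omega) (by omega) (by omega)
        tauto
    · push Not at hex
      refine .inl ⟨0, hn, ?_⟩
      ext i
      simp only [Set.mem_Icc]
      exact iff_of_false (hex i) (by omega)

/-- The descent sets of two classes which are closed under deletions together. -/
theorem descentSets_of_delClosed {n : ℕ} (hn : 1 ≤ n) {w v : List ℕ} (hw : IsWord n w)
    (hv : IsWord n v) (hwv : DelClosed n w v) (hvw : DelClosed n v w) :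
    (IsHookDescentSet n (desWord w) ∧ IsHookDescentSet n (desWord v)) ∨
      (desWord v = desWord w ∧ IsPairDescentSet n (desWord w)) := by
  have main : ∀ w v, IsWord n w → IsWord n v → DelClosed n w v → DelClosed n v w →
      (∀ k, 1 ≤ k → k ≤ n → Ext w k) →
      (IsHookDescentSet n (desWord w) ∧ IsHookDescentSet n (desWord v)) ∨
        (desWord v = desWord w ∧ IsPairDescentSet n (desWord w)) := by
    intro w v hw hv hwv hvw hE
    by_cases hpat : NoPattern (desWord w) n
    swap
    · exact .inr (isPair_of_hook hw hv hE hwv hvw hpat)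
    -- At the largest letter k where v fails, the descents of v below k agree with those of w. They
    -- contain no pattern, and this alone implies `Ext v k`.
    have hEv : ∀ k, 1 ≤ k → k ≤ n → Ext v k := by
      by_contra hcon
      obtain ⟨k, hk1, hk2, hk3, hk4⟩ := exists_max_not_ext hcon
      obtain ⟨h1, h2, -⟩ := not_ext_of_delClosed (hv.trunc hk2) (hw.trunc hk2)
        (hvw.trunc hv hw hk2 hk4) hk1 (by rwa [ext_trunc le_rfl])
      rw [trunc_trunc _ (by omega), trunc_trunc _ (by omega)] at h1
      rw [mem_desWord_trunc (by omega), mem_desWord_trunc (by omega)] at h2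
      have hd : ∀ i, i < k → (i ∈ desWord v ↔ i ∈ desWord w) := by
        intro i hi
        rcases (show i ≤ k - 1 by omega).eq_or_lt with rfl | hi'
        · exact h2
        · rw [← mem_desWord_trunc hi', h1.desWord_eq (nodup_trunc hv.nodup _),
            mem_desWord_trunc hi']
      refine hk3 (ext_of_noPattern hv hk1 hk2 ?_)
      intro a b c ha hab hbc hc
      rw [hd a (by omega), hd b (by omega), hd c hc]
      exact hpat a b c ha hab hbc (by omega)
    by_cases hpat' : NoPattern (desWord v) n
    · exact .inl ⟨isHookDescentSet_of_noPattern hn hpat fun i hi => desWord_subset hw hi,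
        isHookDescentSet_of_noPattern hn hpat' fun i hi => desWord_subset hv hi⟩
    · obtain ⟨h1, h2⟩ := isPair_of_hook hv hw hEv hvw hwv hpat'
      exact .inr ⟨h1.symm, h1 ▸ h2⟩
  rcases hook_or_hook_of_delClosed hw hv hwv hvw with h | h
  · exact main w v hw hv hwv hvw h
  · rcases main v w hv hw hvw hwv h with ⟨h1, h2⟩ | ⟨h1, h2⟩
    · exact .inl ⟨h2, h1⟩
    · exact .inr ⟨h1.symm, h1 ▸ h2⟩

/-! ### Patterns, swaps and words -/

theorem length_word {n : ℕ} (π : Equiv.Perm (Fin n)) : (word π).length = n := by simp [word]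

/-- Here s is the occurrence as a list of letters and g its standardisation, a form in which single
letters of an occurrence can be exchanged. -/
theorem contains_iff {m k : ℕ} {σ : Equiv.Perm (Fin m)} {π : Equiv.Perm (Fin k)} :
    Contains σ π ↔ ∃ (s : List ℕ) (g : ℕ → ℕ), s.Sublist (word σ) ∧
      StrictMonoOn g {x | x ∈ s} ∧ s.map g = word π := by
  constructor
  · rintro ⟨f, hf⟩
    classical
    have hinj : Function.Injective fun i => (σ (f i) : ℕ) + 1 := by
      intro i j h
      exact f.injective (σ.injective (Fin.ext (by simpa using h)))
    let g : ℕ → ℕ := fun x => if h : ∃ i, (σ (f i) : ℕ) + 1 = x then (π h.choose : ℕ) + 1 else 0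
    have hg : ∀ i, g ((σ (f i) : ℕ) + 1) = (π i : ℕ) + 1 := by
      intro i
      have h : ∃ j, (σ (f j) : ℕ) + 1 = (σ (f i) : ℕ) + 1 := ⟨i, rfl⟩
      have h2 : h.choose = i := hinj h.choose_spec
      show (if h : _ then _ else _) = _
      rw [dif_pos h, h2]
    refine ⟨List.ofFn fun i => (σ (f i) : ℕ) + 1, g, ?_, ?_, ?_⟩
    · rw [List.sublist_iff_exists_fin_orderEmbedding_get_eq]
      refine ⟨((Fin.castOrderIso (by simp)).toOrderEmbedding.trans f).trans
        (Fin.castOrderIso (by simp [word])).toOrderEmbedding, fun i => ?_⟩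
      simp [word]
      rfl
    · intro x hx y hy hxy
      simp only [Set.mem_ofPred_eq, List.mem_ofFn] at hx hy
      obtain ⟨i, rfl⟩ := hx
      obtain ⟨j, rfl⟩ := hy
      rw [hg, hg]
      have := (hf i j).1 (Fin.lt_def.2 (by omega))
      rw [Fin.lt_def] at this
      omega
    · rw [List.map_ofFn, word]
      congr 1
      funext i
      exact hg i
  · rintro ⟨s, g, hs, hg, hsg⟩
    have hlen : s.length = k := by rw [← length_word π, ← hsg, List.length_map]
    obtain ⟨f, hf⟩ := List.sublist_iff_exists_fin_orderEmbedding_get_eq.1 hs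
    let f' : Fin k ↪o Fin m := ((Fin.castOrderIso hlen.symm).toOrderEmbedding.trans f).trans
        (Fin.castOrderIso (length_word σ)).toOrderEmbedding
    have h1 : ∀ i : Fin k, s[(i : ℕ)]'(by omega) = (σ (f' i) : ℕ) + 1 := by
      intro i
      have := hf (Fin.cast hlen.symm i)
      simp only [List.get_eq_getElem, word, List.getElem_ofFn] at this
      exact this
    have h2 : ∀ i : Fin k, g (s[(i : ℕ)]'(by omega)) = (π i : ℕ) + 1 := by
      intro i
      have h3 : (s.map g)[(i : ℕ)]'(by simp; omega) = (word π)[(i : ℕ)]'(by simp [word]) := by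
        simp only [hsg]
      simpa [word] using h3
    refine ⟨f', fun i j => ?_⟩
    have h3 := hg.lt_iff_lt (a := s[(i : ℕ)]'(by omega)) (b := s[(j : ℕ)]'(by omega))
      (List.getElem_mem _) (List.getElem_mem _)
    rw [h2, h2, h1, h1] at h3
    rw [Fin.lt_def, Fin.lt_def]
    omega

theorem countP_lt_range' {n x : ℕ} (h1 : 1 ≤ x) (h2 : x ≤ n + 1) :
    (List.range' 1 n).countP (· < x) = x - 1 := by
  induction n with
  | zero => simp; omega
  | succ n ih =>
    rw [range'_one_succ, List.countP_append]
    rcases h2.eq_or_lt with rfl | h2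
    · rw [List.countP_eq_length.2]
      · simp
      · simp; omega
    · rw [ih (by omega), List.countP_singleton]
      simp; omega

/-- A standardisation of a word is unique. -/
theorem map_eq_map_of_strictMonoOn {n : ℕ} {s : List ℕ} {f g : ℕ → ℕ}
    (hf : StrictMonoOn f {x | x ∈ s}) (hg : StrictMonoOn g {x | x ∈ s}) (hfs : IsWord n (s.map f))
    (hgs : IsWord n (s.map g)) : s.map f = s.map g := by
  have key : ∀ f : ℕ → ℕ, StrictMonoOn f {x | x ∈ s} → IsWord n (s.map f) → ∀ x ∈ s,
      f x = s.countP (· < x) + 1 := by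
    intro f hf hfs x hx
    have hfx := hfs.mem_iff.1 (List.mem_map_of_mem (f := f) hx)
    have h1 := hfs.countP_eq (· < f x)
    rw [countP_lt_range' hfx.1 (by omega), List.countP_map] at h1
    have h2 : s.countP (· < x) = s.countP ((fun z => decide (z < f x)) ∘ f) :=
      List.countP_congr fun y hy => by simpa using (hf.lt_iff_lt hy hx).symm
    omega
  exact List.map_congr_left fun x hx => by rw [key f hf hfs x hx, key g hg hgs x hx]

/-- An occurrence of length n among n+1 letters misses exactly one letter c, and its standardisation
is unique. -/
theorem contains_iff_del {n : ℕ} {σ : Equiv.Perm (Fin (n + 1))} {π : Equiv.Perm (Fin n)} :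
    Contains σ π ↔ ∃ c, 1 ≤ c ∧ c ≤ n + 1 ∧ del c (word σ) = word π := by
  rw [contains_iff]
  have hσ := isWord_word σ
  constructor
  · rintro ⟨s, g, hs, hg, hsg⟩
    have hlen : s.length = n := by rw [← length_word π, ← hsg, List.length_map]
    have hex : ∃ c ∈ word σ, c ∉ s := by
      by_contra hcon
      push Not at hcon
      have h1 : (word σ).Subperm s := List.subperm_of_subset hσ.nodup hcon
      have := h1.length_le
      rw [length_word] at this
      omega
    obtain ⟨c, hc, hcs⟩ := hex
    have hcb := hσ.mem_iff.1 hc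
    have hsub : s.Sublist ((word σ).filter fun x => x ≠ c) := by
      have := hs.filter fun x => x ≠ c
      rwa [List.filter_eq_self.2 (fun x hx => by
        simp; rintro rfl; exact hcs hx)] at this
    have hd := (hσ.del hcb.1 hcb.2)
    have heq : s = (word σ).filter fun x => x ≠ c := by
      refine hsub.eq_of_length ?_
      have := hd.length_eq
      rw [del, List.length_map] at this
      omega
    refine ⟨c, hcb.1, hcb.2, ?_⟩
    rw [← hsg]
    rw [del, ← heq] at hd ⊢
    refine map_eq_map_of_strictMonoOn ?_ hg hd (hsg ▸ isWord_word π)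
    refine (dn_strictMonoOn c).mono fun x hx => ?_
    rintro rfl
    exact hcs hx
  · rintro ⟨c, h1, h2, h3⟩
    refine ⟨(word σ).filter fun x => x ≠ c, dn c, List.filter_sublist, ?_, h3⟩
    refine (dn_strictMonoOn c).mono fun x hx => ?_
    simpa using (List.mem_filter.1 hx).2

theorem mem_iff_of_isUnion {n : ℕ} {A : Set (Equiv.Perm (Fin n))} (hA : IsUnionOfKnuthClasses A)
    {σ σ' : Equiv.Perm (Fin n)} (h : KE (word σ) (word σ')) : σ ∈ A ↔ σ' ∈ A := by
  obtain ⟨F, rfl⟩ := hA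
  simp only [Set.mem_iUnion, mem_K_iff]
  constructor
  · rintro ⟨S, hS, h1⟩; exact ⟨S, hS, h.symm.trans h1⟩
  · rintro ⟨S, hS, h1⟩; exact ⟨S, hS, h.trans h1⟩

theorem isUnion_of_ke {n : ℕ} {A : Set (Equiv.Perm (Fin n))}
    (hA : ∀ σ σ', KE (word σ) (word σ') → σ ∈ A → σ' ∈ A) : IsUnionOfKnuthClasses A := by
  refine ⟨{S | K S ⊆ A}, ?_⟩
  ext σ
  simp only [Set.mem_iUnion]
  constructor
  · intro hσ
    obtain ⟨S, hS⟩ := exists_mem_K σ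
    refine ⟨S, fun τ hτ => hA σ τ ?_ hσ, hS⟩
    exact (mem_K_iff.1 hS).trans (mem_K_iff.1 hτ).symm
  · rintro ⟨S, hS, h⟩
    exact hS h

/-- Only the avoiders of length n+1 are used, and nothing else of (i) enters the proof. -/
theorem delClosed_of_patternKnuthClosed {n : ℕ} {S T : SYT n}
    (h : PatternKnuthClosed (K S ∪ K T)) :
    DelClosed n (rowWord S.rows) (rowWord T.rows) := by
  intro σ σ' c hσ hσσ' h1 h2 hc
  obtain ⟨s, rfl⟩ := exists_word_eq hσ
  obtain ⟨s', rfl⟩ := exists_word_eq (hσ.ke hσσ')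
  obtain ⟨π, hπ⟩ := exists_word_eq (hσ.del h1 h2)
  have hs : s ∉ avoiders (n + 1) (K S ∪ K T) := fun hav =>
    hav π (.inl (mem_K_iff.2 (hπ ▸ hc))) (contains_iff_del.2 ⟨c, h1, h2, hπ.symm⟩)
  rw [mem_iff_of_isUnion (h (n + 1)) hσσ'] at hs
  simp only [avoiders, Set.mem_ofPred_eq] at hs
  push Not at hs
  obtain ⟨π', hπ', hcon⟩ := hs
  obtain ⟨c', h3, h4, h5⟩ := contains_iff_del.1 hcon
  refine ⟨c', h3, h4, ?_⟩
  rw [h5]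
  exact hπ'.imp mem_K_iff.1 mem_K_iff.1

/-! ### Swaps in one-line notation -/

theorem word_mul_swap {n : ℕ} {π : Equiv.Perm (Fin n)} {u v : List ℕ} {p q : ℕ}
    (h : word π = u ++ p :: q :: v) {i j : Fin n} (hi : (i : ℕ) = u.length) (hj : (i : ℕ) + 1 = j) :
    word (π * Equiv.swap i j) = u ++ q :: p :: v := by
  have hij : i ≠ j := by rintro rfl; omega
  have hget : ∀ k : Fin n, (word π)[(k : ℕ)]? = some ((π k : ℕ) + 1) := fun k =>
    (getElem?_word π).2 ⟨k.isLt, rfl⟩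
  have hlen : u.length + v.length + 2 = n := by
    have := length_word π
    rw [h] at this
    simp at this
    omega
  refine List.ext_getElem? fun k => ?_
  rcases lt_or_ge k n with hk | hk
  swap
  · rw [List.getElem?_eq_none (by rw [length_word]; exact hk),
      List.getElem?_eq_none (by simp; omega)]
  rw [(getElem?_word _).2 ⟨hk, rfl⟩, Equiv.Perm.mul_apply]
  by_cases hki : (⟨k, hk⟩ : Fin n) = i
  · have hk' : k = u.length := by rw [← hi, ← hki]
    rw [hki, Equiv.swap_apply_left, ← hget j, h, ← hj, hi, hk']
    simp
  by_cases hkj : (⟨k, hk⟩ : Fin n) = j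
  · have hk' : k = u.length + 1 := by rw [← hi, hj, ← hkj]
    rw [hkj, Equiv.swap_apply_right, ← hget i, h, hi, hk']
    simp
  · rw [Equiv.swap_apply_of_ne_of_ne hki hkj, ← hget ⟨k, hk⟩, h]
    have h1 : k ≠ u.length := by
      rw [← hi]; intro h; exact hki (Fin.ext h)
    have h2 : k ≠ u.length + 1 := by
      rw [← hi, hj]; intro h; exact hkj (Fin.ext h)
    rcases lt_or_ge k u.length with h3 | h3
    · rw [List.getElem?_append_left h3, List.getElem?_append_left h3]
    · rw [List.getElem?_append_right h3, List.getElem?_append_right h3]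
      obtain ⟨l, hl⟩ : ∃ l, k - u.length = l + 2 := ⟨k - u.length - 2, by omega⟩
      rw [hl]
      simp

theorem isSwap_iff {n : ℕ} {π σ : Equiv.Perm (Fin n)} : IsSwap π σ ↔
    ∃ u p q v, word π = u ++ p :: q :: v ∧ word σ = u ++ q :: p :: v ∧ (p + 1 < q ∨ q + 1 < p) := by
  have hget : ∀ k : Fin n, (word π)[(k : ℕ)]? = some ((π k : ℕ) + 1) := fun k =>
    (getElem?_word π).2 ⟨k.isLt, rfl⟩
  have habs : ∀ a b : ℕ, 1 < |(a : ℤ) - (b : ℤ)| ↔ (a + 1 < b ∨ b + 1 < a) := by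
    intro a b
    rw [lt_abs]
    omega
  constructor
  · rintro ⟨i, j, hij, hlt, rfl⟩
    have hw : word π = (word π).take i ++ ((π i : ℕ) + 1) :: ((π j : ℕ) + 1) ::
        (word π).drop (i + 2) := by
      have hi : (i : ℕ) < (word π).length := by rw [length_word]; exact i.isLt
      have hj : (i : ℕ) + 1 < (word π).length := by rw [length_word, hij]; exact j.isLt
      conv_lhs => rw [← List.take_append_drop i (word π), List.drop_eq_getElem_cons hi,
        List.drop_eq_getElem_cons hj]
      have h1 := hget i
      have h2 := hget j
      rw [← hij, List.getElem?_eq_getElem hj] at h2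
      rw [List.getElem?_eq_getElem hi] at h1
      rw [Option.some.inj h1, Option.some.inj h2]
    refine ⟨_, _, _, _, hw, word_mul_swap hw ?_ hij, ?_⟩
    · rw [List.length_take, length_word]
      have := i.isLt
      omega
    · rw [habs] at hlt
      omega
  · rintro ⟨u, p, q, v, h1, h2, h3⟩
    have hlen : u.length + v.length + 2 = n := by
      have := length_word π
      rw [h1] at this
      simp at this
      omega
    have hi := hget ⟨u.length, by omega⟩
    have hj := hget ⟨u.length + 1, by omega⟩
    simp [h1] at hi hj
    refine ⟨⟨u.length, by omega⟩, ⟨u.length + 1, by omega⟩, rfl, ?_, ?_⟩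
    · rw [habs]
      omega
    · exact word_injective (h2.trans (word_mul_swap h1 rfl rfl).symm)

theorem desWord_eq_of_isSwap {n : ℕ} {π σ : Equiv.Perm (Fin n)} (h : IsSwap π σ) :
    desWord (word σ) = desWord (word π) := by
  obtain ⟨u, p, q, v, h1, h2, h3⟩ := isSwap_iff.1 h
  rw [h1, h2]
  ext i
  exact ⟨pair_sublist_swap (by omega), pair_sublist_swap (by omega)⟩

theorem swapClosed_of_eq_union {n : ℕ} {Pi : Set (Equiv.Perm (Fin n))} {J L : Set ℕ}
    (h : Pi = (D n J)⁻¹ ∪ (D n L)⁻¹) : SwapClosed Pi := by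
  intro π hπ σ hσ
  have : desWord (word σ) = desWord (word π) := by
    induction hσ with
    | refl => rfl
    | tail _ h ih => exact (desWord_eq_of_isSwap h).trans ih
  rw [h, Set.mem_union, mem_inv_D_iff, mem_inv_D_iff] at hπ ⊢
  rwa [this]

/-! ### Swap closed sets are pattern-Knuth closed -/

/-- Since y compares with the other letters as x does, it can take over the role of x in an
occurrence of a pattern. -/
theorem exists_map_eq_of_replace {u v : List ℕ} {x y : ℕ} {g : ℕ → ℕ}
    (hn : (u ++ x :: v).Nodup) (hg : StrictMonoOn g {e | e ∈ u ++ x :: v})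
    (hy : y ∉ u ++ x :: v) (h : ∀ e ∈ u ++ v, (e < x ↔ e < y)) :
    ∃ g' : ℕ → ℕ, StrictMonoOn g' {e | e ∈ u ++ y :: v} ∧
      (u ++ y :: v).map g' = (u ++ x :: v).map g := by
  have hm : ∀ e, e ∈ u ++ v → e ∈ u ++ x :: v := by
    intro e he
    simp only [List.mem_append, List.mem_cons] at he ⊢
    tauto
  have hne : ∀ e ∈ u ++ v, e ≠ y ∧ e ≠ x := by
    intro e he
    refine ⟨fun h => hy (h ▸ hm e he), ?_⟩
    rintro rfl
    have := (List.perm_middle (a := e) (l₁ := u) (l₂ := v)).nodup_iff.1 hn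
    exact (List.nodup_cons.1 this).1 he
  refine ⟨fun e => if e = y then g x else g e, ?_, ?_⟩
  · have hxm : x ∈ u ++ x :: v := by simp
    have hmem : ∀ e, e ∈ u ++ y :: v → e = y ∨ e ∈ u ++ v := by
      intro e he
      simp only [List.mem_append, List.mem_cons] at he ⊢
      tauto
    intro c hc d hd hcd
    show (if c = y then g x else g c) < if d = y then g x else g d
    rcases hmem c hc with hcy | hc'
    · rw [if_pos hcy]
      rcases hmem d hd with hdy | hd'
      · omega
      · rw [if_neg (hne d hd').1]
        refine hg hxm (hm d hd') ?_
        have := h d hd'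
        have := (hne d hd').2
        omega
    · rw [if_neg (hne c hc').1]
      rcases hmem d hd with hdy | hd'
      · rw [if_pos hdy]
        exact hg (hm c hc') hxm ((h c hc').2 (hdy ▸ hcd))
      · rw [if_neg (hne d hd').1]
        exact hg (hm c hc') (hm d hd') hcd
  · have hcongr : ∀ l : List ℕ, (∀ e ∈ l, e ∈ u ++ v) →
        l.map (fun e => if e = y then g x else g e) = l.map g := fun l hl =>
      List.map_congr_left fun e he => if_neg (hne e (hl e he)).1
    rw [List.map_append, List.map_append, List.map_cons, List.map_cons, if_pos rfl,
      hcongr u (by simp +contextual), hcongr v (by simp +contextual)]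

/-- A swap closed set containing a permutation contains the one with two letters swapped. -/
theorem SwapClosed.exists_word_eq {k : ℕ} {Pi : Set (Equiv.Perm (Fin k))} (hPi : SwapClosed Pi)
    {π : Equiv.Perm (Fin k)} (hπ : π ∈ Pi) {u v : List ℕ} {p q : ℕ}
    (h : word π = u ++ p :: q :: v) (hpq : p + 1 < q ∨ q + 1 < p) :
    ∃ π' ∈ Pi, word π' = u ++ q :: p :: v := by
  have hW : IsWord k (u ++ q :: p :: v) := by
    refine List.Perm.trans ?_ (isWord_word π)
    rw [h]
    exact List.Perm.append_left _ (List.Perm.swap _ _ _)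
  obtain ⟨π', hπ'⟩ := PatternKnuth.exists_word_eq hW
  have hs : IsSwap π π' := isSwap_iff.2 ⟨u, p, q, v, h, hπ', hpq⟩
  exact ⟨π', hPi π hπ π' (Relation.ReflTransGen.single hs), hπ'⟩

/-- The word contains a pattern from the set. -/
def HasPattern {k : ℕ} (Pi : Set (Equiv.Perm (Fin k))) (w : List ℕ) : Prop :=
  ∃ π ∈ Pi, ∃ (s : List ℕ) (g : ℕ → ℕ), s.Sublist w ∧ StrictMonoOn g {x | x ∈ s} ∧
    s.map g = word π

/-- Interchanging two adjacent letters with an adjacent witness between them preserves the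
containment of a pattern from a swap closed set. -/
theorem HasPattern.swap {k : ℕ} {Pi : Set (Equiv.Perm (Fin k))} (hPi : SwapClosed Pi)
    {a b : List ℕ} {p q y : ℕ} (hn : (a ++ p :: q :: b).Nodup)
    (hy : p < y ∧ y < q ∨ q < y ∧ y < p)
    (hadj : (∃ a', a = a' ++ [y]) ∨ ∃ b', b = y :: b')
    (h : HasPattern Pi (a ++ p :: q :: b)) : HasPattern Pi (a ++ q :: p :: b) := by
  obtain ⟨π, hπ, s, g, hs, hg, hsg⟩ := h
  have hsn : s.Nodup := hn.sublist hs
  obtain ⟨s1, t, rfl, h1, ht⟩ := List.sublist_append_iff.1 hs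
  have ht' : t.Sublist ([p, q] ++ b) := by simpa using ht
  obtain ⟨s2, s3, rfl, h2, h3⟩ := List.sublist_append_iff.1 ht'
  -- An occurrence that does not use both p and q survives the exchange unchanged.
  by_cases hs2 : s2 = [p, q]
  swap
  · refine ⟨π, hπ, _, g, ?_, hg, hsg⟩
    have h4 : s2.Sublist [q, p] := by
      have := List.mem_sublists.2 h2
      simp [List.sublists] at this
      rcases this with rfl | rfl | rfl | rfl
      · simp
      · simp
      · simp
      · exact absurd rfl hs2
    have := h1.append (h4.append h3)
    simpa using this
  subst hs2
  simp only [List.cons_append, List.nil_append] at hg hsg hsn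
  -- A letter of the occurrence between p and q in value separates g p from g q by more than 1, so
  -- the exchanged occurrence has a pattern from the swap closed set.
  by_cases hbet : ∃ e ∈ s1 ++ p :: q :: s3, p < e ∧ e < q ∨ q < e ∧ e < p
  · obtain ⟨e, he, hpq⟩ := hbet
    have hpm : p ∈ s1 ++ p :: q :: s3 := by simp
    have hqm : q ∈ s1 ++ p :: q :: s3 := by simp
    have hword : word π = s1.map g ++ g p :: g q :: s3.map g := by rw [← hsg]; simp
    have hgap : g p + 1 < g q ∨ g q + 1 < g p := by
      rcases hpq with ⟨h4, h5⟩ | ⟨h4, h5⟩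
      · have h6 : g p < g e := hg hpm he h4
        have h7 : g e < g q := hg he hqm h5
        omega
      · have h6 : g q < g e := hg hqm he h4
        have h7 : g e < g p := hg he hpm h5
        omega
    obtain ⟨π', hπ'Pi, hπ'⟩ := hPi.exists_word_eq hπ hword hgap
    refine ⟨π', hπ'Pi, s1 ++ q :: p :: s3, g, ?_, ?_, ?_⟩
    · have := h1.append ((List.Sublist.refl [q, p]).append h3)
      simpa using this
    · refine hg.mono fun x hx => ?_
      exact (List.Perm.mem_iff (List.Perm.append_left s1 (List.Perm.swap p q s3))).1 hx
    · rw [hπ']; simp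
  -- Otherwise y is not in the occurrence, and no other letter of it separates p, q and y. Together
  -- with one of p, q, the witness forms a pair in the right order in the new word.
  push Not at hbet
  have hys : y ∉ s1 ++ p :: q :: s3 := fun h => by
    have := hbet y h
    omega
  have hcmp : ∀ e, e ∈ s1 ++ p :: q :: s3 → e ≠ p → e ≠ q →
      (e < p ↔ e < y) ∧ (e < q ↔ e < y) := by
    intro e he hep heq
    have := hbet e he
    omega
  have hne : p ≠ q ∧ ∀ e ∈ s1 ++ s3, e ≠ p ∧ e ≠ q := by
    refine ⟨by omega, fun e he => ?_⟩
    have h4 : (p :: q :: (s1 ++ s3)).Nodup := by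
      refine List.Perm.nodup_iff ?_ |>.1 hsn
      exact List.perm_middle.trans (List.Perm.cons p List.perm_middle)
    rw [List.nodup_cons, List.nodup_cons] at h4
    constructor
    · rintro rfl; exact h4.1 (List.mem_cons_of_mem _ he)
    · rintro rfl; exact h4.2.1 he
  rcases hadj with ⟨a', rfl⟩ | ⟨b', rfl⟩
  · -- the witness replaces `p`
    have h1' : s1.Sublist a' := by
      obtain ⟨r1, r2, rfl, hr1, hr2⟩ := List.sublist_append_iff.1 h1
      rcases List.sublist_singleton.1 hr2 with rfl | rfl
      · simpa using hr1
      · simp at hys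
    obtain ⟨g', hg', hmap⟩ := exists_map_eq_of_replace hsn hg hys (fun e he => by
      rcases List.mem_append.1 he with he | he
      · exact (hcmp e (by simp [he]) (hne.2 e (by simp [he])).1 (hne.2 e (by simp [he])).2).1
      · rcases List.mem_cons.1 he with rfl | he
        · omega
        · exact (hcmp e (by simp [he]) (hne.2 e (by simp [he])).1 (hne.2 e (by simp [he])).2).1)
    refine ⟨π, hπ, s1 ++ y :: q :: s3, g', ?_, hg', hmap.trans hsg⟩
    have := (h1'.append (List.Sublist.refl [y])).append
      (((List.Sublist.refl [q]).trans (List.sublist_append_left [q] [p])).append h3)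
    simpa using this
  · -- the witness replaces `q`
    have h3' : s3.Sublist b' := by
      rcases List.sublist_cons_iff.1 h3 with h | ⟨r, rfl, -⟩
      · exact h
      · simp at hys
    have e1 : ∀ z, s1 ++ p :: z :: s3 = (s1 ++ [p]) ++ z :: s3 := fun z => by simp
    rw [e1] at hsn hg hys hsg
    obtain ⟨g', hg', hmap⟩ := exists_map_eq_of_replace hsn hg hys (fun e he => by
      rw [List.append_assoc, List.singleton_append, List.mem_append] at he
      rcases he with he | he
      · exact (hcmp e (by simp [he]) (hne.2 e (by simp [he])).1 (hne.2 e (by simp [he])).2).2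
      · rcases List.mem_cons.1 he with rfl | he
        · omega
        · exact (hcmp e (by simp [he]) (hne.2 e (by simp [he])).1 (hne.2 e (by simp [he])).2).2)
    refine ⟨π, hπ, (s1 ++ [p]) ++ y :: s3, g', ?_, hg', hmap.trans hsg⟩
    have := h1.append ((List.sublist_append_right [q] [p]).append
      ((List.Sublist.refl [y]).append h3'))
    simpa using this

theorem KStep.hasPattern {k : ℕ} {Pi : Set (Equiv.Perm (Fin k))} (hPi : SwapClosed Pi)
    {w v : List ℕ} (h : KStep w v) (hw : w.Nodup) : HasPattern Pi w ↔ HasPattern Pi v := by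
  have hv : v.Nodup := (KE.of_step h).perm.nodup_iff.1 hw
  cases h with
  | left a b hxy hyz =>
    rename_i x y z
    have e : ∀ c d : ℕ, a ++ y :: c :: d :: b = (a ++ [y]) ++ c :: d :: b := fun c d => by simp
    rw [e] at hw hv ⊢
    rw [e]
    exact ⟨fun h => h.swap hPi hw (y := y) (by omega) (.inl ⟨a, rfl⟩),
      fun h => h.swap hPi hv (y := y) (by omega) (.inl ⟨a, rfl⟩)⟩
  | right a b hxy hyz =>
    rename_i x y z
    exact ⟨fun h => h.swap hPi hw (y := y) (by omega) (.inr ⟨b, rfl⟩),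
      fun h => h.swap hPi hv (y := y) (by omega) (.inr ⟨b, rfl⟩)⟩

theorem KE.hasPattern {k : ℕ} {Pi : Set (Equiv.Perm (Fin k))} (hPi : SwapClosed Pi)
    {w v : List ℕ} (h : KE w v) : w.Nodup → (HasPattern Pi w ↔ HasPattern Pi v) := by
  induction h with
  | rel _ _ h => exact fun hw => h.hasPattern hPi hw
  | refl _ => exact fun _ => Iff.rfl
  | symm _ _ h ih => exact fun hw => (ih ((KE.perm h).nodup_iff.2 hw)).symm
  | trans _ _ _ h _ ih ih' =>
    exact fun hw => (ih hw).trans (ih' ((KE.perm h).nodup_iff.1 hw))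

theorem patternKnuthClosed_of_swapClosed {k : ℕ} {Pi : Set (Equiv.Perm (Fin k))}
    (hPi : SwapClosed Pi) : PatternKnuthClosed Pi := by
  intro m
  have key : ∀ σ : Equiv.Perm (Fin m), σ ∈ avoiders m Pi ↔ ¬ HasPattern Pi (word σ) := by
    intro σ
    simp only [avoiders, Set.mem_ofPred_eq, contains_iff, HasPattern]
    push Not
    exact Iff.rfl
  refine isUnion_of_ke fun σ σ' h hσ => ?_
  rw [key] at hσ ⊢
  rwa [← h.hasPattern hPi (isWord_word σ).nodup]

/-! ### Tableaux with a given descent set -/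

namespace SYT

variable {n : ℕ}

theorem eq_of_mem_rows_iff {S T : SYT n}
    (h : ∀ i x, x ∈ S.rows.getD i [] ↔ x ∈ T.rows.getD i []) : S = T := by
  have hs : ∀ (U : SYT n) i, (U.rows.getD i []).Pairwise (· < ·) := by
    intro U i
    rw [getD_rows, List.pairwise_map]
    refine List.pairwise_iff_getElem.2 fun j k hj hk hjk => ?_
    simp only [List.getElem_range, List.length_range] at hk ⊢
    exact U.row_strict hjk (YoungDiagram.mem_iff_lt_rowLen.2 hk)
  have he : ∀ i, S.rows.getD i [] = T.rows.getD i [] :=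
    fun i => (hs S i).eq_of_mem_iff (hs T i) (h i)
  have hl : ∀ i, S.shape.rowLen i = T.shape.rowLen i := by
    intro i
    simpa only [getD_rows, List.length_map, List.length_range] using congrArg List.length (he i)
  have hm : ∀ i j, (i, j) ∈ S.shape ↔ (i, j) ∈ T.shape := by
    intro i j
    rw [YoungDiagram.mem_iff_lt_rowLen, YoungDiagram.mem_iff_lt_rowLen, hl]
  refine ext_tab hm fun i j hij => ?_
  have := he i
  rw [getD_rows, getD_rows, hl, List.map_inj_left] at this
  exact this j (List.mem_range.2 (YoungDiagram.mem_iff_lt_rowLen.1 ((hm i j).1 hij)))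

theorem transpose_injective {S T : SYT n} (h : S.transpose = T.transpose) : S = T := by
  have hm : ∀ i j, (i, j) ∈ S.shape ↔ (i, j) ∈ T.shape := by
    intro i j
    have h1 : (j, i) ∈ S.transpose.shape ↔ (j, i) ∈ T.transpose.shape := by rw [h]
    simpa [transpose, YoungDiagram.mem_transpose] using h1
  refine ext_tab hm fun i j _ => ?_
  have : ∀ U : SYT n, U.tab i j = U.transpose.tab j i := fun U => rfl
  rw [this, this, h]

theorem transpose_transpose (S : SYT n) : S.transpose.transpose = S := by
  refine ext_tab (fun i j => ?_) fun i j _ => rfl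
  simp [transpose]

theorem mem_transpose {S : SYT n} {i j : ℕ} :
    (i, j) ∈ S.transpose.shape ↔ (j, i) ∈ S.shape := by
  simp [transpose, YoungDiagram.mem_transpose]

theorem tab_lt_tab (S : SYT n) {i j k l : ℕ} (h : (k, l) ∈ S.shape) (hik : i ≤ k) (hjl : j ≤ l)
    (hne : i < k ∨ j < l) : S.tab i j < S.tab k l := by
  have h1 := S.shape.up_left_mem hik le_rfl h
  rcases hik.eq_or_lt with rfl | hik
  · exact S.row_strict (by omega) h
  · refine lt_of_le_of_lt ?_ (S.tab.col_strict hik h)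
    rcases hjl.eq_or_lt with rfl | hjl
    · exact le_rfl
    · exact (S.row_strict hjl h1).le

theorem des_subset (S : SYT n) {x : ℕ} (hx : x ∈ S.des) : 1 ≤ x ∧ x < n := by
  obtain ⟨i, j, k, l, h1, h2, rfl, h3, -⟩ := hx
  have := S.tab_mem h1
  have := S.tab_mem h2
  omega

/-- The entry x+1 lies strictly below x or strictly to its right. If both held, the cell in the row
of x and the column of x+1 would contain an entry strictly between them; if neither held, x+1 would
not exceed x. -/
theorem des_transpose (S : SYT n) : S.transpose.des = Set.Icc 1 (n - 1) \ S.des := by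
  ext x
  by_cases hx : 1 ≤ x ∧ x < n
  swap
  · refine iff_of_false (fun h => hx (S.transpose.des_subset h)) fun h => hx ?_
    have := h.1
    simp only [Set.mem_Icc] at this
    omega
  obtain ⟨i, j, hij, hx1⟩ := S.exists_cell hx.1 hx.2.le
  obtain ⟨k, l, hkl, hx2⟩ := S.exists_cell (x := x + 1) (by omega) (by omega)
  have h1 : x ∈ S.transpose.des ↔ j < l := by
    constructor
    · rintro ⟨i', j', k', l', h1, h2, h3, h4, h5⟩
      have h3' : S.tab j' i' = x := h3
      have h4' : S.tab l' k' = x + 1 := h4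
      have h6 := S.tab_inj (mem_transpose.1 h1) hij (by omega)
      have h7 := S.tab_inj (mem_transpose.1 h2) hkl (by omega)
      omega
    · exact fun h => ⟨j, i, l, k, mem_transpose.2 hij, mem_transpose.2 hkl, hx1, hx2, h⟩
  have h2 : x ∈ S.des ↔ i < k := by
    constructor
    · rintro ⟨i', j', k', l', h1, h2, h3, h4, h5⟩
      have h6 := S.tab_inj h1 hij (by omega)
      have h7 := S.tab_inj h2 hkl (by omega)
      omega
    · exact fun h => ⟨i, j, k, l, hij, hkl, hx1, hx2, h⟩
  rw [h1, Set.mem_sdiff, h2, Set.mem_Icc]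
  constructor
  · intro hjl
    refine ⟨by omega, fun hik => ?_⟩
    have := S.tab_lt_tab hkl hik.le le_rfl (.inl hik) (j := l)
    have := S.tab_lt_tab (S.shape.up_left_mem hik.le le_rfl hkl) le_rfl hjl.le (.inr hjl)
    omega
  · rintro ⟨-, hik⟩
    by_contra hjl
    have : (i, j) = (k, l) ∨ S.tab k l < S.tab i j := by
      by_cases he : i = k ∧ j = l
      · simp [he]
      · exact .inr (S.tab_lt_tab hij (by omega) (by omega) (by omega))
    rcases this with h | h
    · simp only [Prod.mk.injEq] at h
      rw [h.1, h.2] at hx1; omega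
    · omega

end SYT

/-! ### The explicit tableaux and their descent sets -/

theorem isTab_map_singleton {l : List ℕ} (h : l.Pairwise (· < ·)) :
    IsTab (l.map fun x => [x]) := by
  induction l with
  | nil => trivial
  | cons a l ih =>
    rw [List.pairwise_cons] at h
    refine ⟨by simp, by simp, ?_, ih h.2⟩
    cases l with
    | nil => simp
    | cons b l => simpa [Dom] using h.1 b (by simp)

theorem rowWord_map_singleton (l : List ℕ) : rowWord (l.map fun x => [x]) = l.reverse := by
  induction l with
  | nil => rfl
  | cons a l ih => simp [rowWord_cons, ih]

theorem noPattern_of_isHookDescentSet {n : ℕ} {J : Set ℕ} (h : IsHookDescentSet n J) :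
    NoPattern J n := by
  intro i j m h1 h2 h3 h4 h5
  rcases h with ⟨k, hk, rfl⟩ | ⟨k, hk, hk', rfl⟩ <;> simp only [Set.mem_Icc] at * <;> omega

/-- Membership in such a descent set changes at most once, so every letter satisfies `Ext` and the
class is that of the V-shaped word. -/
theorem SYT.eq_of_des_eq {n : ℕ} {S T : SYT n} (hS : IsHookDescentSet n S.des)
    (hST : S.des = T.des) : S = T := by
  have key : ∀ U : SYT n, U.des = S.des → KE (rowWord U.rows) (vWord S.des n) := by
    intro U hU
    have hw := U.isWord_rowWord
    have := ke_vWord hw (fun k h1 h2 => ext_of_noPattern hw h1 h2 ?_) n le_rfl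
    · rwa [U.desWord_rowWord, hU, trunc_eq_self fun x hx => (hw.mem_iff.1 hx).2] at this
    · rw [U.desWord_rowWord, hU]
      intro i j m h3 h4 h5 h6
      exact noPattern_of_isHookDescentSet hS i j m h3 h4 h5 (by omega)
  exact SYT.eq_of_ke ((key S rfl).trans (key T hST.symm).symm)

theorem isTab_hookRows {n k : ℕ} (h1 : 1 ≤ k) : IsTab
    (List.range' 1 k :: (List.range' (k + 1) (n - k)).map fun x => [x]) := by
  refine ⟨by simp; omega, List.pairwise_lt_range', ?_,
    isTab_map_singleton List.pairwise_lt_range'⟩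
  obtain ⟨k, rfl⟩ : ∃ j, k = j + 1 := ⟨k - 1, by omega⟩
  cases n - (k + 1) <;> simp [List.range'_succ, Dom]

theorem isTab_first_left {n k : ℕ} (h1 : 2 ≤ k) (h2 : k + 2 ≤ n) : IsTab
    ((List.range' 1 k ++ [n]) :: (List.range' (k + 1) (n - 1 - k)).map fun x => [x]) := by
  refine ⟨by simp, ?_, ?_, isTab_map_singleton List.pairwise_lt_range'⟩
  · rw [List.pairwise_append]
    exact ⟨List.pairwise_lt_range', by simp, by simp; omega⟩
  · obtain ⟨k, rfl⟩ : ∃ j, k = j + 1 := ⟨k - 1, by omega⟩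
    cases n - 1 - (k + 1) <;> simp [List.range'_succ, Dom]

theorem isTab_first_right {n k : ℕ} (h1 : 2 ≤ k) (h2 : k + 2 ≤ n) : IsTab
    (List.range' 1 k :: [k + 1, n] :: (List.range' (k + 2) (n - 2 - k)).map fun x => [x]) := by
  refine ⟨by simp; omega, List.pairwise_lt_range', ?_, by simp, by simp; omega, ?_,
    isTab_map_singleton List.pairwise_lt_range'⟩
  · obtain ⟨k, rfl⟩ : ∃ j, k = j + 2 := ⟨k - 2, by omega⟩
    simp [List.range'_succ, Dom]; omega
  · cases n - 2 - k <;> simp [List.range'_succ, Dom]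

theorem isTab_second_left {n k : ℕ} (h1 : 4 ≤ k) : IsTab
    ((1 :: 2 :: List.range' k (n + 1 - k)) ::
      (List.range' 3 (k - 3)).map fun x => [x]) := by
  refine ⟨by simp, ?_, ?_, isTab_map_singleton List.pairwise_lt_range'⟩
  · simp only [List.pairwise_cons, List.mem_cons, List.mem_range'_1, forall_eq_or_imp]
    exact ⟨⟨by omega, fun a _ => by omega⟩, fun a _ => by omega, List.pairwise_lt_range'⟩
  · cases k - 3 <;> simp [List.range'_succ, Dom]

theorem isTab_second_right {n k : ℕ} (h1 : 4 ≤ k) : IsTab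
    ((1 :: 2 :: List.range' (k + 1) (n - k)) :: [3, k] ::
      (List.range' 4 (k - 4)).map fun x => [x]) := by
  refine ⟨by simp, ?_, ?_, by simp, by simp; omega, ?_,
    isTab_map_singleton List.pairwise_lt_range'⟩
  · simp only [List.pairwise_cons, List.mem_cons, List.mem_range'_1, forall_eq_or_imp]
    exact ⟨⟨by omega, fun a _ => by omega⟩, fun a _ => by omega, List.pairwise_lt_range'⟩
  · simp [Dom]; omega
  · cases k - 4 <;> simp [List.range'_succ, Dom]

theorem isWord_hookRows {n k : ℕ} (h1 : 1 ≤ k) (h2 : k ≤ n) : IsWord n (rowWord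
    (List.range' 1 k :: (List.range' (k + 1) (n - k)).map fun x => [x])) := by
  rw [rowWord_cons, rowWord_map_singleton]
  refine IsWord.of_nodup ?_ fun x => ?_
  · simp [List.nodup_append, List.nodup_range']; omega
  · simp only [List.mem_append, List.mem_reverse, List.mem_range'_1]; omega

theorem isWord_first_left {n k : ℕ} (h1 : 2 ≤ k) (h2 : k + 2 ≤ n) : IsWord n (rowWord
    ((List.range' 1 k ++ [n]) :: (List.range' (k + 1) (n - 1 - k)).map fun x => [x])) := by
  rw [rowWord_cons, rowWord_map_singleton]
  refine IsWord.of_nodup ?_ fun x => ?_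
  · simp [List.nodup_append, List.nodup_range']; grind
  · simp only [List.mem_append, List.mem_reverse, List.mem_range'_1, List.mem_singleton]; omega

theorem isWord_first_right {n k : ℕ} (h1 : 2 ≤ k) (h2 : k + 2 ≤ n) : IsWord n (rowWord
    (List.range' 1 k :: [k + 1, n] ::
      (List.range' (k + 2) (n - 2 - k)).map fun x => [x])) := by
  rw [rowWord_cons, rowWord_cons, rowWord_map_singleton]
  refine IsWord.of_nodup ?_ fun x => ?_
  · simp [List.nodup_append, List.nodup_range']; grind
  · simp only [List.mem_append, List.mem_reverse, List.mem_range'_1, List.mem_cons,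
      List.not_mem_nil, or_false]
    omega

theorem isWord_second_left {n k : ℕ} (h1 : 4 ≤ k) (h2 : k ≤ n) : IsWord n (rowWord
    ((1 :: 2 :: List.range' k (n + 1 - k)) :: (List.range' 3 (k - 3)).map fun x => [x])) := by
  rw [rowWord_cons, rowWord_map_singleton]
  refine IsWord.of_nodup ?_ fun x => ?_
  · simp [List.nodup_append, List.nodup_range']; grind
  · simp only [List.mem_append, List.mem_reverse, List.mem_range'_1, List.mem_cons]; omega

theorem isWord_second_right {n k : ℕ} (h1 : 4 ≤ k) (h2 : k ≤ n) : IsWord n (rowWord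
    ((1 :: 2 :: List.range' (k + 1) (n - k)) :: [3, k] ::
      (List.range' 4 (k - 4)).map fun x => [x])) := by
  rw [rowWord_cons, rowWord_cons, rowWord_map_singleton]
  refine IsWord.of_nodup ?_ fun x => ?_
  · simp [List.nodup_append, List.nodup_range']; grind
  · simp only [List.mem_append, List.mem_reverse, List.mem_range'_1, List.mem_cons,
      List.not_mem_nil, or_false]
    omega

theorem desWord_hookRows {n k : ℕ} (h1 : 1 ≤ k) (h2 : k ≤ n) : desWord (rowWord
    (List.range' 1 k :: (List.range' (k + 1) (n - k)).map fun x => [x])) =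
      Set.Icc k (n - 1) := by
  rw [rowWord_cons, rowWord_map_singleton]
  ext i
  simp only [desWord, Set.mem_ofPred_eq, pair_sublist_append, pair_sublist_range',
    pair_sublist_range'_reverse, List.mem_reverse, List.mem_range'_1, Set.mem_Icc]
  omega

theorem desWord_first_left {n k : ℕ} (h1 : 2 ≤ k) (h2 : k + 2 ≤ n) : desWord (rowWord
    ((List.range' 1 k ++ [n]) :: (List.range' (k + 1) (n - 1 - k)).map fun x => [x])) =
      Set.Icc k (n - 2) := by
  rw [rowWord_cons, rowWord_map_singleton]
  ext i
  simp only [desWord, Set.mem_ofPred_eq, pair_sublist_append, pair_sublist_cons,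
    pair_sublist_range', pair_sublist_range'_reverse, List.mem_append, List.mem_cons,
    List.mem_reverse, List.mem_range'_1, List.not_mem_nil, or_false, List.sublist_nil,
    reduceCtorEq, and_false, false_or, Set.mem_Icc]
  omega

theorem desWord_first_right {n k : ℕ} (h1 : 2 ≤ k) (h2 : k + 2 ≤ n) : desWord (rowWord
    (List.range' 1 k :: [k + 1, n] ::
      (List.range' (k + 2) (n - 2 - k)).map fun x => [x])) = Set.Icc k (n - 2) := by
  rw [rowWord_cons, rowWord_cons, rowWord_map_singleton]
  ext i
  simp only [desWord, Set.mem_ofPred_eq, pair_sublist_append, pair_sublist_cons,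
    pair_sublist_range', pair_sublist_range'_reverse, List.mem_append, List.mem_cons,
    List.mem_reverse, List.mem_range'_1, List.not_mem_nil, or_false, List.sublist_nil,
    reduceCtorEq, and_false, false_or, Set.mem_Icc]
  omega

theorem desWord_second_left {n k : ℕ} (h1 : 4 ≤ k) : desWord (rowWord
    ((1 :: 2 :: List.range' k (n + 1 - k)) :: (List.range' 3 (k - 3)).map fun x => [x])) =
      Set.Icc 2 (k - 2) := by
  rw [rowWord_cons, rowWord_map_singleton]
  ext i
  simp only [desWord, Set.mem_ofPred_eq, pair_sublist_append, pair_sublist_cons,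
    pair_sublist_range', pair_sublist_range'_reverse, List.mem_cons,
    List.mem_reverse, List.mem_range'_1, Set.mem_Icc]
  omega

theorem desWord_second_right {n k : ℕ} (h1 : 4 ≤ k) (h2 : k ≤ n) : desWord (rowWord
    ((1 :: 2 :: List.range' (k + 1) (n - k)) :: [3, k] ::
      (List.range' 4 (k - 4)).map fun x => [x])) = Set.Icc 2 (k - 2) := by
  rw [rowWord_cons, rowWord_cons, rowWord_map_singleton]
  ext i
  simp only [desWord, Set.mem_ofPred_eq, pair_sublist_append, pair_sublist_cons,
    pair_sublist_range', pair_sublist_range'_reverse, List.mem_append, List.mem_cons,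
    List.mem_reverse, List.mem_range'_1, List.not_mem_nil, or_false, List.sublist_nil,
    reduceCtorEq, and_false, false_or, Set.mem_Icc]
  omega

/-! ### At most two tableaux share a descent set of pair type -/

namespace SYT

variable {n : ℕ}

/-- The entry `x` lies in row `i`. -/
def InRow (S : SYT n) (x i : ℕ) : Prop := ∃ j, (i, j) ∈ S.shape ∧ S.tab i j = x

theorem exists_inRow (S : SYT n) {x : ℕ} (h1 : 1 ≤ x) (h2 : x ≤ n) : ∃ i, S.InRow x i :=
  (S.exists_cell h1 h2).imp fun _ h => h

theorem inRow_unique {S : SYT n} {x i k : ℕ} (h : S.InRow x i) (h' : S.InRow x k) :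
    i = k := by
  obtain ⟨j, h1, h2⟩ := h
  obtain ⟨l, h3, h4⟩ := h'
  exact (S.tab_inj h1 h3 (h2.trans h4.symm)).1

theorem lt_of_mem_des {S : SYT n} {x i k : ℕ} (hx : x ∈ S.des) (h : S.InRow x i)
    (h' : S.InRow (x + 1) k) : i < k := by
  obtain ⟨a, b, c, d, h1, h2, h3, h4, h5⟩ := hx
  have := inRow_unique h ⟨b, h1, h3⟩
  have := inRow_unique h' ⟨d, h2, h4⟩
  omega

theorem le_of_notMem_des {S : SYT n} {x i k : ℕ} (hx : x ∉ S.des) (h : S.InRow x i)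
    (h' : S.InRow (x + 1) k) : k ≤ i := by
  obtain ⟨j, h1, h2⟩ := h
  obtain ⟨l, h3, h4⟩ := h'
  exact not_lt.1 fun hc => hx ⟨i, j, k, l, h1, h3, h2, h4, hc⟩

theorem exists_inRow_pred {S : SYT n} {x i : ℕ} (h : S.InRow x (i + 1)) :
    ∃ y, 1 ≤ y ∧ y < x ∧ S.InRow y i := by
  obtain ⟨j, h1, rfl⟩ := h
  have h2 := S.shape.up_left_mem (Nat.le_succ i) (le_refl j) h1
  exact ⟨S.tab i j, (S.tab_mem h2).1, S.tab.col_strict (Nat.lt_succ_self i) h1, j, h2, rfl⟩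

/-- Two entries of a row have two smaller entries above them. -/
theorem exists_inRow_pred_pair {S : SYT n} {x y i : ℕ} (hxy : x < y) (hx : S.InRow x (i + 1))
    (hy : S.InRow y (i + 1)) :
    ∃ a b, 1 ≤ a ∧ a < b ∧ b < y ∧ S.InRow a i ∧ S.InRow b i := by
  obtain ⟨j, h1, rfl⟩ := hx
  obtain ⟨l, h2, rfl⟩ := hy
  have hjl : j < l := by
    by_contra hc
    rcases (not_lt.1 hc).eq_or_lt with rfl | hc
    · omega
    · have := S.row_strict hc h1; omega
  have h3 := S.shape.up_left_mem (Nat.le_succ i) (le_refl l) h2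
  have h4 := S.shape.up_left_mem (le_refl i) hjl.le h3
  exact ⟨S.tab i j, S.tab i l, (S.tab_mem h4).1, S.row_strict hjl h3,
    S.tab.col_strict (Nat.lt_succ_self i) h2, ⟨j, h4, rfl⟩, ⟨l, h3, rfl⟩⟩

theorem inRow_of_le {S : SYT n} {k : ℕ} (hk : ∀ x ∈ S.des, k ≤ x) {x : ℕ} (h1 : 1 ≤ x)
    (h2 : x ≤ k) (h3 : x ≤ n) : S.InRow x 0 := by
  induction x, h1 using Nat.le_induction with
  | base =>
    obtain ⟨i, hi⟩ := S.exists_inRow le_rfl h3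
    cases i with
    | zero => exact hi
    | succ i => obtain ⟨y, h4, h5, -⟩ := exists_inRow_pred hi; omega
  | succ x h1 ih =>
    obtain ⟨i, hi⟩ := S.exists_inRow (x := x + 1) (by omega) h3
    have := le_of_notMem_des (fun h => by have := hk x h; omega) (ih (by omega) (by omega)) hi
    rwa [show i = 0 by omega] at hi

/-- The entries after `1, …, k` go down one row at a time as long as they are descents. -/
theorem inRow_add {S : SYT n} {k m : ℕ} (hk1 : 1 ≤ k) (hk : ∀ x ∈ S.des, k ≤ x)
    (hm : ∀ x, k ≤ x → x < m → x ∈ S.des) (hmn : m ≤ n) {t : ℕ} (ht : k + t ≤ m) :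
    S.InRow (k + t) t := by
  induction t using Nat.strong_induction_on with
  | _ t ih =>
    rcases t with _ | t
    · exact inRow_of_le hk hk1 le_rfl (by omega)
    obtain ⟨i, hi⟩ := S.exists_inRow (x := k + (t + 1)) (by omega) (by omega)
    have h1 := lt_of_mem_des (hm (k + t) (by omega) (by omega)) (ih t (by omega) (by omega)) hi
    rcases i with _ | i
    · omega
    obtain ⟨y, h2, h3, h4⟩ := exists_inRow_pred hi
    have h5 : i ≤ t := by
      by_cases hy : y ≤ k
      · have := inRow_unique h4 (inRow_of_le hk h2 hy (by omega)); omega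
      · have := ih (y - k) (by omega) (by omega)
        rw [show k + (y - k) = y by omega] at this
        have := inRow_unique h4 this; omega
    rwa [show i + 1 = t + 1 by omega] at hi

/-- Rows are numbered from 0. The entry k+t lies in row t for k+t < n, and n is not below n-1. If n
were in row i+1 with i ≥ 1, it would share that row with k+i+1, so row i would contain two entries
less than n; but k+i is the only one. -/
theorem inRow_last {S : SYT n} {k : ℕ} (h1 : 1 ≤ k) (h2 : k + 2 ≤ n)
    (hS : S.des = Set.Icc k (n - 2)) {i : ℕ} (hi : S.InRow n i) : i < 2 := by
  have hk : ∀ x ∈ S.des, k ≤ x := fun x hx => by rw [hS] at hx; exact hx.1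
  have hadd : ∀ t, k + t ≤ n - 1 → S.InRow (k + t) t := fun t ht => inRow_add h1 hk
    (fun x h3 h4 => by rw [hS, Set.mem_Icc]; omega) (by omega) ht
  have h3 := hadd (n - 1 - k) (by omega)
  rw [show k + (n - 1 - k) = n - 1 by omega] at h3
  have h4 := le_of_notMem_des (k := i) (by rw [hS, Set.mem_Icc]; omega) h3
    (by rwa [show n - 1 + 1 = n by omega])
  by_contra hc
  obtain ⟨i, rfl⟩ : ∃ j, i = j + 1 := ⟨i - 1, by omega⟩
  obtain ⟨a, b, h5, h6, h7, h8, h9⟩ :=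
    exists_inRow_pred_pair (by omega) (hadd (i + 1) (by omega)) hi
  have key : ∀ y, 1 ≤ y → y < n → S.InRow y i → y = k + i := by
    intro y hy hyn hyi
    by_cases hyk : y ≤ k
    · have := inRow_unique hyi (inRow_of_le hk hy hyk (by omega)); omega
    · have := hadd (y - k) (by omega)
      rw [show k + (y - k) = y by omega] at this
      have := inRow_unique hyi this; omega
  have := key a h5 (by omega) h8
  have := key b (by omega) h7 h9
  omega

/-- The row of every entry x < n is forced to be x-k (truncated subtraction), and the contents of
the rows determine a standard tableau. -/
theorem eq_of_inRow {S T : SYT n} {k : ℕ} (h1 : 1 ≤ k) (h2 : k + 2 ≤ n)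
    (hS : S.des = Set.Icc k (n - 2)) (hT : T.des = Set.Icc k (n - 2)) {i : ℕ}
    (hSi : S.InRow n i) (hTi : T.InRow n i) : S = T := by
  have key : ∀ U : SYT n, U.des = Set.Icc k (n - 2) → ∀ x, 1 ≤ x → x < n →
      U.InRow x (x - k) := by
    intro U hU x hx hxn
    have hk : ∀ x ∈ U.des, k ≤ x := fun x hx => by rw [hU] at hx; exact hx.1
    by_cases hxk : x ≤ k
    · rw [show x - k = 0 by omega]; exact inRow_of_le hk hx hxk hxn.le
    · have := inRow_add (S := U) (m := n - 1) (t := x - k) h1 hk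
        (fun x h3 h4 => by rw [hU, Set.mem_Icc]; omega) (by omega) (by omega)
      rwa [show k + (x - k) = x by omega] at this
  have main : ∀ U V : SYT n, U.des = Set.Icc k (n - 2) → V.des = Set.Icc k (n - 2) →
      U.InRow n i → V.InRow n i → ∀ r x, U.InRow x r → V.InRow x r := by
    intro U V hU hV hUi hVi r x hx
    obtain ⟨j, hj, rfl⟩ := id hx
    obtain ⟨h3, h4⟩ := U.tab_mem hj
    rcases h4.eq_or_lt with h4 | h4
    · rw [h4] at hx ⊢; rwa [inRow_unique hx hUi]
    · have h5 := key V hV _ h3 h4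
      rwa [← inRow_unique hx (key U hU _ h3 h4)] at h5
  refine eq_of_mem_rows_iff fun r x => ?_
  rw [mem_getD_rows, mem_getD_rows]
  exact ⟨main S T hS hT hSi hTi r x, main T S hT hS hTi hSi r x⟩

theorem eq_or_eq_of_des_first {S T U : SYT n} {k : ℕ} (h1 : 2 ≤ k) (h2 : k + 2 ≤ n)
    (hST : S ≠ T) (hS : S.des = Set.Icc k (n - 2)) (hT : T.des = Set.Icc k (n - 2))
    (hU : U.des = Set.Icc k (n - 2)) : U = S ∨ U = T := by
  have h1 : 1 ≤ k := by omega
  obtain ⟨a, ha⟩ := S.exists_inRow (x := n) (by omega) le_rfl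
  obtain ⟨b, hb⟩ := T.exists_inRow (x := n) (by omega) le_rfl
  obtain ⟨c, hc⟩ := U.exists_inRow (x := n) (by omega) le_rfl
  have := inRow_last h1 h2 hS ha
  have := inRow_last h1 h2 hT hb
  have := inRow_last h1 h2 hU hc
  have hab : a ≠ b := fun h => hST (eq_of_inRow h1 h2 hS hT ha (h ▸ hb))
  rcases (show c = a ∨ c = b by omega) with rfl | rfl
  · exact .inl (eq_of_inRow h1 h2 hU hS hc ha)
  · exact .inr (eq_of_inRow h1 h2 hU hT hc hb)

/-- Reversing and complementing the words of a tableau class: the evacuation involution. -/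
theorem exists_evac (S : SYT n) : ∃ T : SYT n, KE (revComp n (rowWord S.rows)) (rowWord T.rows) :=
  exists_ke S.isWord_rowWord.revComp

theorem des_evac {S T : SYT n} (h : KE (revComp n (rowWord S.rows)) (rowWord T.rows)) {x : ℕ}
    (h1 : 1 ≤ x) (h2 : x < n) : x ∈ T.des ↔ n - x ∈ S.des := by
  rw [← T.desWord_rowWord, ← h.desWord_eq S.isWord_rowWord.revComp.nodup,
    desWord_revComp S.isWord_rowWord h1 h2, S.desWord_rowWord]

theorem evac_injective {S S' T : SYT n} (h : KE (revComp n (rowWord S.rows)) (rowWord T.rows))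
    (h' : KE (revComp n (rowWord S'.rows)) (rowWord T.rows)) : S = S' := by
  have hle : ∀ U : SYT n, ∀ x ∈ rowWord U.rows, x ≤ n + 1 :=
    fun U x hx => (U.isWord_rowWord.mem_iff.1 hx).2.trans (Nat.le_succ n)
  have h1 := (h.trans h'.symm).revComp (n := n) fun x hx =>
    (S.isWord_rowWord.revComp.mem_iff.1 hx).2.trans (Nat.le_succ n)
  rw [revComp_revComp (hle S), revComp_revComp (hle S')] at h1
  exact eq_of_ke h1

/-- Evacuation replaces a descent x by n-x and so turns [2,k-2] into [n+2-k,n-2], a descent set of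
the first kind. -/
theorem eq_or_eq_of_des_second {S T U : SYT n} {k : ℕ} (h1 : 4 ≤ k) (h2 : k ≤ n)
    (hST : S ≠ T) (hS : S.des = Set.Icc 2 (k - 2)) (hT : T.des = Set.Icc 2 (k - 2))
    (hU : U.des = Set.Icc 2 (k - 2)) : U = S ∨ U = T := by
  have key : ∀ V : SYT n, V.des = Set.Icc 2 (k - 2) → ∃ V' : SYT n,
      KE (revComp n (rowWord V.rows)) (rowWord V'.rows) ∧
      V'.des = Set.Icc (n + 2 - k) (n - 2) := by
    intro V hV
    obtain ⟨V', hV'⟩ := V.exists_evac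
    refine ⟨V', hV', ?_⟩
    ext x
    by_cases hx : 1 ≤ x ∧ x < n
    · rw [des_evac hV' hx.1 hx.2, hV, Set.mem_Icc, Set.mem_Icc]; omega
    · refine iff_of_false (fun h => hx (V'.des_subset h)) ?_
      rw [Set.mem_Icc]; omega
  obtain ⟨S', hS1, hS2⟩ := key S hS
  obtain ⟨T', hT1, hT2⟩ := key T hT
  obtain ⟨U', hU1, hU2⟩ := key U hU
  have hne : S' ≠ T' := by rintro rfl; exact hST (evac_injective hS1 hT1)
  rcases eq_or_eq_of_des_first (by omega) (by omega) hne hS2 hT2 hU2 with rfl | rfl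
  · exact .inl (evac_injective hU1 hS1)
  · exact .inr (evac_injective hU1 hT1)

theorem des_transpose_of_eq {S : SYT n} {I : Set ℕ} (hI : IsBasicPairDescentSet n I)
    (hS : S.des = Set.Icc 1 (n - 1) \ I) : S.transpose.des = I := by
  rw [des_transpose, hS, sdiff_sdiff_right_self]
  refine inf_eq_right.2 fun x hx => ?_
  rw [Set.mem_Icc]
  rcases hI with ⟨k, h1, h2, rfl⟩ | ⟨k, h1, h2, rfl⟩ <;> rw [Set.mem_Icc] at hx <;> omega

theorem eq_or_eq_of_des {S T U : SYT n} {J : Set ℕ} (hJ : IsPairDescentSet n J) (hST : S ≠ T)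
    (hS : S.des = J) (hT : T.des = J) (hU : U.des = J) : U = S ∨ U = T := by
  have basic : ∀ {I : Set ℕ} {S T U : SYT n}, IsBasicPairDescentSet n I → S ≠ T → S.des = I →
      T.des = I → U.des = I → U = S ∨ U = T := by
    rintro I S T U (⟨k, h1, h2, rfl⟩ | ⟨k, h1, h2, rfl⟩) hST hS hT hU
    · exact eq_or_eq_of_des_first h1 h2 hST hS hT hU
    · exact eq_or_eq_of_des_second h1 h2 hST hS hT hU
  rcases hJ with hJ | ⟨I, hI, rfl⟩
  · exact basic hJ hST hS hT hU
  · exact (basic hI (fun h => hST (transpose_injective h)) (des_transpose_of_eq hI hS)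
      (des_transpose_of_eq hI hT) (des_transpose_of_eq hI hU)).imp
      transpose_injective transpose_injective

end SYT

/-! ### Superstandard hooks -/

namespace SYT

variable {n : ℕ}

theorem transpose_isHook {S : SYT n} : S.transpose.IsHook ↔ S.IsHook :=
  ⟨fun h i j hij => (h j i (mem_transpose.2 hij)).symm,
    fun h i j hij => (h j i (mem_transpose.1 hij)).symm⟩

theorem transpose_isRowSuperstandard {S : SYT n} :
    S.transpose.IsRowSuperstandard ↔ S.IsColSuperstandard := by
  have hl : ∀ i, S.transpose.shape.rowLen i = S.shape.colLen i :=
    fun i => YoungDiagram.rowLen_transpose S.shape i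
  simp only [IsRowSuperstandard, IsColSuperstandard, hl]
  exact ⟨fun h i j hij => h j i (mem_transpose.2 hij),
    fun h i j hij => h j i (mem_transpose.1 hij)⟩

/-- The witness k is the length of the first row: the entries up to k fill it, and each later entry
is one row lower than its predecessor. -/
theorem des_of_isRowSuperstandard (hn : 1 ≤ n) {S : SYT n} (hS : S.IsHook)
    (hS' : S.IsRowSuperstandard) : ∃ k, 1 ≤ k ∧ k ≤ n ∧ S.des = Set.Icc k (n - 1) := by
  have h00 : (0, 0) ∈ S.shape := by
    obtain ⟨i, j, hij, -⟩ := S.exists_cell le_rfl hn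
    exact S.shape.up_left_mem (Nat.zero_le i) (Nat.zero_le j) hij
  have hk := YoungDiagram.mem_iff_lt_rowLen.1 h00
  have h0 : ∀ j, (0, j) ∈ S.shape → S.tab 0 j = j + 1 := fun j hj => by simpa using hS' 0 j hj
  have h1 : ∀ i j, (i + 1, j) ∈ S.shape → S.tab (i + 1) j = S.shape.rowLen 0 + i + 1 := by
    intro i j hij
    have h2 : ∑ r ∈ Finset.range i, S.shape.rowLen (r + 1) = i := by
      rw [Finset.sum_congr rfl (g := fun _ => 1), Finset.sum_const]
      · simp
      · intro r hr
        rw [Finset.mem_range] at hr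
        have h3 : (r + 1, 0) ∈ S.shape :=
          S.shape.up_left_mem (by omega) (Nat.zero_le j) hij
        have h4 := YoungDiagram.mem_iff_lt_rowLen.1 h3
        by_contra h5
        have := hS (r + 1) 1 (YoungDiagram.mem_iff_lt_rowLen.2 (by omega))
        omega
    have h3 := hS' _ _ hij
    rw [Finset.sum_range_succ', h2] at h3
    have := hS _ _ hij
    omega
  refine ⟨S.shape.rowLen 0, hk, ?_, ?_⟩
  · have h2 : (0, S.shape.rowLen 0 - 1) ∈ S.shape :=
      YoungDiagram.mem_iff_lt_rowLen.2 (by omega)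
    have := h0 _ h2
    have := S.tab_mem h2
    omega
  ext x
  rw [Set.mem_Icc]
  constructor
  · intro hx
    have := S.des_subset hx
    obtain ⟨i, j, k, l, h3, h4, rfl, h6, h7⟩ := hx
    obtain ⟨k, rfl⟩ : ∃ k', k = k' + 1 := ⟨k - 1, by omega⟩
    have := h1 _ _ h4
    omega
  · rintro ⟨h2, h3⟩
    obtain ⟨i, j, h4, h5⟩ := S.exists_cell (x := x) (by omega) (by omega)
    obtain ⟨k, l, h6, h7⟩ := S.exists_cell (x := x + 1) (by omega) (by omega)
    refine ⟨i, j, k, l, h4, h6, h5, h7, ?_⟩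
    rcases k with _ | k
    · have := h0 l h6
      have := YoungDiagram.mem_iff_lt_rowLen.1 h6
      omega
    · have := h1 k l h6
      rcases i with _ | i
      · omega
      · have := h1 i j h4; omega

theorem isRowSuperstandard_of_rows {S : SYT n} {k : ℕ}
    (h : S.rows = List.range' 1 k :: (List.range' (k + 1) (n - k)).map fun x => [x]) :
    S.IsHook ∧ S.IsRowSuperstandard := by
  have h0 := S.getD_rows 0
  rw [h, List.getD_cons_zero] at h0
  have hl0 : S.shape.rowLen 0 = k := by simpa using (congrArg List.length h0).symm
  have h1 : ∀ i j, (i + 1, j) ∈ S.shape →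
      S.shape.rowLen (i + 1) = 1 ∧ S.tab (i + 1) 0 = k + i + 1 := by
    intro i j hij
    have hr := S.getD_rows (i + 1)
    have hpos := YoungDiagram.mem_iff_lt_rowLen.1 hij
    rw [h, List.getD_cons_succ] at hr
    by_cases hi : i < n - k
    · rw [List.getD_eq_getElem _ _ (by simpa)] at hr
      simp only [List.getElem_map, List.getElem_range'] at hr
      have hl : S.shape.rowLen (i + 1) = 1 := by simpa using (congrArg List.length hr).symm
      rw [hl] at hr
      simp only [List.range_one, List.map_cons, List.map_nil, List.cons.injEq, and_true] at hr
      exact ⟨hl, by omega⟩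
    · rw [List.getD_eq_default _ _ (by simpa using hi)] at hr
      have := congrArg List.length hr
      simp at this
      omega
  refine ⟨fun i j hij => ?_, fun i j hij => ?_⟩
  · rcases i with _ | i
    · exact .inl rfl
    · have := (h1 i j hij).1
      have := YoungDiagram.mem_iff_lt_rowLen.1 hij
      omega
  · have hj := YoungDiagram.mem_iff_lt_rowLen.1 hij
    rcases i with _ | i
    · have h2 := congrArg (·.getD j 0) h0
      rw [List.getD_eq_getElem _ _ (by simpa [← hl0]), List.getD_eq_getElem _ _ (by simpa)] at h2
      simp only [List.getElem_map, List.getElem_range', List.getElem_range] at h2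
      simp
      omega
    · obtain ⟨h2, h3⟩ := h1 i j hij
      obtain rfl : j = 0 := by omega
      rw [h3, Finset.sum_range_succ', hl0, Finset.sum_congr rfl (g := fun _ => 1),
        Finset.sum_const]
      · simp; omega
      · intro r hr
        rw [Finset.mem_range] at hr
        exact (h1 r 0 (S.shape.up_left_mem (by omega) le_rfl hij)).1

/-- By uniqueness of the tableau with this descent set, it is enough to look at the explicit hook.
-/
theorem isRowSuperstandard_of_des {S : SYT n} {k : ℕ} (h1 : 1 ≤ k) (h2 : k ≤ n)
    (hS : S.des = Set.Icc k (n - 1)) : S.IsHook ∧ S.IsRowSuperstandard := by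
  obtain ⟨T, hT⟩ := exists_of_isTab (isTab_hookRows h1) (isWord_hookRows h1 h2)
  have hT' : T.des = Set.Icc k (n - 1) := by
    rw [← T.desWord_rowWord, hT, desWord_hookRows h1 h2]
  rw [eq_of_des_eq (hS ▸ .inr ⟨k, h1, h2, rfl⟩) (hS.trans hT'.symm)]
  exact isRowSuperstandard_of_rows hT

theorem isSuperstandardHook_iff (hn : 1 ≤ n) {S : SYT n} :
    S.IsSuperstandardHook ↔ IsHookDescentSet n S.des := by
  constructor
  · rintro ⟨h1, h2 | h2⟩
    · exact .inr (des_of_isRowSuperstandard hn h1 h2)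
    · obtain ⟨k, h3, h4, h5⟩ := des_of_isRowSuperstandard hn (transpose_isHook.2 h1)
        (transpose_isRowSuperstandard.2 h2)
      refine .inl ⟨k - 1, by omega, ?_⟩
      have h6 := S.transpose.des_transpose
      rw [transpose_transpose, h5] at h6
      rw [h6]
      ext x
      simp only [Set.mem_sdiff, Set.mem_Icc]
      omega
  · rintro (⟨k, hk, hS⟩ | ⟨k, h1, h2, hS⟩)
    · have h3 : S.transpose.des = Set.Icc (k + 1) (n - 1) := by
        rw [des_transpose, hS]
        ext x
        simp only [Set.mem_sdiff, Set.mem_Icc]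
        omega
      obtain ⟨h4, h5⟩ := isRowSuperstandard_of_des (by omega) hk h3
      exact ⟨transpose_isHook.1 h4, .inr (transpose_isRowSuperstandard.1 h5)⟩
    · obtain ⟨h4, h5⟩ := isRowSuperstandard_of_des h1 h2 hS
      exact ⟨h4, .inl h5⟩

/-! ### The displayed pairs -/

theorem ne_of_isFirstPair {S T : SYT n} (h : IsFirstPair S T) : S ≠ T := by
  rintro rfl
  obtain ⟨k, h1, h2, h3, h4⟩ := h
  have := congrArg (fun l => (l.getD 0 []).length) (h3.symm.trans h4)
  simp at this

theorem ne_of_isSecondPair {S T : SYT n} (h : IsSecondPair S T) : S ≠ T := by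
  rintro rfl
  obtain ⟨k, h1, h2, h3, h4⟩ := h
  have := congrArg (fun l => (l.getD 0 []).length) (h3.symm.trans h4)
  simp at this
  omega

theorem des_eq_of_isFirstPair {S T : SYT n} (h : IsFirstPair S T) :
    ∃ J, IsBasicPairDescentSet n J ∧ S.des = J ∧ T.des = J := by
  obtain ⟨k, h1, h2, h3, h4⟩ := h
  refine ⟨Set.Icc k (n - 2), .inl ⟨k, h1, h2, rfl⟩, ?_, ?_⟩
  · rw [← S.desWord_rowWord, h3, desWord_first_left h1 h2]
  · rw [← T.desWord_rowWord, h4, desWord_first_right h1 h2]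

theorem des_eq_of_isSecondPair {S T : SYT n} (h : IsSecondPair S T) :
    ∃ J, IsBasicPairDescentSet n J ∧ S.des = J ∧ T.des = J := by
  obtain ⟨k, h1, h2, h3, h4⟩ := h
  refine ⟨Set.Icc 2 (k - 2), .inr ⟨k, h1, h2, rfl⟩, ?_, ?_⟩
  · rw [← S.desWord_rowWord, h3, desWord_second_left h1]
  · rw [← T.desWord_rowWord, h4, desWord_second_right h1 h2]

theorem des_eq_of_isDisplayedPair {S T : SYT n} (h : IsDisplayedPair S T) :
    ∃ J, IsPairDescentSet n J ∧ S.des = J ∧ T.des = J := by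
  have key : ∀ {S T : SYT n}, (∃ J, IsBasicPairDescentSet n J ∧ S.transpose.des = J ∧
      T.transpose.des = J) → ∃ J, IsPairDescentSet n J ∧ S.des = J ∧ T.des = J := by
    rintro S T ⟨J, h1, h2, h3⟩
    refine ⟨_, .inr ⟨J, h1, rfl⟩, ?_, ?_⟩
    · rw [← h2, ← des_transpose, transpose_transpose]
    · rw [← h3, ← des_transpose, transpose_transpose]
  rcases h with h | h | h | h
  · obtain ⟨J, h1, h2⟩ := des_eq_of_isFirstPair h
    exact ⟨J, .inl h1, h2⟩
  · obtain ⟨J, h1, h2⟩ := des_eq_of_isSecondPair h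
    exact ⟨J, .inl h1, h2⟩
  · exact key (des_eq_of_isFirstPair h)
  · exact key (des_eq_of_isSecondPair h)

theorem exists_pair {J : Set ℕ} (hJ : IsBasicPairDescentSet n J) :
    ∃ A B : SYT n, A ≠ B ∧ A.des = J ∧ B.des = J ∧ (IsFirstPair A B ∨ IsSecondPair A B) := by
  rcases hJ with ⟨k, h1, h2, rfl⟩ | ⟨k, h1, h2, rfl⟩
  · obtain ⟨A, hA⟩ := exists_of_isTab (isTab_first_left h1 h2) (isWord_first_left h1 h2)
    obtain ⟨B, hB⟩ := exists_of_isTab (isTab_first_right h1 h2) (isWord_first_right h1 h2)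
    have hAB : IsFirstPair A B := ⟨k, h1, h2, hA, hB⟩
    refine ⟨A, B, ne_of_isFirstPair hAB, ?_, ?_, .inl hAB⟩
    · rw [← A.desWord_rowWord, hA, desWord_first_left h1 h2]
    · rw [← B.desWord_rowWord, hB, desWord_first_right h1 h2]
  · obtain ⟨A, hA⟩ := exists_of_isTab (isTab_second_left h1) (isWord_second_left h1 h2)
    obtain ⟨B, hB⟩ := exists_of_isTab (isTab_second_right h1) (isWord_second_right h1 h2)
    have hAB : IsSecondPair A B := ⟨k, h1, h2, hA, hB⟩
    refine ⟨A, B, ne_of_isSecondPair hAB, ?_, ?_, .inr hAB⟩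
    · rw [← A.desWord_rowWord, hA, desWord_second_left h1]
    · rw [← B.desWord_rowWord, hB, desWord_second_right h1 h2]

/-- Some displayed pair has descent set J, and it exhausts the tableaux with this descent set, so S
and T are its members in some order. -/
theorem isBasicPair_of_des {S T : SYT n} {J : Set ℕ} (hJ : IsBasicPairDescentSet n J)
    (hST : S ≠ T) (hS : S.des = J) (hT : T.des = J) :
    (IsFirstPair S T ∨ IsSecondPair S T) ∨ IsFirstPair T S ∨ IsSecondPair T S := by
  obtain ⟨A, B, hAB, hA, hB, h⟩ := exists_pair hJ
  rcases eq_or_eq_of_des (.inl hJ) hAB hA hB hS with rfl | rfl <;>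
    rcases eq_or_eq_of_des (.inl hJ) hAB hA hB hT with rfl | rfl
  · exact absurd rfl hST
  · exact .inl h
  · exact .inr h
  · exact absurd rfl hST

theorem isDisplayedPair_of_des {S T : SYT n} {J : Set ℕ} (hJ : IsPairDescentSet n J)
    (hST : S ≠ T) (hS : S.des = J) (hT : T.des = J) :
    IsDisplayedPair S T ∨ IsDisplayedPair T S := by
  rcases hJ with hJ | ⟨I, hI, rfl⟩
  · rcases isBasicPair_of_des hJ hST hS hT with (h | h) | h | h
    · exact .inl (.inl h)
    · exact .inl (.inr (.inl h))
    · exact .inr (.inl h)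
    · exact .inr (.inr (.inl h))
  · rcases isBasicPair_of_des hI (fun h => hST (transpose_injective h))
      (des_transpose_of_eq hI hS) (des_transpose_of_eq hI hT) with (h | h) | h | h
    · exact .inl (.inr (.inr (.inl h)))
    · exact .inl (.inr (.inr (.inr h)))
    · exact .inr (.inr (.inr (.inl h)))
    · exact .inr (.inr (.inr (.inr h)))

end SYT

/-! ### The main theorem -/

theorem K_subset {n : ℕ} (S : SYT n) : K S ⊆ (D n S.des)⁻¹ := fun _ h =>
  mem_inv_D_iff.2 (desWord_of_mem_K h)

theorem exists_mem_K_of_mem_inv_D {n : ℕ} {J : Set ℕ} {π : Equiv.Perm (Fin n)}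
    (h : π ∈ (D n J)⁻¹) : ∃ U : SYT n, π ∈ K U ∧ U.des = J := by
  obtain ⟨U, hU⟩ := exists_mem_K π
  exact ⟨U, hU, (desWord_of_mem_K hU).symm.trans (mem_inv_D_iff.1 h)⟩

theorem inv_D_eq_K {n : ℕ} {S : SYT n} (hS : IsHookDescentSet n S.des) :
    (D n S.des)⁻¹ = K S := by
  refine Set.Subset.antisymm (fun π hπ => ?_) (K_subset S)
  obtain ⟨U, hU, hU'⟩ := exists_mem_K_of_mem_inv_D hπ
  rwa [SYT.eq_of_des_eq hS hU'.symm]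

theorem inv_D_eq_union {n : ℕ} {S T : SYT n} {J : Set ℕ} (hJ : IsPairDescentSet n J) (hST : S ≠ T)
    (hS : S.des = J) (hT : T.des = J) : (D n J)⁻¹ = K S ∪ K T := by
  refine Set.Subset.antisymm (fun π hπ => ?_) (Set.union_subset (hS ▸ K_subset S)
    (hT ▸ K_subset T))
  obtain ⟨U, hU, hU'⟩ := exists_mem_K_of_mem_inv_D hπ
  rcases SYT.eq_or_eq_of_des hJ hST hS hT hU' with rfl | rfl
  · exact .inl hU
  · exact .inr hU

/-- A union of two inverse descent classes, of hook type or of pair type. -/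
def IsDescentUnion {n : ℕ} (Pi : Set (Equiv.Perm (Fin n))) : Prop :=
  ∃ J L : Set ℕ, Pi = (D n J)⁻¹ ∪ (D n L)⁻¹ ∧
    ((J ≠ L ∧ IsHookDescentSet n J ∧ IsHookDescentSet n L) ∨ (J = L ∧ IsPairDescentSet n J))

theorem isDescentUnion_of_hooks {n : ℕ} {S T : SYT n} (hST : S ≠ T)
    (hS : IsHookDescentSet n S.des) (hT : IsHookDescentSet n T.des) :
    IsDescentUnion (K S ∪ K T) :=
  ⟨S.des, T.des, by rw [inv_D_eq_K hS, inv_D_eq_K hT],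
    .inl ⟨fun h => hST (SYT.eq_of_des_eq hS h), hS, hT⟩⟩

theorem isDescentUnion_of_pair {n : ℕ} {S T : SYT n} {J : Set ℕ} (hJ : IsPairDescentSet n J)
    (hST : S ≠ T) (hS : S.des = J) (hT : T.des = J) : IsDescentUnion (K S ∪ K T) :=
  ⟨J, J, by rw [inv_D_eq_union hJ hST hS hT, Set.union_self], .inr ⟨rfl, hJ⟩⟩

theorem isDescentUnion_of_patternKnuthClosed {n : ℕ} (hn : 1 ≤ n) {S T : SYT n} (hST : S ≠ T)
    (h : PatternKnuthClosed (K S ∪ K T)) : IsDescentUnion (K S ∪ K T) := by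
  have h1 := descentSets_of_delClosed hn S.isWord_rowWord T.isWord_rowWord
    (delClosed_of_patternKnuthClosed h)
    (delClosed_of_patternKnuthClosed (by rwa [Set.union_comm]))
  rw [S.desWord_rowWord, T.desWord_rowWord] at h1
  rcases h1 with ⟨h1, h2⟩ | ⟨h1, h2⟩
  · exact isDescentUnion_of_hooks hST h1 h2
  · exact isDescentUnion_of_pair h2 hST rfl h1

/-- A Knuth class is nonempty, so any of its permutations reveals the descent set of the tableau. -/
theorem des_mem_of_eq_union {n : ℕ} {S : SYT n} {Pi : Set (Equiv.Perm (Fin n))} {J L : Set ℕ}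
    (hS : K S ⊆ Pi) (h : Pi = (D n J)⁻¹ ∪ (D n L)⁻¹) : S.des = J ∨ S.des = L := by
  obtain ⟨π, hπ⟩ := K_nonempty S
  rw [← desWord_of_mem_K hπ]
  exact (h ▸ hS hπ : π ∈ (D n J)⁻¹ ∪ (D n L)⁻¹).imp mem_inv_D_iff.1 mem_inv_D_iff.1

end PatternKnuth

theorem mainTheorem2 (n : ℕ) (S T : PatternKnuth.SYT n) (hST : S ≠ T)
    (Pi : Set (Equiv.Perm (Fin n))) (hPi : Pi = PatternKnuth.K S ∪ PatternKnuth.K T) :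
    List.TFAE
      [ PatternKnuth.PatternKnuthClosed Pi,
        PatternKnuth.SwapClosed Pi,
        ∃ J L : Set ℕ, Pi = (PatternKnuth.D n J)⁻¹ ∪ (PatternKnuth.D n L)⁻¹ ∧
          ((J ≠ L ∧ PatternKnuth.IsHookDescentSet n J ∧ PatternKnuth.IsHookDescentSet n L) ∨
            (J = L ∧ PatternKnuth.IsPairDescentSet n J)),
        (S.IsSuperstandardHook ∧ T.IsSuperstandardHook) ∨
          PatternKnuth.IsDisplayedPair S T ∨ PatternKnuth.IsDisplayedPair T S ] := by
  have hn : 1 ≤ n := by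
    by_contra hn
    -- For n = 0 the empty tableau is the only one, which contradicts S ≠ T.
    refine hST (PatternKnuth.SYT.eq_of_mem_rows_iff fun i x => ?_)
    rw [PatternKnuth.SYT.mem_getD_rows, PatternKnuth.SYT.mem_getD_rows]
    refine iff_of_false ?_ ?_ <;> rintro ⟨j, hj, -⟩
    · have := S.tab_mem hj; omega
    · have := T.tab_mem hj; omega
  tfae_have 1 → 3 := by
    subst hPi
    exact PatternKnuth.isDescentUnion_of_patternKnuthClosed hn hST
  tfae_have 3 → 2 := fun ⟨J, L, h, _⟩ => PatternKnuth.swapClosed_of_eq_union h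
  tfae_have 2 → 1 := PatternKnuth.patternKnuthClosed_of_swapClosed
  tfae_have 3 → 4 := by
    rintro ⟨J, L, h, h'⟩
    have hS := PatternKnuth.des_mem_of_eq_union (S := S) (by simp [hPi]) h
    have hT := PatternKnuth.des_mem_of_eq_union (S := T) (by simp [hPi]) h
    rcases h' with ⟨-, hJ, hL⟩ | ⟨rfl, hJ⟩
    · left
      rw [PatternKnuth.SYT.isSuperstandardHook_iff hn, PatternKnuth.SYT.isSuperstandardHook_iff hn]
      exact ⟨by rcases hS with h | h <;> rwa [h], by rcases hT with h | h <;> rwa [h]⟩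
    · exact .inr (PatternKnuth.SYT.isDisplayedPair_of_des hJ hST (or_self_iff.1 hS)
        (or_self_iff.1 hT))
  tfae_have 4 → 3 := by
    subst hPi
    rintro (⟨h1, h2⟩ | h | h)
    · exact PatternKnuth.isDescentUnion_of_hooks hST
        ((PatternKnuth.SYT.isSuperstandardHook_iff hn).1 h1)
        ((PatternKnuth.SYT.isSuperstandardHook_iff hn).1 h2)
    · obtain ⟨J, hJ, h1, h2⟩ := PatternKnuth.SYT.des_eq_of_isDisplayedPair h
      exact PatternKnuth.isDescentUnion_of_pair hJ hST h1 h2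
    · obtain ⟨J, hJ, h1, h2⟩ := PatternKnuth.SYT.des_eq_of_isDisplayedPair h
      exact PatternKnuth.isDescentUnion_of_pair hJ hST h2 h1
  tfae_finish
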